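/- Let $\sigma$ be a finite relational signature and let $\mathcal{B}$ be a fixed finite $\sigma$-structure with domain $B$. Let $\{\exists,\forall,\wedge,\vee\}\text{-}\mathsf{FO}(\mathcal{B})$ be the following decision problem: the input is a sentence $\varphi$ of first-order logic over $\sigma$ built from atoms $R(v_1,\ldots,v_k)$ with $R\in\sigma$ (no equality) using only $\wedge$, $\vee$, $\exists$, $\forall$; the question is whether $\mathcal{B}\models\varphi$. A *surjective hyper-operation* (shop) on $B$ is a function $f$ from $B$ to the set of non-empty subsets of $B$ such that every $y\in B$ lies in $f(x)$ for some $x\in B$. A *surjective hyper-endomorphism* (she) of $\mathcal{B}$ is a shop $f$ on $B$ such that for every $k$-ary $R\in\sigma$, if $\mathcal{B}\models R(x_1,\ldots,x_k)$ then $\mathcal{B}\models R(y_1,\ldots,y_k)$ for all $y_1\in f(x_1),\ldots,y_k\in f(x_k)$. A shop $f$ is an *$\mathsf{A}$-shop* if $f(b)=B$ for some $b\in B$, and an *$\mathsf{E}$-shop* if there is $b\in B$ with $b\in f(x)$ for all $x\in B$. **Theorem.** 1. If $\mathcal{B}$ has an $\mathsf{A}$-shop as a she, then $\{\exists,\forall,\wedge,\vee\}\text{-}\mathsf{FO}(\mathcal{B})$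 is in NP. 2. If $\mathcal{B}$ has an $\mathsf{E}$-shop as a she, then $\{\exists,\forall,\wedge,\vee\}\text{-}\mathsf{FO}(\mathcal{B})$ is in coNP. 3. If $\mathcal{B}$ has both an $\mathsf{A}$-shop and an $\mathsf{E}$-shop as shes, then $\{\exists,\forall,\wedge,\vee\}\text{-}\mathsf{FO}(\mathcal{B})$ is in Logspace (deterministic logarithmic space). -/

import Mathlib

universe u v w

/-! ### Off-line multi-tape Turing machines -/

/-- What a machine sees under its input head: the left end-marker, a letter of the input, or the
right end-marker. -/
inductive InputSymbol (α : Type u) : Type u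
  | leftEnd : InputSymbol α
  | letter (a : α) : InputSymbol α
  | rightEnd : InputSymbol α

/-- A head movement. -/
inductive HeadMove : Type
  | left
  | stay
  | right

/-- The position of a head after a movement; on cell `0` a movement to the left has no effect. -/
def HeadMove.apply : HeadMove → ℕ → ℕ
  | .left, i => i - 1
  | .stay, i => i
  | .right, i => i + 1

/-- A deterministic Turing machine over the finite input alphabet `α`, with a two-way read-only
input tape, and finitely many one-way infinite read-write work tapes. A state whose `verdict` is
`some true` (`some false`) is an accepting (rejecting) halting state. -/
structure OfflineTM (α : Type u) [Finite α] where
  State : Type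
  finite_state : Finite State
  WorkSymbol : Type
  finite_workSymbol : Finite WorkSymbol
  blank : WorkSymbol
  tapes : ℕ
  start : State
  verdict : State → Option Bool
  trans : State → InputSymbol α → (Fin tapes → WorkSymbol) →
    State × HeadMove × (Fin tapes → WorkSymbol × HeadMove)

namespace OfflineTM

/-- The content of cell `i` of the input tape: the left end-marker is on cell `0`, the input `x` on
cells `1, …, |x|`, and the right end-marker on cell `|x| + 1`. -/
def inputAt {α : Type u} (x : List α) : ℕ → InputSymbol α
  | 0 => .leftEnd
  | i + 1 =>
    match x[i]? with
    | some a => .letter a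
    | none => .rightEnd

variable {α : Type u} [Finite α]

/-- A configuration; the input is not part of it, since it never changes. -/
structure Config (M : OfflineTM α) where
  state : M.State
  inputHead : ℕ
  workHead : Fin M.tapes → ℕ
  work : Fin M.tapes → ℕ → M.WorkSymbol

/-- The initial configuration: all heads on cell `0`, all work tapes blank. -/
def initialConfig (M : OfflineTM α) : M.Config where
  state := M.start
  inputHead := 0
  workHead := fun _ => 0
  work := fun _ _ => M.blank

/-- One step on input `x`. Halting configurations do not change. The input head
cannot move beyond the right end-marker. -/
def next (M : OfflineTM α) (x : List α) (c : M.Config) : M.Config :=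
  match M.verdict c.state with
  | some _ => c
  | none =>
    let r := M.trans c.state (inputAt x c.inputHead) (fun k => c.work k (c.workHead k))
    { state := r.1
      inputHead := min (r.2.1.apply c.inputHead) (x.length + 1)
      workHead := fun k => (r.2.2 k).2.apply (c.workHead k)
      work := fun k => Function.update (c.work k) (c.workHead k) (r.2.2 k).1 }

/-- The configuration after `t` steps on input `x`. -/
def run (M : OfflineTM α) (x : List α) (t : ℕ) : M.Config :=
  (M.next x)^[t] M.initialConfig

/-- `M` halts on `x` within `t` steps, and it accepts `x` if `x ∈ A` and rejects `x` otherwise. -/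
def AnswersWithin (M : OfflineTM α) (A : Language α) (x : List α) (t : ℕ) : Prop :=
  (x ∈ A ∧ M.verdict (M.run x t).state = some true) ∨
    (x ∉ A ∧ M.verdict (M.run x t).state = some false)

/-- During its computation on `x`, `M` visits only the first `s` cells of each work tape. -/
def UsesSpaceAtMost (M : OfflineTM α) (x : List α) (s : ℕ) : Prop :=
  ∀ (t : ℕ) (k : Fin M.tapes), (M.run x t).workHead k < s

end OfflineTM

/-! ### Complexity classes -/

/-- Decidable in deterministic polynomial time. -/
def InPtime {α : Type u} [Finite α] (A : Language α) : Prop :=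
  ∃ (M : OfflineTM α) (p : Polynomial ℕ), ∀ x : List α, M.AnswersWithin A x (p.eval x.length)

/-- Decidable in deterministic logarithmic space. -/
def InLogspace {α : Type u} [Finite α] (A : Language α) : Prop :=
  ∃ (M : OfflineTM α) (c : ℕ), ∀ x : List α,
    (∃ t, M.AnswersWithin A x t) ∧ M.UsesSpaceAtMost x (c * Nat.log 2 x.length + c)

/-- Nondeterministic polynomial time: membership of `x` is witnessed by a certificate `y`, a word
over a finite alphabet `Γ` of length polynomial in that of `x`, which is checked in polynomial time.
The pair of `x` and `y` is the concatenation of the two words over the disjoint union of their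
alphabets. -/
def InNP {α : Type u} [Finite α] (A : Language α) : Prop :=
  ∃ (Γ : Type) (_ : Finite Γ) (V : Language (α ⊕ Γ)) (p : Polynomial ℕ), InPtime V ∧
    ∀ x : List α, x ∈ A ↔
      ∃ y : List Γ, y.length ≤ p.eval x.length ∧ x.map Sum.inl ++ y.map Sum.inr ∈ V

/-- The complements of the languages in NP. -/
def InCoNP {α : Type u} [Finite α] (A : Language α) : Prop :=
  InNP Aᶜ

/-! ### Positive equality-free first-order logic -/

/-- Formulas of `{∃, ∀, ∧, ∨}`-FO over the relation symbols of `σ`, without equality. The variables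
are `x₀, x₁, x₂, …`, given by their indices. -/
inductive PosFormula (σ : FirstOrder.Language.{u, v}) : Type v
  | rel {n : ℕ} (R : σ.Relations n) (x : Fin n → ℕ) : PosFormula σ
  | and (φ ψ : PosFormula σ) : PosFormula σ
  | or (φ ψ : PosFormula σ) : PosFormula σ
  | all (i : ℕ) (φ : PosFormula σ) : PosFormula σ
  | ex (i : ℕ) (φ : PosFormula σ) : PosFormula σ

/-- The alphabet in which formulas are written: the relation symbols, connectives, quantifiers,
parentheses, the letter `x`, and the binary digits for the indices of variables. -/
inductive Token (σ : FirstOrder.Language.{u, v}) : Type v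
  | rel (R : Σ n, σ.Relations n) : Token σ
  | and : Token σ
  | or : Token σ
  | all : Token σ
  | ex : Token σ
  | lparen : Token σ
  | rparen : Token σ
  | var : Token σ
  | digit (b : Bool) : Token σ

instance Token.instFinite (σ : FirstOrder.Language.{u, v}) [Finite (Σ n, σ.Relations n)] :
    Finite (Token σ) := by
  let f : Token σ → (Σ n, σ.Relations n) ⊕ (Bool ⊕ Fin 7) := fun t =>
    match t with
    | .rel R => Sum.inl R
    | .digit b => Sum.inr (Sum.inl b)
    | .and => Sum.inr (Sum.inr 0)
    | .or => Sum.inr (Sum.inr 1)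
    | .all => Sum.inr (Sum.inr 2)
    | .ex => Sum.inr (Sum.inr 3)
    | .lparen => Sum.inr (Sum.inr 4)
    | .rparen => Sum.inr (Sum.inr 5)
    | .var => Sum.inr (Sum.inr 6)
  refine Finite.of_injective f ?_
  intro s t h
  cases s <;> cases t <;> simp_all [f]

namespace PosFormula

variable {σ : FirstOrder.Language.{u, v}}

/-- The set of indices of the free variables. -/
def free : PosFormula σ → Set ℕ
  | rel _ x => Set.range x
  | and φ ψ => φ.free ∪ ψ.free
  | or φ ψ => φ.free ∪ ψ.free
  | all i φ => φ.free \ {i}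
  | ex i φ => φ.free \ {i}

/-- A sentence is a formula without free variables. -/
def IsSentence (φ : PosFormula σ) : Prop :=
  φ.free = ∅

/-- Tarski's truth definition, under the assignment `s`. -/
def Realize {B : Type w} [σ.Structure B] : PosFormula σ → (ℕ → B) → Prop
  | rel R x, s => FirstOrder.Language.Structure.RelMap R (fun j => s (x j))
  | and φ ψ, s => φ.Realize s ∧ ψ.Realize s
  | or φ ψ, s => φ.Realize s ∨ ψ.Realize s
  | all i φ, s => ∀ b : B, φ.Realize (Function.update s i b)
  | ex i φ, s => ∃ b : B, φ.Realize (Function.update s i b)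

/-- The variable `xᵢ` is written as the letter `x` followed by the binary digits of `i`, least
significant digit first. -/
def encodeVar (i : ℕ) : List (Token σ) :=
  Token.var :: (Nat.bits i).map Token.digit

/-- A formula as a word, in the usual fully parenthesised infix notation. -/
def encode : PosFormula σ → List (Token σ)
  | @rel _ n R x => Token.rel ⟨n, R⟩ :: (List.ofFn x).flatMap encodeVar
  | and φ ψ => Token.lparen :: (φ.encode ++ Token.and :: (ψ.encode ++ [Token.rparen]))
  | or φ ψ => Token.lparen :: (φ.encode ++ Token.or :: (ψ.encode ++ [Token.rparen]))
  | all i φ => Token.all :: (encodeVar i ++ φ.encode)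
  | ex i φ => Token.ex :: (encodeVar i ++ φ.encode)

end PosFormula

/-- The problem `{∃, ∀, ∧, ∨}`-FO(B) for a fixed `σ`-structure `B`: the language of all (words that
write) sentences of `{∃, ∀, ∧, ∨}`-FO that are true in `B`. -/
def positiveEvaluation (σ : FirstOrder.Language.{u, v}) (B : Type w) [σ.Structure B] :
    Language (Token σ) :=
  {word | ∃ φ : PosFormula σ, φ.IsSentence ∧ (∀ s : ℕ → B, φ.Realize s) ∧ φ.encode = word}

/-! ### Surjective hyper-operations and surjective hyper-endomorphisms -/

/-- `f` is a surjective hyper-operation (shop) on `B`. -/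
structure IsShop {B : Type w} (f : B → Set B) : Prop where
  total : ∀ x, (f x).Nonempty
  surjective : ∀ y, ∃ x, y ∈ f x

/-- `f` is a surjective hyper-endomorphism (she) of the `σ`-structure `B`. -/
structure IsShe (σ : FirstOrder.Language.{u, v}) {B : Type w} [σ.Structure B] (f : B → Set B) :
    Prop where
  isShop : IsShop f
  preserves : ∀ (n : ℕ) (R : σ.Relations n) (x y : Fin n → B),
    FirstOrder.Language.Structure.RelMap R x → (∀ j, y j ∈ f (x j)) →
      FirstOrder.Language.Structure.RelMap R y

/-- `f` is an A-shop: a shop with `f(b) = B` for some `b`. -/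
def IsAShop {B : Type w} (f : B → Set B) : Prop :=
  IsShop f ∧ ∃ b, f b = Set.univ

/-- `f` is an E-shop: a shop such that some `b` lies in `f(x)` for all `x`. -/
def IsEShop {B : Type w} (f : B → Set B) : Prop :=
  IsShop f ∧ ∃ b, ∀ x, b ∈ f x

-- The logical core is to give every quantifier occurrence one value that depends only on its
-- position in the word; `PosFormula.Holds` is truth under such values.
--
-- Let `h` be a she with `h a = B`. If a sentence holds with every universal quantifier evaluated at
-- `a` and every existential one at some prescribed value, then it is true (`realize_of_holds`). The
-- induction keeps two assignments with `s' i ∈ h (s i)`: atoms pass from `s` to `s'` by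
-- preservation, every element lies in `h a` and so may be given to a universal variable, and an
-- existential witness is taken from the non-empty image of the prescribed value. Conversely, a true
-- sentence has suitable existential values, because the universal variables range over `a` only
-- (`exists_holds`). These values form a certificate of one letter per position, whence NP.
--
-- Dually, let `e` lie in all `h x`. A true sentence holds with all existential quantifiers at `e`,
-- whatever values the universal ones get, by surjectivity (`holds_of_realize`), and a false one is
-- refuted by some universal values (`exists_not_holds`); this gives coNP. With both shes, the
-- values `a` for ∀ and `e` for ∃ decide truth without a certificate.
--
-- It remains to check in logarithmic space that a word is a sentence which holds under given values
-- (`logFn_check`, `check_encode`). Evaluation from left to right needs no stack, since a decisive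
-- first operand lets the rest of the pair of parentheses be skipped, and otherwise the value of the
-- pair is that of its second operand. The quantifier of a variable is found by a scan to the left
-- that counts parentheses and compares digits. The parser is a finite automaton with a counter
-- which learns the status of the innermost open pair from another scan to the left. So a fixed
-- number of positions and counters suffices.
--
-- To avoid programming Turing machines directly, `LogFn` collects the functions that are computed
-- by structured programs on registers whose contents stay linear in the input length. It is closed
-- under composition, case distinction and bounded loops. Binary counters on the work tapes simulate
-- the registers (`RegProg.Runs.reach`, `LogFn.inLogspace`), and counting configurations turns the
-- verifiers into polynomial-time machines (`InLogspace.inPtime`).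

universe u₁ u₂ u₃

/-! ### Register programs -/

/-- Structured programs acting on a two-way read-only input head and on registers that hold natural
numbers. -/
inductive RegProg (α : Type u) : Type u
  | inc (i : ℕ) : RegProg α
  | move (m : HeadMove) : RegProg α
  | seq (P Q : RegProg α) : RegProg α
  /-- If register `i` is positive, decrement it and run `P`; otherwise run `Q`. -/
  | ifPos (i : ℕ) (P Q : RegProg α) : RegProg α
  /-- As long as register `i` is positive, decrement it and run `P`. -/
  | loop (i : ℕ) (P : RegProg α) : RegProg α
  | ifSym (p : InputSymbol α → Bool) (P Q : RegProg α) : RegProg α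
  | loopSym (p : InputSymbol α → Bool) (P : RegProg α) : RegProg α

/-- Instructions of a register machine with set of labels `β`. -/
inductive RegInstr (α : Type u) (β : Type) : Type u
  | inc (i : ℕ) (q : β) : RegInstr α β
  | dec (i : ℕ) (zero pos : β) : RegInstr α β
  | move (m : HeadMove) (q : β) : RegInstr α β
  | test (p : InputSymbol α → Bool) (yes no : β) : RegInstr α β
  | halt (b : Bool) : RegInstr α β

namespace RegInstr

variable {α : Type u} {β γ : Type}

def map (f : β → γ) : RegInstr α β → RegInstr α γ
  | inc i q => inc i (f q)
  | dec i z p => dec i (f z) (f p)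
  | move m q => move m (f q)
  | test p y n => test p (f y) (f n)
  | halt b => halt b

theorem map_map_eq {δ : Type} {f : β → γ} {g : γ → δ} {h : β → δ} (I : RegInstr α β)
    (H : ∀ o, g (f o) = h o) : (I.map f).map g = I.map h := by
  cases I <;> simp [map, H]

end RegInstr

namespace RegProg

variable {α : Type u}

/-- `Runs x N P h r h' r'`: on input `x`, the program `P` started with the input head on cell `h` and
register contents `r` terminates with head position `h'` and register contents `r'`, and never
increments a register beyond `N`. -/
inductive Runs (x : List α) (N : ℕ) : RegProg α → ℕ → (ℕ → ℕ) → ℕ → (ℕ → ℕ) → Prop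
  | inc {i h r} (hN : r i + 1 ≤ N) : Runs x N (inc i) h r h (Function.update r i (r i + 1))
  | move {m h r} : Runs x N (move m) h r (min (m.apply h) (x.length + 1)) r
  | seq {P Q h₁ r₁ h₂ r₂ h₃ r₃} (hP : Runs x N P h₁ r₁ h₂ r₂) (hQ : Runs x N Q h₂ r₂ h₃ r₃) :
      Runs x N (seq P Q) h₁ r₁ h₃ r₃
  | ifPos_pos {i n P Q h r h' r'} (hi : r i = n + 1)
      (hP : Runs x N P h (Function.update r i n) h' r') : Runs x N (ifPos i P Q) h r h' r'
  | ifPos_zero {i P Q h r h' r'} (hi : r i = 0) (hQ : Runs x N Q h r h' r') :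
      Runs x N (ifPos i P Q) h r h' r'
  | loop_zero {i P h r} (hi : r i = 0) : Runs x N (loop i P) h r h r
  | loop_pos {i n P h₁ r₁ h₂ r₂ h₃ r₃} (hi : r₁ i = n + 1)
      (hP : Runs x N P h₁ (Function.update r₁ i n) h₂ r₂)
      (hl : Runs x N (loop i P) h₂ r₂ h₃ r₃) : Runs x N (loop i P) h₁ r₁ h₃ r₃
  | ifSym_true {p P Q h r h' r'} (hp : p (OfflineTM.inputAt x h) = true)
      (hP : Runs x N P h r h' r') : Runs x N (ifSym p P Q) h r h' r'
  | ifSym_false {p P Q h r h' r'} (hp : p (OfflineTM.inputAt x h) = false)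
      (hQ : Runs x N Q h r h' r') : Runs x N (ifSym p P Q) h r h' r'
  | loopSym_false {p P h r} (hp : p (OfflineTM.inputAt x h) = false) :
      Runs x N (loopSym p P) h r h r
  | loopSym_true {p P h₁ r₁ h₂ r₂ h₃ r₃} (hp : p (OfflineTM.inputAt x h₁) = true)
      (hP : Runs x N P h₁ r₁ h₂ r₂) (hl : Runs x N (loopSym p P) h₂ r₂ h₃ r₃) :
      Runs x N (loopSym p P) h₁ r₁ h₃ r₃

/-- A bound on the registers that occur in a program. -/
def regs : RegProg α → ℕ
  | inc i => i + 1
  | move _ => 0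
  | seq P Q => max P.regs Q.regs
  | ifPos i P Q => max (i + 1) (max P.regs Q.regs)
  | loop i P => max (i + 1) P.regs
  | ifSym _ P Q => max P.regs Q.regs
  | loopSym _ P => P.regs

/-- The program points. -/
def State : RegProg α → Type
  | inc _ => Unit
  | move _ => Unit
  | seq P Q => P.State ⊕ Q.State
  | ifPos _ P Q => Option (P.State ⊕ Q.State)
  | loop _ P => Option P.State
  | ifSym _ P Q => Option (P.State ⊕ Q.State)
  | loopSym _ P => Option P.State

theorem finite_state : ∀ P : RegProg α, Finite P.State
  | inc _ => inferInstanceAs (Finite Unit)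
  | move _ => inferInstanceAs (Finite Unit)
  | seq P Q => by
      have := finite_state P; have := finite_state Q
      exact inferInstanceAs (Finite (P.State ⊕ Q.State))
  | ifPos _ P Q => by
      have := finite_state P; have := finite_state Q
      exact inferInstanceAs (Finite (Option (P.State ⊕ Q.State)))
  | loop _ P => by
      have := finite_state P
      exact inferInstanceAs (Finite (Option P.State))
  | ifSym _ P Q => by
      have := finite_state P; have := finite_state Q
      exact inferInstanceAs (Finite (Option (P.State ⊕ Q.State)))
  | loopSym _ P => by
      have := finite_state P
      exact inferInstanceAs (Finite (Option P.State))

/-- The entry point. -/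
def entry : (P : RegProg α) → P.State
  | inc _ => ()
  | move _ => ()
  | seq P _ => Sum.inl P.entry
  | ifPos _ _ _ => (none : Option _)
  | loop _ _ => (none : Option _)
  | ifSym _ _ _ => (none : Option _)
  | loopSym _ _ => (none : Option _)

/-- The instruction at a program point; the label `none` is the exit. -/
def instr : (P : RegProg α) → P.State → RegInstr α (Option P.State)
  | inc i, _ => .inc i none
  | move m, _ => .move m none
  | seq P Q, Sum.inl q => (P.instr q).map fun o => some (o.elim (Sum.inr Q.entry) Sum.inl)
  | seq _ Q, Sum.inr q => (Q.instr q).map (Option.map Sum.inr)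
  | ifPos i P Q, none => .dec i (some (some (Sum.inr Q.entry))) (some (some (Sum.inl P.entry)))
  | ifPos _ P _, some (Sum.inl q) => (P.instr q).map (Option.map (some ∘ Sum.inl))
  | ifPos _ _ Q, some (Sum.inr q) => (Q.instr q).map (Option.map (some ∘ Sum.inr))
  | loop i P, none => .dec i none (some (some P.entry))
  | loop _ P, some q => (P.instr q).map some
  | ifSym p P Q, none => .test p (some (some (Sum.inl P.entry))) (some (some (Sum.inr Q.entry)))
  | ifSym _ P _, some (Sum.inl q) => (P.instr q).map (Option.map (some ∘ Sum.inl))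
  | ifSym _ _ Q, some (Sum.inr q) => (Q.instr q).map (Option.map (some ∘ Sum.inr))
  | loopSym p P, none => .test p (some (some P.entry)) none
  | loopSym _ P, some q => (P.instr q).map some

theorem Runs.mono {x : List α} {N N' : ℕ} (hN : N ≤ N') {P : RegProg α} {h r h' r'}
    (hR : Runs x N P h r h' r') : Runs x N' P h r h' r' := by
  induction hR with
  | inc h => exact .inc (h.trans hN)
  | move => exact .move
  | seq _ _ h₁ h₂ => exact .seq h₁ h₂
  | ifPos_pos hi _ h => exact .ifPos_pos hi h
  | ifPos_zero hi _ h => exact .ifPos_zero hi h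
  | loop_zero hi => exact .loop_zero hi
  | loop_pos hi _ _ h₁ h₂ => exact .loop_pos hi h₁ h₂
  | ifSym_true hp _ h => exact .ifSym_true hp h
  | ifSym_false hp _ h => exact .ifSym_false hp h
  | loopSym_false hp => exact .loopSym_false hp
  | loopSym_true hp _ _ h₁ h₂ => exact .loopSym_true hp h₁ h₂

end RegProg

/-! ### Binary counters -/

namespace BinaryCounter

/-- The number with the given binary digits, least significant digit first. -/
def val : List Bool → ℕ
  | [] => 0
  | b :: l => b.toNat + 2 * val l

def inc : List Bool → List Bool
  | [] => [true]
  | false :: l => true :: l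
  | true :: l => false :: inc l

def dec : List Bool → Option (List Bool)
  | [] => none
  | true :: l => some (false :: l)
  | false :: l => (dec l).map (true :: ·)

theorem val_inc (l : List Bool) : val (inc l) = val l + 1 := by
  induction l with
  | nil => rfl
  | cons b l ih => cases b <;> simp [inc, val, ih] <;> ring

theorem dec_none {l : List Bool} (h : dec l = none) : val l = 0 := by
  induction l with
  | nil => rfl
  | cons b l ih => cases b <;> simp_all [dec, val]

theorem dec_some {l l' : List Bool} (h : dec l = some l') :
    val l = val l' + 1 ∧ l'.length = l.length := by
  induction l generalizing l' with
  | nil => simp [dec] at h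
  | cons b l ih =>
    cases b
    · simp only [dec, Option.map_eq_some_iff] at h
      obtain ⟨m, hm, rfl⟩ := h
      have := ih hm
      simp [val, this]
      ring
    · simp only [dec, Option.some.injEq] at h
      subst h
      simp [val]
      ring

/-- A new digit appears only when the carry runs through all digits, and then the value is the power
of two belonging to the old length. This keeps the length logarithmic in the largest value ever
held, although leading zeros are never removed. -/
theorem length_inc (l : List Bool) :
    (inc l).length = l.length ∨ (inc l).length = l.length + 1 ∧ val (inc l) = 2 ^ l.length := by
  induction l with
  | nil => simp [inc, val]
  | cons b l ih =>
    cases b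
    · simp [inc]
    · rcases ih with h | ⟨h₁, h₂⟩
      · simp [inc, h]
      · right
        simp [inc, h₁, val, h₂, pow_succ]
        ring

theorem length_le_length_inc (l : List Bool) : l.length ≤ (inc l).length := by
  rcases length_inc l with h | h <;> omega

/-- Work symbols: a blank, a mark for the first cell, or a digit. -/
abbrev Symbol := Option (Option Bool)

abbrev mark : Symbol := some none
abbrev digit (b : Bool) : Symbol := some (some b)

/-- The tape that holds a counter: a mark followed by the digits. -/
def tape (l : List Bool) : ℕ → Symbol
  | 0 => mark
  | i + 1 => l[i]?.map some

theorem tape_append_cons (l : List Bool) (b : Bool) (m : List Bool) :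
    tape (l ++ b :: m) (l.length + 1) = digit b := by
  simp [tape]

theorem tape_length (l : List Bool) : tape l (l.length + 1) = none := by
  simp [tape]

theorem update_tape (l : List Bool) (b c : Bool) (m : List Bool) :
    Function.update (tape (l ++ b :: m)) (l.length + 1) (digit c) = tape (l ++ c :: m) := by
  funext i
  rcases i with _ | i
  · simp [tape]
  · by_cases hi : i = l.length
    · subst hi; simp [tape]
    · rw [Function.update_of_ne (by omega)]
      simp only [tape]
      congr 1
      rcases lt_or_gt_of_ne hi with h | h
      · rw [List.getElem?_append_left h, List.getElem?_append_left h]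
      · rw [List.getElem?_append_right h.le, List.getElem?_append_right h.le]
        obtain ⟨k, hk⟩ : ∃ k, i - l.length = k + 1 := ⟨i - l.length - 1, by omega⟩
        simp [hk]

theorem update_tape_length (l : List Bool) (c : Bool) :
    Function.update (tape l) (l.length + 1) (digit c) = tape (l ++ [c]) := by
  funext i
  rcases i with _ | i
  · simp [tape]
  · by_cases hi : i = l.length
    · subst hi; simp [tape]
    · rw [Function.update_of_ne (by omega)]
      simp only [tape]
      congr 1
      rcases lt_or_gt_of_ne hi with h | h
      · rw [List.getElem?_append_left h]
      · rw [List.getElem?_eq_none (by omega), List.getElem?_eq_none (by simp; omega)]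

end BinaryCounter


/-! ### Simulation of register machines by Turing machines -/

namespace RegMachine

open BinaryCounter

/-- The phases in which a Turing machine executes one instruction. -/
inductive Phase : Type
  | ready
  | carry
  | return
  | undo

instance : Finite Phase := by
  refine Finite.of_injective (β := Fin 4)
    (fun p => match p with | .ready => 0 | .carry => 1 | .return => 2 | .undo => 3) ?_
  intro p q h
  cases p <;> cases q <;> simp_all

variable {α : Type u} {Q : Type}

/-- Act on tape `i` only. -/
def onTape {k : ℕ} (i : ℕ) (s : Fin k → Symbol) (a : Symbol → Symbol × HeadMove) :
    Fin k → Symbol × HeadMove :=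
  fun j => if j.val = i then a (s j) else (s j, .stay)

def readTape {k : ℕ} (i : ℕ) (s : Fin k → Symbol) : Symbol :=
  if h : i < k then s ⟨i, h⟩ else mark

/-- The transition function. The state `none` writes the marks. -/
def trans (start : Q) (instr : Q → RegInstr α Q) (k : ℕ) :
    Option (Q × Phase) → InputSymbol α → (Fin k → Symbol) →
      Option (Q × Phase) × HeadMove × (Fin k → Symbol × HeadMove)
  | none, _, _ => (some (start, .ready), .stay, fun _ => (mark, .stay))
  | some (q, .ready), a, s =>
    match instr q with
    | .inc i _ => (some (q, .carry), .stay, onTape i s fun c => (c, .right))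
    | .dec i _ _ => (some (q, .carry), .stay, onTape i s fun c => (c, .right))
    | .move m q' => (some (q', .ready), m, fun j => (s j, .stay))
    | .test p y n => (some (if p a then y else n, .ready), .stay, fun j => (s j, .stay))
    | .halt _ => (none, .stay, fun j => (s j, .stay))
  | some (q, .carry), _, s =>
    match instr q with
    | .inc i _ =>
      match readTape i s with
      | some (some true) => (some (q, .carry), .stay, onTape i s fun _ => (digit false, .right))
      -- A zero, or the blank behind the last digit: the carry ends here.
      | _ => (some (q, .return), .stay, onTape i s fun _ => (digit true, .left))
    | .dec i _ _ =>
      match readTape i s with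
      | some (some true) => (some (q, .return), .stay, onTape i s fun _ => (digit false, .left))
      | some (some false) => (some (q, .carry), .stay, onTape i s fun _ => (digit true, .right))
      -- The blank is reached only if all digits were zeros. The borrow has turned them into ones,
      -- and the phase `undo` restores them.
      | _ => (some (q, .undo), .stay, onTape i s fun c => (c, .left))
    | _ => (none, .stay, fun j => (s j, .stay))
  | some (q, .return), _, s =>
    match instr q with
    | .inc i q' =>
      match readTape i s with
      | some none => (some (q', .ready), .stay, onTape i s fun c => (c, .stay))
      | _ => (some (q, .return), .stay, onTape i s fun c => (c, .left))
    | .dec i _ q' =>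
      match readTape i s with
      | some none => (some (q', .ready), .stay, onTape i s fun c => (c, .stay))
      | _ => (some (q, .return), .stay, onTape i s fun c => (c, .left))
    | _ => (none, .stay, fun j => (s j, .stay))
  | some (q, .undo), _, s =>
    match instr q with
    | .dec i q' _ =>
      match readTape i s with
      | some none => (some (q', .ready), .stay, onTape i s fun c => (c, .stay))
      | _ => (some (q, .undo), .stay, onTape i s fun _ => (digit false, .left))
    | _ => (none, .stay, fun j => (s j, .stay))

variable [Finite α]

/-- The Turing machine that simulates a register machine, with one tape per register. -/
abbrev toTM [Finite Q] (start : Q) (instr : Q → RegInstr α Q) (k : ℕ) : OfflineTM α where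
  State := Option (Q × Phase)
  finite_state := inferInstance
  WorkSymbol := Symbol
  finite_workSymbol := inferInstance
  blank := none
  tapes := k
  start := none
  verdict
    | some (q, .ready) =>
      match instr q with
      | .halt b => some b
      | _ => none
    | _ => none
  trans := trans start instr k

end RegMachine

/-! ### Computations of a Turing machine within a space bound. -/

namespace OfflineTM

variable {α : Type u} [Finite α] (M : OfflineTM α)

/-- `M` gets from `c` to `c'`, visiting only the first `s` cells of each work tape. -/
def Reach (x : List α) (s : ℕ) (c c' : M.Config) : Prop :=
  ∃ t, (M.next x)^[t] c = c' ∧ ∀ t' ≤ t, ∀ k, ((M.next x)^[t'] c).workHead k < s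

variable {M} {x : List α} {s : ℕ}

theorem Reach.refl {c : M.Config} (h : ∀ k, c.workHead k < s) : M.Reach x s c c :=
  ⟨0, rfl, fun t ht => by obtain rfl : t = 0 := by omega
                          exact h⟩

theorem Reach.trans {c₁ c₂ c₃ : M.Config} (h : M.Reach x s c₁ c₂) (h' : M.Reach x s c₂ c₃) :
    M.Reach x s c₁ c₃ := by
  obtain ⟨t, rfl, ht⟩ := h
  obtain ⟨t', rfl, ht'⟩ := h'
  refine ⟨t' + t, Function.iterate_add_apply _ _ _ _, fun n hn k => ?_⟩
  rcases le_total n t with h | h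
  · exact ht n h k
  · obtain ⟨m, rfl⟩ := Nat.exists_eq_add_of_le' h
    rw [Function.iterate_add_apply]
    exact ht' m (by omega) k

theorem Reach.head {c₁ c₂ c₃ : M.Config} (h : M.next x c₁ = c₂) (hs : ∀ k, c₁.workHead k < s)
    (h' : M.Reach x s c₂ c₃) : M.Reach x s c₁ c₃ := by
  obtain ⟨t, rfl, ht⟩ := h'
  subst h
  refine ⟨t + 1, rfl, fun n hn k => ?_⟩
  rcases n with _ | n
  · exact hs k
  · exact ht n (by omega) k

theorem next_of_verdict {c : M.Config} {b : Bool} (h : M.verdict c.state = some b) :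
    M.next x c = c := by
  unfold next; rw [h]

theorem next_of_trans {c : M.Config} {r} (hv : M.verdict c.state = none)
    (hr : M.trans c.state (inputAt x c.inputHead) (fun k => c.work k (c.workHead k)) = r) :
    M.next x c = ⟨r.1, min (r.2.1.apply c.inputHead) (x.length + 1),
      fun k => (r.2.2 k).2.apply (c.workHead k),
      fun k => Function.update (c.work k) (c.workHead k) (r.2.2 k).1⟩ := by
  subst hr
  unfold next
  rw [hv]

/-- A halting configuration is a fixed point of `next`, so the heads never move again. -/
theorem Reach.usesSpaceAtMost {c : M.Config} {b : Bool} (h : M.Reach x s M.initialConfig c)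
    (hc : M.verdict c.state = some b) : M.UsesSpaceAtMost x s := by
  obtain ⟨t, rfl, ht⟩ := h
  intro n k
  rcases le_total n t with h | h
  · exact ht n h k
  · obtain ⟨m, rfl⟩ := Nat.exists_eq_add_of_le' h
    have : M.run x (m + t) = (M.next x)^[t] M.initialConfig := by
      rw [run, Function.iterate_add_apply]
      exact Function.iterate_fixed (next_of_verdict hc) m
    rw [this]
    exact ht t le_rfl k

end OfflineTM

/-! ### Execution of single instructions on binary counters. -/

namespace RegMachine

open BinaryCounter OfflineTM

variable {α : Type u} [Finite α] {Q : Type} [Finite Q] {start : Q} {instr : Q → RegInstr α Q} {k : ℕ}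

/-- The configuration in phase `ph` of instruction `q`, with counters `D`, and all work heads on
cell `0` but that of tape `i` on cell `p`. -/
def config (start : Q) (instr : Q → RegInstr α Q) (q : Q) (ph : Phase) (h : ℕ) (i : Fin k) (p : ℕ)
    (D : Fin k → List Bool) : (toTM start instr k).Config where
  state := some (q, ph)
  inputHead := h
  workHead := fun j : Fin k => if j = i then p else 0
  work := fun j => tape (D j)

/-- The configuration before instruction `q` is executed. -/
def readyConfig (start : Q) (instr : Q → RegInstr α Q) (q : Q) (h : ℕ)
    (D : Fin k → List Bool) : (toTM start instr k).Config where
  state := some (q, .ready)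
  inputHead := h
  workHead := fun _ => 0
  work := fun j => tape (D j)

theorem config_ready (q : Q) (h : ℕ) (i : Fin k) (D : Fin k → List Bool) :
    config start instr q .ready h i 0 D = readyConfig start instr q h D := by
  simp only [config, readyConfig, ite_self]

variable {x : List α} {h : ℕ} {i : Fin k} {p : ℕ} {D : Fin k → List Bool} {q : Q}

theorem config_workHead_lt {ph : Phase} {s : ℕ} (hp : p < s) (j : Fin k) :
    (config start instr q ph h i p D).workHead j < s := by
  simp only [config]
  split <;> omega

theorem readTape_val (s : Fin k → Symbol) : readTape i s = s i := by
  simp [readTape]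

/-- A step inside an instruction affects tape `i` only, by the rule `a` applied to the scanned
symbol; `l` is the list of digits on that tape afterwards. -/
theorem next_config {ph ph' : Phase} {q' : Q} {l : List Bool} {a : Symbol → Symbol × HeadMove}
    (hh : h ≤ x.length + 1)
    (hv : (toTM start instr k).verdict (some (q, ph)) = none)
    (ht : trans start instr k (some (q, ph)) (inputAt x h)
      (fun j : Fin k => tape (D j) (if j = i then p else 0)) =
      (some (q', ph'), .stay, onTape i (fun j : Fin k => tape (D j) (if j = i then p else 0)) a))
    (hw : Function.update (tape (D i)) p (a (tape (D i) p)).1 = tape l) :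
    (toTM start instr k).next x (config start instr q ph h i p D) =
      config start instr q' ph' h i ((a (tape (D i) p)).2.apply p) (Function.update D i l) := by
  refine (next_of_trans (M := toTM start instr k) hv ht).trans ?_
  unfold config
  congr 1
  · exact min_eq_left hh
  · funext j
    by_cases hj : j = i
    · subst hj; simp [onTape]
    · have : j.val ≠ i.val := fun h => hj (Fin.ext h)
      simp [onTape, hj, this, HeadMove.apply]
  · funext j
    by_cases hj : j = i
    · subst hj; simp [onTape, hw]
    · have : j.val ≠ i.val := fun h => hj (Fin.ext h)
      simp [onTape, hj, this]

variable {s : ℕ}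

theorem reach_return {q' z : Q} (hh : h ≤ x.length + 1) (hq : instr q = .inc i q' ∨ instr q = .dec i z q')
    (hp : p ≤ (D i).length) (hs : p < s) :
    (toTM start instr k).Reach x s (config start instr q .return h i p D)
      (readyConfig start instr q' h D) := by
  induction p with
  | zero =>
    refine Reach.head (c₂ := readyConfig start instr q' h D) ?_ (config_workHead_lt hs)
      (Reach.refl fun _ => hs)
    rw [next_config (q' := q') (ph' := .ready) (l := D i) (a := fun c => (c, .stay)) hh rfl ?_
      (by simp)]
    · simp [HeadMove.apply, config_ready]
    · rcases hq with hq | hq <;> simp [trans, hq, readTape_val, tape]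
  | succ p ih =>
    refine Reach.head (c₂ := config start instr q .return h i p D) ?_ (config_workHead_lt hs)
      (ih (by omega) (by omega))
    rw [next_config (q' := q) (ph' := .return) (l := D i) (a := fun c => (c, .left)) hh rfl ?_
      (by simp)]
    · simp [HeadMove.apply]
    · have : (D i)[p]? = some ((D i)[p]) := List.getElem?_eq_getElem (by omega)
      rcases hq with hq | hq <;> simp [trans, hq, readTape_val, tape, this]

/-- The `n` ones to be erased are those that the failed borrow has written over zeros. -/
theorem reach_undo {q' z : Q} (hh : h ≤ x.length + 1) (hq : instr q = .dec i q' z) (n : ℕ)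
    (m : List Bool) (hD : D i = List.replicate n true ++ m) (hs : n < s) :
    (toTM start instr k).Reach x s (config start instr q .undo h i n D)
      (readyConfig start instr q' h (Function.update D i (List.replicate n false ++ m))) := by
  induction n generalizing D m with
  | zero =>
    have hm : Function.update D i m = D := by
      rw [← Function.update_eq_self i D, hD]; simp
    refine Reach.head (c₂ := readyConfig start instr q' h D) ?_ (config_workHead_lt hs) ?_
    · rw [next_config (q' := q') (ph' := .ready) (l := D i) (a := fun c => (c, .stay)) hh rfl ?_
        (by simp)]
      · simp [HeadMove.apply, config_ready]
      · simp [trans, hq, readTape_val, tape]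
    · simp only [List.replicate_zero, List.nil_append, hm]
      exact Reach.refl fun _ => hs
  | succ n ih =>
    have hD' : D i = List.replicate n true ++ true :: m := by
      rw [hD, List.replicate_succ']; simp
    have ht : tape (D i) (n + 1) = digit true := by
      have := tape_append_cons (List.replicate n true) true m
      rw [hD']; simpa using this
    refine Reach.head (c₂ := config start instr q .undo h i n
      (Function.update D i (List.replicate n true ++ false :: m))) ?_ (config_workHead_lt hs) ?_
    · rw [next_config (q' := q) (ph' := .undo) (l := List.replicate n true ++ false :: m)
        (a := fun c => (digit false, .left)) hh rfl ?_ ?_]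
      · simp [HeadMove.apply]
      · simp [trans, hq, readTape_val, ht]
      · have := update_tape (List.replicate n true) true false m
        rw [hD']; simpa using this
    · have := ih (D := Function.update D i (List.replicate n true ++ false :: m)) (false :: m)
        (by simp) (by omega)
      rw [Function.update_idem] at this
      rwa [List.replicate_succ', List.append_assoc]

/-- The digits `l` to the left of the head are final, and `inc` remains to be applied to the part
`m` from the head on. A one in front of `m` becomes a zero at the end of `l`, and the carry moves
on. -/
theorem reach_inc_carry {q' : Q} (hh : h ≤ x.length + 1) (hq : instr q = .inc i q')
    (l m : List Bool) (hD : D i = l ++ m) (hs : (l ++ inc m).length + 1 < s) :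
    (toTM start instr k).Reach x s (config start instr q .carry h i (l.length + 1) D)
      (readyConfig start instr q' h (Function.update D i (l ++ inc m))) := by
  have hl : l.length + 1 < s := by rw [List.length_append] at hs; omega
  induction m generalizing D l with
  | nil =>
    simp only [List.append_nil] at hD
    refine Reach.head (c₂ := config start instr q .return h i l.length
      (Function.update D i (l ++ [true]))) ?_ (config_workHead_lt hl) ?_
    · rw [next_config (q' := q) (ph' := .return) (l := l ++ [true])
        (a := fun c => (digit true, .left)) hh rfl ?_ ?_]
      · simp [HeadMove.apply]
      · simp [trans, hq, readTape_val, hD, tape_length]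
      · rw [hD]; exact update_tape_length l true
    · exact reach_return hh (.inl hq) (z := q') (by simp) (by omega)
  | cons b m ih =>
    cases b
    · refine Reach.head (c₂ := config start instr q .return h i l.length
        (Function.update D i (l ++ true :: m))) ?_ (config_workHead_lt hl) ?_
      · rw [next_config (q' := q) (ph' := .return) (l := l ++ true :: m)
          (a := fun c => (digit true, .left)) hh rfl ?_ ?_]
        · simp [HeadMove.apply]
        · simp [trans, hq, readTape_val, hD, tape_append_cons]
        · rw [hD]; exact update_tape l false true m
      · exact reach_return hh (.inl hq) (z := q') (by simp) (by omega)
    · have hs' : (l ++ [false] ++ inc m).length + 1 < s := by simpa [inc] using hs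
      refine Reach.head (c₂ := config start instr q .carry h i (l.length + 1 + 1)
        (Function.update D i (l ++ false :: m))) ?_ (config_workHead_lt hl) ?_
      · rw [next_config (q' := q) (ph' := .carry) (l := l ++ false :: m)
          (a := fun c => (digit false, .right)) hh rfl ?_ ?_]
        · simp [HeadMove.apply]
        · simp [trans, hq, readTape_val, hD, tape_append_cons]
        · rw [hD]; exact update_tape l true false m
      · have := ih (D := Function.update D i (l ++ false :: m)) (l ++ [false]) (by simp) hs'
          (by have := length_le_length_inc m
              cases m <;> simp [inc] at hs' ⊢ <;> omega)
        rw [Function.update_idem] at this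
        simpa [inc] using this

/-- Invariant of the borrow: the first `n` digits were zeros and are now ones. They remain ones if a
one is found in `m`; otherwise the register was zero and they are reset. -/
theorem reach_dec_carry {z q' : Q} (hh : h ≤ x.length + 1) (hq : instr q = .dec i z q')
    (n : ℕ) (m : List Bool) (hD : D i = List.replicate n true ++ m) (hs : n + m.length + 1 < s) :
    (toTM start instr k).Reach x s (config start instr q .carry h i (n + 1) D)
      (match dec m with
        | some m' => readyConfig start instr q' h
            (Function.update D i (List.replicate n true ++ m'))
        | none => readyConfig start instr z h
            (Function.update D i (List.replicate n false ++ m))) := by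
  have hl : n + 1 < s := by omega
  induction m generalizing D n with
  | nil =>
    simp only [List.append_nil] at hD
    refine Reach.head (c₂ := config start instr q .undo h i n D) ?_ (config_workHead_lt hl) ?_
    · have ht := tape_length (List.replicate n true)
      rw [List.length_replicate] at ht
      rw [next_config (q' := q) (ph' := .undo) (l := D i) (a := fun c => (c, .left)) hh rfl ?_ ?_]
      · simp [HeadMove.apply]
      · simp [trans, hq, readTape_val, hD, ht]
      · simp
    · exact reach_undo hh hq n [] (by simpa using hD) (by omega)
  | cons b m ih =>
    have ht := tape_append_cons (List.replicate n true) b m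
    have hu := fun c => update_tape (List.replicate n true) b c m
    rw [List.length_replicate] at ht hu
    cases b
    · refine Reach.head (c₂ := config start instr q .carry h i (n + 1 + 1)
        (Function.update D i (List.replicate n true ++ true :: m))) ?_ (config_workHead_lt hl) ?_
      · rw [next_config (q' := q) (ph' := .carry) (l := List.replicate n true ++ true :: m)
          (a := fun c => (digit true, .right)) hh rfl ?_ ?_]
        · simp [HeadMove.apply]
        · simp [trans, hq, readTape_val, hD, ht]
        · rw [hD]; exact hu true
      · have := ih (D := Function.update D i (List.replicate n true ++ true :: m)) (n + 1)
          (by simp [List.replicate_succ']) (by simp at hs; omega) (by simp at hs; omega)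
        simp only [Function.update_idem] at this
        simp only [dec]
        cases hd : dec m with
        | none =>
          simp only [hd] at this
          simpa [List.replicate_succ'] using this
        | some m' =>
          simp only [hd] at this
          simpa [List.replicate_succ'] using this
    · refine Reach.head (c₂ := config start instr q .return h i n
        (Function.update D i (List.replicate n true ++ false :: m))) ?_ (config_workHead_lt hl) ?_
      · rw [next_config (q' := q) (ph' := .return) (l := List.replicate n true ++ false :: m)
          (a := fun c => (digit false, .left)) hh rfl ?_ ?_]
        · simp [HeadMove.apply]
        · simp [trans, hq, readTape_val, hD, ht]
        · rw [hD]; exact hu false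
      · exact reach_return hh (.inr hq) (by simp) (by omega)

theorem next_ready (hh : h ≤ x.length + 1)
    (hv : (toTM start instr k).verdict (some (q, .ready)) = none)
    (ht : trans start instr k (some (q, .ready)) (inputAt x h) (fun j => tape (D j) 0) =
      (some (q, .carry), .stay, onTape i (fun j => tape (D j) 0) fun c => (c, .right))) :
    (toTM start instr k).next x (readyConfig start instr q h D) =
      config start instr q .carry h i 1 D := by
  rw [← config_ready (i := i), next_config (q' := q) (ph' := .carry) (l := D i)
    (a := fun c => (c, .right)) hh hv (by simpa using ht) (by simp)]
  simp [HeadMove.apply]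

theorem reach_inc {q' : Q} (hh : h ≤ x.length + 1) (hq : instr q = .inc i q')
    (hs : (inc (D i)).length + 1 < s) :
    (toTM start instr k).Reach x s (readyConfig start instr q h D)
      (readyConfig start instr q' h (Function.update D i (inc (D i)))) :=
  Reach.head (next_ready (i := i) hh (by simp [hq]) (by simp [trans, hq]))
    (fun _ => by simp only [readyConfig]; omega)
    (reach_inc_carry hh hq [] (D i) rfl hs)

theorem reach_dec {z q' : Q} (hh : h ≤ x.length + 1) (hq : instr q = .dec i z q')
    (hs : (D i).length + 1 < s) :
    (toTM start instr k).Reach x s (readyConfig start instr q h D)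
      (match dec (D i) with
        | some m => readyConfig start instr q' h (Function.update D i m)
        | none => readyConfig start instr z h D) := by
  refine Reach.head (next_ready (i := i) hh (by simp [hq]) (by simp [trans, hq]))
    (fun _ => by simp only [readyConfig]; omega) ?_
  have := reach_dec_carry (start := start) hh hq 0 (D i) (s := s) rfl (by omega)
  cases hd : dec (D i) <;> simpa [hd] using this

theorem reach_move {m : HeadMove} {q' : Q} (hq : instr q = .move m q') (hs : 0 < s) :
    (toTM start instr k).Reach x s (readyConfig start instr q h D)
      (readyConfig start instr q' (min (m.apply h) (x.length + 1)) D) := by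
  refine Reach.head ?_ (fun _ => hs) (Reach.refl fun _ => hs)
  simp [next, toTM, readyConfig, hq, trans, HeadMove.apply]

theorem reach_test {f : InputSymbol α → Bool} {y n : Q} (hh : h ≤ x.length + 1)
    (hq : instr q = .test f y n) (hs : 0 < s) :
    (toTM start instr k).Reach x s (readyConfig start instr q h D)
      (readyConfig start instr (if f (inputAt x h) then y else n) h D) := by
  refine Reach.head ?_ (fun _ => hs) (Reach.refl fun _ => hs)
  simp [next, toTM, readyConfig, hq, trans, HeadMove.apply]
  exact hh

theorem reach_initial (hs : 0 < s) :
    (toTM start instr k).Reach x s (toTM start instr k).initialConfig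
      (readyConfig start instr start 0 fun _ => []) := by
  refine Reach.head ?_ (fun _ => hs) (Reach.refl fun _ => hs)
  simp only [next, toTM, readyConfig, trans, HeadMove.apply, initialConfig]
  congr 1
  funext j c
  cases c <;> simp [tape]

/-- The counters `D` hold the contents of the registers, and are as short as the bound `N`
allows. -/
def Represents (N : ℕ) (D : Fin k → List Bool) (r : ℕ → ℕ) : Prop :=
  ∀ j, val (D j) = r j ∧ 2 ^ (D j).length ≤ 2 * N

theorem Represents.length_le {N : ℕ} {r : ℕ → ℕ} (hD : Represents N D r) (j : Fin k) :
    (D j).length ≤ Nat.log 2 N + 1 := by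
  have h := (hD j).2
  rcases Nat.eq_zero_or_pos N with rfl | hN
  · simp at h
  · have := Nat.le_log_of_pow_le (b := 2) one_lt_two h
    rwa [mul_comm, Nat.log_mul_base one_lt_two (by omega)] at this

/-- If the counter gets longer, then by `length_inc` its new value is `2` to the old length, and
this value is at most `N`. -/
theorem Represents.inc {N : ℕ} {r : ℕ → ℕ} (hD : Represents N D r) (hN : r i + 1 ≤ N) :
    Represents N (Function.update D i (inc (D i))) (Function.update r i (r i + 1)) := by
  intro j
  by_cases hj : j = i
  · subst hj
    have hl := length_inc (D j)
    simp only [Function.update_self, val_inc, (hD j).1, true_and]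
    rcases hl with hl | ⟨hl, hv⟩
    · rw [hl]; exact (hD j).2
    · rw [val_inc, (hD j).1] at hv
      rw [hl, pow_succ]; omega
  · have : (j : ℕ) ≠ i := fun h => hj (Fin.ext h)
    simpa [hj, this] using hD j

theorem Represents.dec {N n : ℕ} {r : ℕ → ℕ} {m : List Bool} (hD : Represents N D r)
    (hn : r i = n + 1) (hm : dec (D i) = some m) :
    Represents N (Function.update D i m) (Function.update r i n) := by
  intro j
  by_cases hj : j = i
  · subst hj
    have hl := dec_some hm
    have := hD j
    simp only [Function.update_self, hl.2, this.2, and_true]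
    omega
  · have : (j : ℕ) ≠ i := fun h => hj (Fin.ext h)
    simpa [hj, this] using hD j

end RegMachine

open RegMachine OfflineTM in
-- Induction on the run. The program may sit inside a larger machine, through a map `e` of its
-- program points, and may exit to any label `qe`; sequences and loops need this, as the exit of one
-- part is the entry of another. A counter has at most `Nat.log 2 N + 1` digits, and the mark and
-- the blank behind the digits account for two more cells.
theorem RegProg.Runs.reach {α : Type u} [Finite α] {Q : Type} [Finite Q] {start : Q}
    {instr : Q → RegInstr α Q} {k N : ℕ} {x : List α} {P : RegProg α} {h r h' r'}
    (hR : Runs x N P h r h' r') (hk : P.regs ≤ k) (e : P.State → Q) (qe : Q)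
    (he : ∀ q, instr (e q) = (P.instr q).map (fun o => o.elim qe e)) (hh : h ≤ x.length + 1)
    (D : Fin k → List Bool) (hD : Represents N D r) :
    ∃ D', Represents N D' r' ∧ h' ≤ x.length + 1 ∧
      (toTM start instr k).Reach x (Nat.log 2 N + 3) (readyConfig start instr (e P.entry) h D)
        (readyConfig start instr qe h' D') := by
  induction hR generalizing qe D with
  | @inc i h r hN =>
    have hD' := hD.inc (i := ⟨i, hk⟩) hN
    refine ⟨_, hD', hh, reach_inc (i := ⟨i, hk⟩) hh (he ()) ?_⟩
    have := hD'.length_le ⟨i, hk⟩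
    rw [Function.update_self] at this
    omega
  | move =>
    exact ⟨D, hD, by omega, reach_move (he ()) (by omega)⟩
  | @seq P Q h₁ r₁ h₂ r₂ h₃ r₃ hP hQ ihP ihQ =>
    obtain ⟨hk₁, hk₂⟩ := max_le_iff.1 hk
    obtain ⟨D₁, hD₁, hh₁, hr₁⟩ := ihP hk₁ (fun q => e (Sum.inl q)) (e (Sum.inr Q.entry))
      (fun q => (he (Sum.inl q)).trans (RegInstr.map_map_eq _ fun o => by cases o <;> rfl)) hh D hD
    obtain ⟨D₂, hD₂, hh₂, hr₂⟩ := ihQ hk₂ (fun q => e (Sum.inr q)) qe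
      (fun q => (he (Sum.inr q)).trans (RegInstr.map_map_eq _ fun o => by cases o <;> rfl)) hh₁ D₁ hD₁
    exact ⟨D₂, hD₂, hh₂, hr₁.trans hr₂⟩
  | @ifPos_pos i n P Q h r h' r' hi hP ih =>
    simp only [RegProg.regs, max_le_iff] at hk
    have hl := hD.length_le ⟨i, hk.1⟩
    have hr := reach_dec (start := start) (s := Nat.log 2 N + 3) (i := ⟨i, hk.1⟩) (D := D) hh
      (he none) (by omega)
    cases hd : BinaryCounter.dec (D ⟨i, hk.1⟩) with
    | none =>
      have := BinaryCounter.dec_none hd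
      rw [(hD ⟨i, hk.1⟩).1] at this
      simp only at this
      omega
    | some m =>
      rw [hd] at hr
      obtain ⟨D', hD', hh', hr'⟩ := ih hk.2.1 (fun q => e (some (Sum.inl q))) qe
        (fun q => (he (some (Sum.inl q))).trans (RegInstr.map_map_eq _ fun o => by cases o <;> rfl)) hh _ (hD.dec (i := ⟨i, hk.1⟩) hi hd)
      exact ⟨D', hD', hh', hr.trans hr'⟩
  | @ifPos_zero i P Q h r h' r' hi hQ ih =>
    simp only [RegProg.regs, max_le_iff] at hk
    have hl := hD.length_le ⟨i, hk.1⟩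
    have hr := reach_dec (start := start) (s := Nat.log 2 N + 3) (i := ⟨i, hk.1⟩) (D := D) hh
      (he none) (by omega)
    cases hd : BinaryCounter.dec (D ⟨i, hk.1⟩) with
    | some m =>
      have := BinaryCounter.dec_some hd
      rw [(hD ⟨i, hk.1⟩).1] at this
      simp only at this
      omega
    | none =>
      rw [hd] at hr
      obtain ⟨D', hD', hh', hr'⟩ := ih hk.2.2 (fun q => e (some (Sum.inr q))) qe
        (fun q => (he (some (Sum.inr q))).trans (RegInstr.map_map_eq _ fun o => by cases o <;> rfl)) hh _ hD
      exact ⟨D', hD', hh', hr.trans hr'⟩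
  | @loop_zero i P h r hi =>
    simp only [RegProg.regs, max_le_iff] at hk
    have hl := hD.length_le ⟨i, hk.1⟩
    have hr := reach_dec (start := start) (s := Nat.log 2 N + 3) (i := ⟨i, hk.1⟩) (D := D) hh
      (he none) (by omega)
    cases hd : BinaryCounter.dec (D ⟨i, hk.1⟩) with
    | some m =>
      have := BinaryCounter.dec_some hd
      rw [(hD ⟨i, hk.1⟩).1] at this
      simp only at this
      omega
    | none =>
      rw [hd] at hr
      exact ⟨D, hD, hh, hr⟩
  | @loop_pos i n P h₁ r₁ h₂ r₂ h₃ r₃ hi hP hL ihP ihL =>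
    have hk' := hk
    simp only [RegProg.regs, max_le_iff] at hk
    have hl := hD.length_le ⟨i, hk.1⟩
    have hr := reach_dec (start := start) (s := Nat.log 2 N + 3) (i := ⟨i, hk.1⟩) (D := D) hh
      (he none) (by omega)
    cases hd : BinaryCounter.dec (D ⟨i, hk.1⟩) with
    | none =>
      have := BinaryCounter.dec_none hd
      rw [(hD ⟨i, hk.1⟩).1] at this
      simp only at this
      omega
    | some m =>
      rw [hd] at hr
      obtain ⟨D₁, hD₁, hh₁, hr₁⟩ := ihP hk.2 (fun q => e (some q)) (e none)
        (fun q => (he (some q)).trans (RegInstr.map_map_eq _ fun o => by cases o <;> rfl)) hh _ (hD.dec (i := ⟨i, hk.1⟩) hi hd)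
      obtain ⟨D₂, hD₂, hh₂, hr₂⟩ := ihL hk' e qe he hh₁ D₁ hD₁
      exact ⟨D₂, hD₂, hh₂, hr.trans (hr₁.trans hr₂)⟩
  | @ifSym_true p P Q h r h' r' hp hP ih =>
    obtain ⟨hk₁, hk₂⟩ := max_le_iff.1 hk
    have hr := reach_test (start := start) (s := Nat.log 2 N + 3) (D := D) hh (he none) (by omega)
    rw [hp] at hr
    obtain ⟨D', hD', hh', hr'⟩ := ih hk₁ (fun q => e (some (Sum.inl q))) qe
      (fun q => (he (some (Sum.inl q))).trans (RegInstr.map_map_eq _ fun o => by cases o <;> rfl)) hh _ hD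
    exact ⟨D', hD', hh', hr.trans hr'⟩
  | @ifSym_false p P Q h r h' r' hp hP ih =>
    obtain ⟨hk₁, hk₂⟩ := max_le_iff.1 hk
    have hr := reach_test (start := start) (s := Nat.log 2 N + 3) (D := D) hh (he none) (by omega)
    rw [hp] at hr
    obtain ⟨D', hD', hh', hr'⟩ := ih hk₂ (fun q => e (some (Sum.inr q))) qe
      (fun q => (he (some (Sum.inr q))).trans (RegInstr.map_map_eq _ fun o => by cases o <;> rfl)) hh _ hD
    exact ⟨D', hD', hh', hr.trans hr'⟩
  | @loopSym_false p P h r hp =>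
    have hr := reach_test (start := start) (s := Nat.log 2 N + 3) (D := D) hh (he none) (by omega)
    rw [hp] at hr
    exact ⟨D, hD, hh, hr⟩
  | @loopSym_true p P h₁ r₁ h₂ r₂ h₃ r₃ hp hP hL ihP ihL =>
    have hr := reach_test (start := start) (s := Nat.log 2 N + 3) (D := D) hh (he none) (by omega)
    rw [hp] at hr
    obtain ⟨D₁, hD₁, hh₁, hr₁⟩ := ihP hk (fun q => e (some q)) (e none)
      (fun q => (he (some q)).trans (RegInstr.map_map_eq _ fun o => by cases o <;> rfl)) hh _ hD
    obtain ⟨D₂, hD₂, hh₂, hr₂⟩ := ihL hk e qe he hh₁ D₁ hD₁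
    exact ⟨D₂, hD₂, hh₂, hr.trans (hr₁.trans hr₂)⟩


/-! ### Functions computable in logarithmic space -/

/-- A coding of the elements of a type by tuples of natural numbers of a fixed length. -/
class RegCode (X : Type u) where
  dim : ℕ
  enc : X → ℕ → ℕ

namespace RegCode

variable {X : Type u} {Y : Type v} [RegCode X] [RegCode Y]

/-- The largest number in the code. -/
def size (x : X) : ℕ := (Finset.range (dim X)).sup (enc x)

theorem size_le_iff {x : X} {N : ℕ} : size x ≤ N ↔ ∀ i < dim X, enc x i ≤ N := by
  simp [size, Finset.sup_le_iff]

theorem enc_le_size {x : X} {i : ℕ} (hi : i < dim X) : enc x i ≤ size x :=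
  size_le_iff.1 le_rfl i hi

/-- The elements of a finite type are numbered. -/
noncomputable instance ofFinite {D : Type u} [Finite D] : RegCode D where
  dim := 1
  enc a _ := (Finite.equivFin D a).val

noncomputable instance : RegCode ℕ where
  dim := 1
  enc n _ := n

noncomputable instance : RegCode (X × Y) where
  dim := dim X + dim Y
  enc p i := if i < dim X then enc p.1 i else enc p.2 (i - dim X)

theorem size_nat (n : ℕ) : size n = n := by
  simp [size, dim, enc]

theorem size_prod (p : X × Y) : size p = max (size p.1) (size p.2) := by
  apply le_antisymm
  · rw [size_le_iff]
    intro i hi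
    simp only [enc]
    split
    · exact (enc_le_size ‹_›).trans (le_max_left _ _)
    · refine (enc_le_size ?_).trans (le_max_right _ _)
      simp only [dim] at hi; omega
  · rw [max_le_iff, size_le_iff, size_le_iff]
    constructor
    · intro i hi
      have := enc_le_size (x := p) (i := i) (by simp only [dim]; omega)
      simpa [enc, hi] using this
    · intro i hi
      have := enc_le_size (x := p) (i := dim X + i) (by simp only [dim]; omega)
      simpa [enc] using this

theorem size_finite_lt {D : Type u} [Finite D] (a : D) : size a < Nat.card D := by
  have : size a = (Finite.equivFin D a).val := by simp [size, dim, enc]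
  rw [this]
  exact Fin.isLt _

end RegCode

/-- Replace the contents of the registers `d, …, d + k - 1` by the values of `v`. -/
def putRegs (r : ℕ → ℕ) (d k : ℕ) (v : ℕ → ℕ) : ℕ → ℕ :=
  fun i => if d ≤ i ∧ i < d + k then v (i - d) else r i

/-! ### Basic programs: copying and moving registers, branching, rewinding. -/

namespace RegProg

variable {α : Type u} {x : List α} {N : ℕ}

def skip : RegProg α := move .stay

theorem runs_skip {r : ℕ → ℕ} {h : ℕ} (hh : h ≤ x.length + 1) : Runs x N skip h r h r := by
  have := Runs.move (x := x) (N := N) (m := .stay) (h := h) (r := r)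
  rwa [HeadMove.apply, min_eq_left hh] at this

def clear (i : ℕ) : RegProg α := loop i skip

theorem runs_clear (i : ℕ) (r : ℕ → ℕ) : Runs x N (clear i) 0 r 0 (Function.update r i 0) := by
  obtain ⟨n, hn⟩ : ∃ n, r i = n := ⟨_, rfl⟩
  induction n generalizing r with
  | zero => rw [← hn, Function.update_eq_self]; exact .loop_zero hn
  | succ n ih =>
    refine .loop_pos hn (runs_skip (by omega)) ?_
    have := ih (Function.update r i n) (by simp)
    rwa [Function.update_idem] at this

/-- Add register `i` to register `j`, and clear register `i`. -/
def transfer (i j : ℕ) : RegProg α := loop i (inc j)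

theorem runs_transfer {i j : ℕ} (hij : i ≠ j) {h : ℕ} (r : ℕ → ℕ) (hN : r j + r i ≤ N) :
    Runs x N (transfer i j) h r h (Function.update (Function.update r i 0) j (r j + r i)) := by
  obtain ⟨n, hn⟩ : ∃ n, r i = n := ⟨_, rfl⟩
  induction n generalizing r with
  | zero =>
    have : Function.update (Function.update r i 0) j (r j + r i) = r := by
      rw [hn, ← hn, Function.update_eq_self]; simp [hn]
    rw [this]; exact .loop_zero hn
  | succ n ih =>
    refine .loop_pos hn (.inc ?_) ?_
    · simp [hij.symm]; omega
    · have := ih (Function.update (Function.update r i n) j (Function.update r i n j + 1))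
        (by simp [hij, hij.symm]; omega) (by simp [hij])
      change Runs x N (transfer i j) _ _ _ _
      convert this using 1
      funext l
      simp only [Function.update_apply]
      split_ifs <;> simp_all
      omega

/-- Add register `i` to register `j`, with the help of register `t`. -/
def copy (i j t : ℕ) : RegProg α := seq (loop i (seq (inc j) (inc t))) (transfer t i)

theorem runs_copy {i j t : ℕ} (hij : i ≠ j) (hit : i ≠ t) (hjt : j ≠ t) {h : ℕ} (r : ℕ → ℕ)
    (ht : r t = 0) (hN : r j + r i ≤ N) :
    Runs x N (copy i j t) h r h (Function.update r j (r j + r i)) := by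
  -- The helper register is zero only at the outset, so the induction runs over arbitrary contents.
  have key : ∀ (n : ℕ) (r : ℕ → ℕ), r i = n → r j + r i ≤ N → r t + r i ≤ N →
      Runs x N (loop i (seq (inc j) (inc t))) h r h
        (Function.update (Function.update (Function.update r i 0) j (r j + r i)) t (r t + r i)) := by
    intro n
    induction n with
    | zero =>
      intro r hn h₁ h₂
      have : Function.update (Function.update (Function.update r i 0) j (r j + r i)) t
          (r t + r i) = r := by
        funext l
        simp only [Function.update_apply]
        split_ifs <;> simp_all
      rw [this]; exact .loop_zero hn
    | succ n ih =>
      intro r hn h₁ h₂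
      refine .loop_pos hn (.seq (.inc ?_) (.inc ?_)) ?_
      · simp [hij.symm]; omega
      · simp [hit.symm, hjt.symm]; omega
      · have := ih (Function.update (Function.update (Function.update r i n) j (r j + 1)) t
          (r t + 1)) (by simp [hij, hit]) (by simp [hij, hit, hjt]; omega)
          (by simp [hij, hit]; omega)
        convert this using 1
        · funext l
          simp only [Function.update_apply]
          split_ifs <;> simp_all
        · funext l
          simp only [Function.update_apply]
          split_ifs <;> simp_all <;> omega
  refine .seq (key _ r rfl hN (by omega)) ?_
  have := runs_transfer (x := x) (N := N) (h := h) hit.symm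
    (Function.update (Function.update (Function.update r i 0) j (r j + r i)) t (r t + r i))
    (by simp [hij, hit, ht]; omega)
  convert this using 1
  funext l
  simp only [Function.update_apply]
  split_ifs <;> simp_all

def clearBlock (d : ℕ) : ℕ → RegProg α
  | 0 => skip
  | m + 1 => seq (clearBlock d m) (clear (d + m))

theorem runs_clearBlock (d m : ℕ) (r : ℕ → ℕ) :
    Runs x N (clearBlock d m) 0 r 0 (putRegs r d m fun _ => 0) := by
  induction m with
  | zero =>
    have : putRegs r d 0 (fun _ => 0) = r := by funext i; simp [putRegs]
    rw [this]; exact runs_skip (by omega)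
  | succ m ih =>
    refine .seq ih ?_
    have := runs_clear (x := x) (N := N) (d + m) (putRegs r d m fun _ => 0)
    convert this using 1
    funext i
    simp only [putRegs, Function.update_apply]
    split_ifs <;> first | rfl | omega

/-- Move the contents of the registers from `d + m` on down to those from `d` on. -/
def moveBlock (d m : ℕ) : ℕ → RegProg α
  | 0 => skip
  | k + 1 => seq (moveBlock d m k) (transfer (d + m + k) (d + k))

/-- The transfers proceed upwards, so each of them finds an empty target: either one of the `m` free
registers or the source of an earlier transfer. -/
theorem runs_moveBlock {d m : ℕ} (k : ℕ) (r : ℕ → ℕ) (b : ℕ → ℕ) (n : ℕ) (hk : k ≤ n) (hm : 0 < m)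
    (hr : ∀ i, d ≤ i → r i = 0) (hb : ∀ i < k, b i ≤ N) :
    Runs x N (moveBlock d m k) 0 (putRegs r (d + m) n b) 0
      (fun i => if i < d then r i else if i - d < k then b (i - d)
        else if d + m + k ≤ i ∧ i < d + m + n then b (i - (d + m)) else 0) := by
  induction k with
  | zero =>
    change Runs x N skip _ _ _ _
    convert runs_skip (x := x) (N := N) (h := 0) (by omega) using 1
    funext i
    simp only [putRegs]
    split_ifs <;> first | rfl | omega | (apply (hr _ _).symm; omega)
  | succ k ih =>
    refine .seq (ih (by omega) fun i hi => hb i (by omega)) ?_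
    have h₁ : ¬ d + m + k < d := by omega
    have h₂ : ¬ d + m + k - d < k := by omega
    have h₃ : d + m + k < d + m + n := by omega
    have := runs_transfer (x := x) (N := N) (h := 0) (i := d + m + k) (j := d + k) (by omega)
      (fun i => if i < d then r i else if i - d < k then b (i - d)
        else if d + m + k ≤ i ∧ i < d + m + n then b (i - (d + m)) else 0)
      (by have := hb k (by omega)
          simp [h₁, h₂, h₃, hm.ne']
          omega)
    convert this using 1
    funext i
    simp only [Function.update_apply]
    by_cases hi : i = d + k
    · subst hi
      simp [h₁, h₂, h₃]
      omega
    · by_cases hi' : i = d + m + k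
      · subst hi'
        simp [h₁, hm.ne']
        omega
      · simp only [hi, hi', if_false]
        split_ifs <;> first | rfl | omega

/-- Clear the registers `d, …, d + m - 1`, and move the next `k` registers down. -/
def shiftDown (d m k : ℕ) : RegProg α :=
  -- For `m = 0` sources and targets coincide, and a transfer from a non-zero register to itself
  -- would not terminate.
  if m = 0 then skip else seq (clearBlock d m) (moveBlock d m k)

theorem runs_shiftDown {d m k : ℕ} {r a b : ℕ → ℕ} (hr : ∀ i, d ≤ i → r i = 0)
    (hb : ∀ i < k, b i ≤ N) :
    Runs x N (shiftDown d m k) 0 (putRegs (putRegs r d m a) (d + m) k b) 0 (putRegs r d k b) := by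
  unfold shiftDown
  split
  · subst m
    convert runs_skip (x := x) (N := N) (h := 0) (by omega) using 1
    funext i
    simp only [putRegs]
    split_ifs <;> first | rfl | omega
  · refine .seq (runs_clearBlock d m _) ?_
    have := runs_moveBlock (x := x) (m := m) k r b k le_rfl (by omega) hr hb
    convert this using 1
    · funext i
      simp only [putRegs]
      split_ifs <;> first | rfl | omega | (apply (hr _ _).symm; omega)
    · funext i
      simp only [putRegs]
      split_ifs <;> first | rfl | omega | (apply hr; omega)

/-- Run `P (c + v)`, where `v < m` is the contents of register `d`, after clearing it. -/
def switch (d : ℕ) (P : ℕ → RegProg α) : ℕ → ℕ → RegProg α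
  | 0, _ => skip
  | m + 1, c => ifPos d (switch d P m (c + 1)) (P c)

theorem runs_switch {d : ℕ} {P : ℕ → RegProg α} {m c : ℕ} {r : ℕ → ℕ} {h' r'} (hm : r d < m)
    (hP : Runs x N (P (c + r d)) 0 (Function.update r d 0) h' r') :
    Runs x N (switch d P m c) 0 r h' r' := by
  induction m generalizing c r with
  | zero => omega
  | succ m ih =>
    obtain h | ⟨n, hn⟩ : r d = 0 ∨ ∃ n, r d = n + 1 := by cases h : r d <;> simp
    · refine .ifPos_zero h ?_
      rwa [h, ← h, Function.update_eq_self, h, add_zero] at hP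
    · refine .ifPos_pos hn (ih (by simp; omega) ?_)
      simp only [Function.update_self, Function.update_idem]
      rw [hn] at hP
      convert hP using 2
      ring

def incs (d : ℕ) : ℕ → RegProg α
  | 0 => skip
  | c + 1 => seq (incs d c) (inc d)

theorem runs_incs {d c h : ℕ} {r : ℕ → ℕ} (hh : h ≤ x.length + 1) (hc : r d + c ≤ N) :
    Runs x N (incs d c) h r h (Function.update r d (r d + c)) := by
  induction c with
  | zero => simpa [incs] using runs_skip hh
  | succ c ih =>
    refine .seq (ih (by omega)) ?_
    have := Runs.inc (x := x) (N := N) (i := d) (h := h)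
      (r := Function.update r d (r d + c)) (by simp; omega)
    simpa [add_assoc] using this

theorem _root_.OfflineTM.inputAt_succ_ne_leftEnd (x : List α) (i : ℕ) :
    OfflineTM.inputAt x (i + 1) ≠ .leftEnd := by
  rw [OfflineTM.inputAt]
  cases x[i]? <;> simp

/-- Move the input head back to the left end. -/
noncomputable def rewind : RegProg α :=
  open scoped Classical in loopSym (fun a => decide (a ≠ .leftEnd)) (move .left)

theorem runs_rewind {h : ℕ} {r : ℕ → ℕ} (hh : h ≤ x.length + 1) : Runs x N rewind h r 0 r := by
  induction h with
  | zero => exact .loopSym_false (by simp [OfflineTM.inputAt])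
  | succ h ih =>
    refine .loopSym_true (h₂ := h) (r₂ := r) ?_ ?_ (ih (by omega))
    · simpa using OfflineTM.inputAt_succ_ne_leftEnd x h
    · have := Runs.move (x := x) (N := N) (m := .left) (h := h + 1) (r := r)
      rwa [HeadMove.apply, Nat.add_sub_cancel, min_eq_left (by omega)] at this

end RegProg


open RegCode

/-- `f`, on the arguments `x`, can be computed from the input `w` in logarithmic space: wherever the
arguments are stored, and whichever registers are free, a program computes the value, and all
numbers that it forms are linear in the length of `w` and the size of `x`. -/
def LogFn {α : Type u} {X : Type u₁} {Y : Type u₂} [RegCode X] [RegCode Y]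
    (f : List α → X → Y) : Prop :=
  ∃ c : ℕ, (∀ w x, size (f w x) ≤ c * (w.length + size x + 1)) ∧
    ∀ (ρ : ℕ → ℕ) (d : ℕ), (∀ i < dim X, ρ i < d) →
      ∃ P : RegProg α, ∀ w x (r : ℕ → ℕ), (∀ i < dim X, r (ρ i) = enc x i) →
        (∀ j, d ≤ j → r j = 0) →
        P.Runs w (c * (w.length + size x + 1)) 0 r 0 (putRegs r d (dim Y) (enc (f w x)))

section putRegs

variable {r v : ℕ → ℕ} {d k i : ℕ}

theorem putRegs_of_lt (h : i < d) : putRegs r d k v i = r i := by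
  simp only [putRegs]; split_ifs <;> first | rfl | omega

theorem putRegs_add (h : i < k) : putRegs r d k v (d + i) = v i := by
  simp only [putRegs]; split_ifs <;> first | omega | simp

theorem putRegs_of_le (h : d + k ≤ i) : putRegs r d k v i = r i := by
  simp only [putRegs]; split_ifs <;> first | rfl | omega

theorem putRegs_one : putRegs r d 1 v = Function.update r d (v 0) := by
  funext i
  simp only [putRegs, Function.update_apply]
  split_ifs <;> first | rfl | omega | (congr 1; omega)

end putRegs

/-! ### Closure properties of logarithmic-space functions. -/

namespace LogFn

variable {α : Type u} {X : Type u₁} {Y : Type u₂} {Z : Type u₃} [RegCode X] [RegCode Y] [RegCode Z]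

theorem mul_bound {a b c n s t : ℕ} (ht : t ≤ b * (n + s + 1)) (hc : a * (1 + b) ≤ c) :
    a * (n + t + 1) ≤ c * (n + s + 1) := by
  calc a * (n + t + 1) ≤ a * ((1 + b) * (n + s + 1)) := by gcongr; nlinarith
    _ = (a * (1 + b)) * (n + s + 1) := by ring
    _ ≤ c * (n + s + 1) := by gcongr

theorem comp {f : List α → Y → Z} {g : List α → X → Y} (hf : LogFn f) (hg : LogFn g) :
    LogFn fun w x => f w (g w x) := by
  obtain ⟨a, ha, hf⟩ := hf
  obtain ⟨b, hb, hg⟩ := hg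
  have hsize : ∀ w x, size (f w (g w x)) ≤ (a * (1 + b) + b) * (w.length + size x + 1) :=
    fun w x => (ha w _).trans (mul_bound (hb w x) (by omega))
  refine ⟨a * (1 + b) + b, hsize, fun ρ d hρ => ?_⟩
  obtain ⟨Pg, hPg⟩ := hg ρ d hρ
  -- The value of `g` stays in the registers from `d` on, as the argument of `f`. The value of `f`
  -- is formed behind it and finally moved down over it.
  obtain ⟨Pf, hPf⟩ := hf (fun i => d + i) (d + dim Y) (by intro i hi; omega)
  refine ⟨.seq Pg (.seq Pf (.shiftDown d (dim Y) (dim Z))), fun w x r hr h0 => ?_⟩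
  refine .seq ((hPg w x r hr h0).mono ?_) (.seq ((hPf w (g w x) _ ?_ ?_).mono ?_)
    (RegProg.runs_shiftDown h0 ?_))
  · gcongr; omega
  · intro i hi; exact putRegs_add hi
  · intro j hj; rw [putRegs_of_le hj]; exact h0 j (by omega)
  · exact mul_bound (hb w x) (by omega)
  · intro i hi; exact (enc_le_size hi).trans (hsize w x)

theorem pair {f : List α → X → Y} {g : List α → X → Z} (hf : LogFn f) (hg : LogFn g) :
    LogFn fun w x => (f w x, g w x) := by
  obtain ⟨a, ha, hf⟩ := hf
  obtain ⟨b, hb, hg⟩ := hg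
  refine ⟨a + b, fun w x => ?_, fun ρ d hρ => ?_⟩
  · rw [size_prod]
    exact max_le ((ha w x).trans (by gcongr; omega)) ((hb w x).trans (by gcongr; omega))
  obtain ⟨Pf, hPf⟩ := hf ρ d hρ
  obtain ⟨Pg, hPg⟩ := hg ρ (d + dim Y) (by intro i hi; have := hρ i hi; omega)
  refine ⟨.seq Pf Pg, fun w x r hr h0 => ?_⟩
  refine .seq ((hPf w x r hr h0).mono (by gcongr; omega)) ?_
  have := (hPg w x (putRegs r d (dim Y) (enc (f w x))) ?_ ?_).mono
    (N' := (a + b) * (w.length + size x + 1)) (by gcongr; omega)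
  · convert this using 1
    funext i
    simp only [putRegs, dim, enc]
    split_ifs <;> first | rfl | omega | (congr 1; omega)
  · intro i hi; rw [putRegs_of_lt (hρ i hi), hr i hi]
  · intro j hj; rw [putRegs_of_le hj]; exact h0 j (by omega)

/-- Functions that select components of their argument. -/
theorem select {f : X → Y} (π : ℕ → ℕ) (hπ : ∀ i < dim Y, π i < dim X)
    (h : ∀ x, ∀ i < dim Y, enc (f x) i = enc x (π i)) : LogFn fun (_ : List α) x => f x := by
  have hs : ∀ x, size (f x) ≤ size x := fun x => size_le_iff.2 fun i hi => by
    rw [h x i hi]; exact enc_le_size (hπ i hi)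
  refine ⟨1, fun w x => (hs x).trans (by omega), fun ρ d hρ => ?_⟩
  have key : ∀ k ≤ dim Y, ∃ P : RegProg α, ∀ w x (r : ℕ → ℕ), (∀ i < dim X, r (ρ i) = enc x i) →
      (∀ j, d ≤ j → r j = 0) →
      P.Runs w (1 * (w.length + size x + 1)) 0 r 0 (putRegs r d k (enc (f x))) := by
    intro k
    induction k with
    | zero =>
      refine fun _ => ⟨.skip, fun w x r _ _ => ?_⟩
      convert RegProg.runs_skip (x := w) (r := r) (h := 0) (by omega) using 1
      funext i; simp [putRegs]
    | succ k ih =>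
      intro hk
      obtain ⟨P, hP⟩ := ih (by omega)
      have hρk := hρ _ (hπ k hk)
      refine ⟨.seq P (.copy (ρ (π k)) (d + k) (d + k + 1)), fun w x r hr h0 =>
        .seq (hP w x r hr h0) ?_⟩
      have h1 : putRegs r d k (enc (f x)) (ρ (π k)) = enc (f x) k := by
        rw [putRegs_of_lt hρk, hr _ (hπ k hk), h x k hk]
      have h2 : putRegs r d k (enc (f x)) (d + k) = 0 := by
        rw [putRegs_of_le le_rfl, h0 _ (by omega)]
      have := RegProg.runs_copy (x := w) (N := 1 * (w.length + size x + 1)) (h := 0)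
        (i := ρ (π k)) (j := d + k) (t := d + k + 1) (by omega) (by omega) (by omega)
        (putRegs r d k (enc (f x)))
        (by rw [putRegs_of_le (by omega)]; exact h0 _ (by omega))
        (by have := (enc_le_size (x := f x) hk).trans (hs x)
            rw [h1, h2]; omega)
      rw [h1, h2, zero_add] at this
      convert this using 1
      funext i
      simp only [putRegs, Function.update_apply]
      split_ifs <;> first | rfl | omega | (congr 1; omega)
  exact key _ le_rfl

theorem id : LogFn fun (_ : List α) (x : X) => x :=
  select (fun i => i) (fun _ h => h) fun _ _ _ => rfl

theorem fst {f : List α → X → Y × Z} (hf : LogFn f) : LogFn fun w x => (f w x).1 :=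
  comp (f := fun _ p => p.1)
    (select (fun i => i) (fun i hi => by simp only [dim]; omega) fun p i hi => by simp [enc, hi]) hf

theorem snd {f : List α → X → Y × Z} (hf : LogFn f) : LogFn fun w x => (f w x).2 :=
  comp (f := fun _ p => p.2)
    (select (fun i => dim Y + i) (fun i hi => by simp only [dim]; omega)
      fun p i hi => by simp [enc]) hf

/-- A function into a type with codes of length `1` can be given by a program that leaves the code
in a fresh register. -/
theorem of_prog {f : List α → X → Y} (hY : dim Y = 1) (c : ℕ)
    (hs : ∀ w x, enc (f w x) 0 ≤ c * (w.length + size x + 1))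
    (h : ∀ (ρ : ℕ → ℕ) (d : ℕ), (∀ i < dim X, ρ i < d) →
      ∃ P : RegProg α, ∀ w x (r : ℕ → ℕ), (∀ i < dim X, r (ρ i) = enc x i) →
        (∀ j, d ≤ j → r j = 0) →
        P.Runs w (c * (w.length + size x + 1)) 0 r 0 (Function.update r d (enc (f w x) 0))) :
    LogFn f := by
  refine ⟨c, fun w x => size_le_iff.2 fun i hi => ?_, fun ρ d hρ => ?_⟩
  · obtain rfl : i = 0 := by omega
    exact hs w x
  · obtain ⟨P, hP⟩ := h ρ d hρ
    refine ⟨P, fun w x r hr h0 => ?_⟩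
    rw [hY, putRegs_one]
    exact hP w x r hr h0

theorem const_of_dim (hY : dim Y = 1) (y : Y) : LogFn fun (_ : List α) (_ : X) => y := by
  refine of_prog hY (enc y 0) (fun w x => Nat.le_mul_of_pos_right _ (by omega)) fun ρ d hρ =>
    ⟨.incs d (enc y 0), fun w x r _ h0 => ?_⟩
  have := RegProg.runs_incs (x := w) (N := enc y 0 * (w.length + size x + 1)) (d := d)
    (c := enc y 0) (h := 0) (r := r) (by omega)
    (by rw [h0 d le_rfl, zero_add]; exact Nat.le_mul_of_pos_right _ (by omega))
  rwa [h0 d le_rfl, zero_add] at this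

theorem natConst (n : ℕ) : LogFn fun (_ : List α) (_ : X) => n := const_of_dim rfl n

theorem finConst {D : Type v} [Finite D] (a : D) : LogFn fun (_ : List α) (_ : X) => a :=
  const_of_dim rfl a

/-- Definition by cases on a value in a finite type. -/
theorem cases {D : Type v} [Finite D] {a : List α → X → D} {f : D → List α → X → Y} (ha : LogFn a)
    (hf : ∀ e, LogFn (f e)) : LogFn fun w x => f (a w x) w x := by
  obtain ⟨b, hb, ha⟩ := ha
  -- Each value has a program and a constant of its own; finiteness of `D` yields a common bound for
  -- the constants.
  choose c hc hf using hf
  obtain ⟨C, hC⟩ := (Set.finite_range c).bddAbove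
  have hC : ∀ e, c e ≤ C := fun e => hC ⟨e, rfl⟩
  refine ⟨C + b, fun w x => (hc _ w x).trans ?_, fun ρ d hρ => ?_⟩
  · gcongr; exact (hC _).trans (by omega)
  obtain ⟨Pa, hPa⟩ := ha ρ d hρ
  choose P hP using fun e => hf e ρ d hρ
  let F := Finite.equivFin D
  refine ⟨.seq Pa (.switch d (fun i => if h : i < Nat.card D then P (F.symm ⟨i, h⟩) else .skip)
    (Nat.card D) 0), fun w x r hr h0 => ?_⟩
  refine .seq ((hPa w x r hr h0).mono (by gcongr; omega)) ?_
  have he : putRegs r d (dim D) (enc (a w x)) = Function.update r d (F (a w x)).val := putRegs_one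
  rw [he]
  refine RegProg.runs_switch (by simp) ?_
  -- The switch has emptied register `d`, so the chosen branch finds the initial registers.
  have hu : Function.update r d 0 = r := by
    conv_lhs => rw [← h0 d le_rfl]
    exact Function.update_eq_self _ _
  simp only [Function.update_self, zero_add, Fin.is_lt, dite_true, Fin.eta, Equiv.symm_apply_apply,
    Function.update_idem, hu]
  refine (hP (a w x) w x r hr h0).mono ?_
  gcongr; exact (hC _).trans (by omega)

/-- Functions on finite types. -/
theorem finMap {D : Type v} [Finite D] {E : Type w} [Finite E] {a : List α → X → D}
    (ha : LogFn a) (f : D → E) : LogFn fun w x => f (a w x) :=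
  cases (f := fun e _ _ => f e) ha fun _ => finConst _

theorem cond {b : List α → X → Bool} {f g : List α → X → Y} (hb : LogFn b) (hf : LogFn f)
    (hg : LogFn g) : LogFn fun w x => bif b w x then f w x else g w x :=
  cases (f := fun e w x => bif e then f w x else g w x) hb fun e => by cases e <;> assumption

theorem and {a b : List α → X → Bool} (ha : LogFn a) (hb : LogFn b) :
    LogFn fun w x => a w x && b w x :=
  cases (f := fun e w x => e && b w x) ha fun e => by
    cases e
    · exact finConst false
    · simpa using hb

theorem not {a : List α → X → Bool} (ha : LogFn a) : LogFn fun w x => !a w x :=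
  finMap ha _

theorem add {f g : List α → X → ℕ} (hf : LogFn f) (hg : LogFn g) :
    LogFn fun w x => f w x + g w x := by
  have : LogFn fun (_ : List α) (p : ℕ × ℕ) => p.1 + p.2 := by
    refine of_prog rfl 2 (fun w p => ?_) fun ρ d hρ => ?_
    · have h1 := size_prod p
      rw [size_nat, size_nat] at h1
      change p.1 + p.2 ≤ _
      omega
    · have hd0 := hρ 0 Nat.two_pos
      have hd1 := hρ 1 Nat.one_lt_two
      refine ⟨.seq (.copy (ρ 0) d (d + 1)) (.copy (ρ 1) d (d + 1)), fun w p r hr h0 => ?_⟩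
      have hr0 : r (ρ 0) = p.1 := hr 0 Nat.two_pos
      have hr1 : r (ρ 1) = p.2 := hr 1 Nat.one_lt_two
      have h1 := size_prod p
      rw [size_nat, size_nat] at h1
      have c1 := RegProg.runs_copy (x := w) (N := 2 * (w.length + size p + 1)) (h := 0)
        (i := ρ 0) (j := d) (t := d + 1) (by omega) (by omega) (by omega) r (h0 _ (by omega))
        (by rw [hr0, h0 d le_rfl]; omega)
      rw [hr0, h0 d le_rfl, zero_add] at c1
      have c2 := RegProg.runs_copy (x := w) (N := 2 * (w.length + size p + 1)) (h := 0)
        (i := ρ 1) (j := d) (t := d + 1) (by omega) (by omega) (by omega)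
        (Function.update r d p.1)
        (by rw [Function.update_of_ne (by omega)]; exact h0 _ (by omega))
        (by rw [Function.update_self, Function.update_of_ne (by omega), hr1]; omega)
      rw [Function.update_self, Function.update_of_ne (by omega), hr1, Function.update_idem] at c2
      exact .seq c1 c2
  exact comp this (pair hf hg)

theorem succ {f : List α → X → ℕ} (hf : LogFn f) : LogFn fun w x => f w x + 1 :=
  add hf (natConst 1)

theorem pred {f : List α → X → ℕ} (hf : LogFn f) : LogFn fun w x => f w x - 1 := by
  have : LogFn fun (_ : List α) (n : ℕ) => n - 1 := by
    refine of_prog rfl 1 (fun w n => ?_) fun ρ d hρ => ?_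
    · rw [size_nat]; change n - 1 ≤ _; omega
    · have hd := hρ 0 Nat.one_pos
      refine ⟨.seq (.copy (ρ 0) d (d + 1)) (.ifPos d .skip .skip), fun w n r hr h0 => ?_⟩
      have hr0 : r (ρ 0) = n := hr 0 Nat.one_pos
      have c1 := RegProg.runs_copy (x := w) (N := 1 * (w.length + size n + 1)) (h := 0)
        (i := ρ 0) (j := d) (t := d + 1) (by omega) (by omega) (by omega) r (h0 _ (by omega))
        (by rw [hr0, h0 d le_rfl, size_nat]; omega)
      rw [hr0, h0 d le_rfl, zero_add] at c1
      refine .seq c1 ?_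
      change RegProg.Runs _ _ _ _ _ _ (Function.update r d (n - 1))
      cases n with
      | zero => exact .ifPos_zero (by simp) (RegProg.runs_skip (by omega))
      | succ n =>
        refine .ifPos_pos (n := n) (by simp) ?_
        rw [Function.update_idem]
        exact RegProg.runs_skip (by omega)
  exact comp this hf

theorem isZero {f : List α → X → ℕ} (hf : LogFn f) : LogFn fun w x => decide (f w x = 0) := by
  have : LogFn fun (_ : List α) (n : ℕ) => decide (n = 0) := by
    -- The numbering of `Bool` is not specified, so the program has to write `F true` or `F false`
    -- instead of `1` or `0`.
    let F := Finite.equivFin Bool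
    refine of_prog rfl 2 (fun w n => ?_) fun ρ d hρ => ?_
    · have : (F (decide (n = 0))).val < 2 := by
        have := (F (decide (n = 0))).isLt
        simpa using this
      change (F (decide (n = 0))).val ≤ _
      omega
    · have hd := hρ 0 Nat.one_pos
      refine ⟨.seq (.copy (ρ 0) d (d + 1)) (.ifPos d (.seq (.clear d) (.incs d (F false)))
        (.incs d (F true))), fun w n r hr h0 => ?_⟩
      have hr0 : r (ρ 0) = n := hr 0 Nat.one_pos
      have hF : ∀ b, (F b).val ≤ 2 * (w.length + size n + 1) := fun b => by
        have : (F b).val < 2 := by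
          have := (F b).isLt
          simpa using this
        omega
      have c1 := RegProg.runs_copy (x := w) (N := 2 * (w.length + size n + 1)) (h := 0)
        (i := ρ 0) (j := d) (t := d + 1) (by omega) (by omega) (by omega) r (h0 _ (by omega))
        (by rw [hr0, h0 d le_rfl, size_nat]; omega)
      rw [hr0, h0 d le_rfl, zero_add] at c1
      refine .seq c1 ?_
      change RegProg.Runs _ _ _ _ _ _ (Function.update r d (F (decide (n = 0))))
      cases n with
      | zero =>
        refine .ifPos_zero (by simp) ?_
        have := RegProg.runs_incs (x := w) (d := d) (c := F true) (h := 0)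
          (r := Function.update r d 0) (by omega) (by simpa using hF true)
        simpa using this
      | succ n =>
        refine .ifPos_pos (n := n) (by simp) (.seq (RegProg.runs_clear _ _) ?_)
        have := RegProg.runs_incs (x := w) (d := d) (c := F false) (h := 0)
          (r := Function.update r d 0) (by omega) (by simpa using hF false)
        simpa using this
  exact comp this hf

end LogFn


open RegCode

instance {α : Type u} [Finite α] : Finite (InputSymbol α) := by
  refine Finite.of_injective (β := Option (Option α))
    (fun a => match a with
      | .leftEnd => none
      | .rightEnd => some none
      | .letter a => some (some a)) ?_
  intro a b h
  cases a <;> cases b <;> simp_all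

/-! ### Iteration, and access to the input tape. -/

namespace LogFn

variable {α : Type u} {X : Type u₁} {S : Type u₂} [RegCode X] [RegCode S]

/-- A countdown is kept in register `d` and the current state behind it. The bound `hb` on the
intermediate states is a separate hypothesis because the linear bound for a single step, when
iterated, would only give an exponential one. -/
theorem iterate {n : List α → X → ℕ} {s₀ : List α → X → S} {f : List α → X × S → S}
    (hn : LogFn n) (hs : LogFn s₀) (hf : LogFn f)
    (hb : ∃ b, ∀ w x, ∀ t ≤ n w x,
      size ((fun s => f w (x, s))^[t] (s₀ w x)) ≤ b * (w.length + size x + 1)) :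
    LogFn fun w x => (fun s => f w (x, s))^[n w x] (s₀ w x) := by
  obtain ⟨a, ha, hn⟩ := hn
  obtain ⟨a', ha', hs⟩ := hs
  obtain ⟨c, hc, hf⟩ := hf
  obtain ⟨b, hb⟩ := hb
  set C := c * (2 + b) + b + a + a'
  refine ⟨C, fun w x => (hb w x _ le_rfl).trans (by gcongr; omega), fun ρ d hρ => ?_⟩
  obtain ⟨Pn, hPn⟩ := hn ρ d hρ
  obtain ⟨Ps, hPs⟩ := hs ρ (d + 1) (fun i hi => (hρ i hi).trans (by omega))
  obtain ⟨Pf, hPf⟩ := hf (fun i => if i < dim X then ρ i else d + 1 + (i - dim X))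
    (d + 1 + dim S) (fun i hi => by
      simp only [dim] at hi
      split
      · have := hρ i ‹_›; omega
      · omega)
  refine ⟨.seq Pn (.seq Ps (.seq (.loop d (.seq Pf (.shiftDown (d + 1) (dim S) (dim S))))
    (.shiftDown d 1 (dim S)))), fun w x r hr h0 => ?_⟩
  set N := C * (w.length + size x + 1) with hN
  have hbN : ∀ t ≤ n w x, size ((fun s => f w (x, s))^[t] (s₀ w x)) ≤ N := fun t ht =>
    (hb w x t ht).trans (by rw [hN]; gcongr; omega)
  -- The registers at the head of the loop, with countdown `m` and state `s`.
  let reg : ℕ → S → ℕ → ℕ := fun m s => putRegs (putRegs r d 1 fun _ => m) (d + 1) (dim S) (enc s)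
  have hregd : ∀ m s, reg m s d = m := fun m s =>
    (putRegs_of_lt (by omega)).trans (putRegs_add (i := 0) (by omega))
  have loop : ∀ m t, t + m = n w x →
      RegProg.Runs w N (.loop d (.seq Pf (.shiftDown (d + 1) (dim S) (dim S)))) 0
        (reg m ((fun s => f w (x, s))^[t] (s₀ w x))) 0
        (reg 0 ((fun s => f w (x, s))^[n w x] (s₀ w x))) := by
    intro m
    induction m with
    | zero =>
      intro t ht
      obtain rfl : t = n w x := by omega
      exact .loop_zero (hregd _ _)
    | succ m ih =>
      intro t ht
      set s := (fun s => f w (x, s))^[t] (s₀ w x) with hs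
      have hu : Function.update (reg (m + 1) s) d m = reg m s := by
        funext i
        simp only [reg, putRegs, Function.update_apply]
        split_ifs <;> first | rfl | omega
      have hnext : f w (x, s) = (fun s => f w (x, s))^[t + 1] (s₀ w x) := by
        rw [Function.iterate_succ_apply']
      have body : RegProg.Runs w N (.seq Pf (.shiftDown (d + 1) (dim S) (dim S))) 0 (reg m s) 0
          (reg m (f w (x, s))) := by
        refine .seq ?_ (RegProg.runs_shiftDown (a := enc s) (b := enc (f w (x, s))) ?_ ?_)
        · refine (hPf w (x, s) (reg m s) ?_ ?_).mono ?_
          · intro i hi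
            simp only [dim] at hi
            simp only [enc]
            split
            · exact (putRegs_of_lt (by have := hρ i ‹_›; omega)).trans
                ((putRegs_of_lt (hρ i ‹_›)).trans (hr i ‹_›))
            · exact putRegs_add (by omega)
          · intro j hj
            exact (putRegs_of_le hj).trans ((putRegs_of_le (by omega)).trans (h0 j (by omega)))
          · rw [size_prod, hN]
            refine mul_bound (b := 1 + b) ?_ ?_
            · have := hb w x t (by omega)
              rw [← hs] at this
              refine max_le ?_ (this.trans ?_)
              · nlinarith
              · gcongr; omega
            · simp only [C]; ring_nf; omega
        · intro i hi
          rw [putRegs_of_le (by omega), h0 i (by omega)]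
        · intro i hi
          rw [hnext]
          exact (enc_le_size hi).trans (hbN _ (by omega))
      refine .loop_pos (hregd _ _) (h₂ := 0) (r₂ := reg m (f w (x, s))) (by rwa [hu]) ?_
      rw [hnext]
      exact ih (t + 1) (by omega)
  have h1 : putRegs r d (dim ℕ) (enc (n w x)) = putRegs r d 1 fun _ => n w x := rfl
  refine .seq ((hPn w x r hr h0).mono (by rw [hN]; gcongr; omega)) (.seq ((hPs w x _ ?_ ?_).mono
    (by rw [hN]; gcongr; omega)) (.seq (loop _ 0 (by omega)) (RegProg.runs_shiftDown h0 ?_)))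
  · intro i hi; rw [putRegs_of_lt (hρ i hi), hr i hi]
  · intro j hj; rw [h1, putRegs_of_le hj, h0 j (by omega)]
  · intro i hi
    exact (enc_le_size hi).trans (hbN _ le_rfl)

/-- The symbol on a cell of the input tape. -/
theorem symbol [Finite α] {f : List α → X → ℕ} (hf : LogFn f) :
    LogFn fun w x => OfflineTM.inputAt w (f w x) := by
  have : LogFn fun (w : List α) (p : ℕ) => OfflineTM.inputAt w p := by
    classical
    let F := Finite.equivFin (InputSymbol α)
    let out : ℕ → List (InputSymbol α) → RegProg α := fun d l =>
      l.foldr (fun a P => .ifSym (fun b => decide (b = a)) (.incs d (F a)) P) .skip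
    have hF : ∀ a, (F a).val ≤ Nat.card (InputSymbol α) := fun a => (F a).isLt.le
    have hout : ∀ d l (w : List α) N h (r : ℕ → ℕ), h ≤ w.length + 1 → r d = 0 →
        Nat.card (InputSymbol α) ≤ N → OfflineTM.inputAt w h ∈ l →
        RegProg.Runs w N (out d l) h r h
          (Function.update r d (F (OfflineTM.inputAt w h))) := by
      intro d l w N h r hh hr hN hl
      induction l with
      | nil => simp at hl
      | cons a l ih =>
        by_cases ha : OfflineTM.inputAt w h = a
        · refine .ifSym_true (by simpa using ha) ?_
          have := RegProg.runs_incs (x := w) (N := N) (d := d) (c := F a) hh (r := r)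
            (by rw [hr, zero_add]; exact (hF a).trans hN)
          rw [hr, zero_add] at this
          rwa [ha]
        · refine .ifSym_false (by simpa using ha) (ih ?_)
          simpa [ha] using hl
    obtain ⟨l, hl⟩ : ∃ l : List (InputSymbol α), ∀ a, a ∈ l := by
      obtain ⟨l, _, hl⟩ := Finite.exists_univ_list (InputSymbol α)
      exact ⟨l, hl⟩
    refine of_prog rfl (Nat.card (InputSymbol α) + 1) (fun w n => ?_) fun ρ d hρ => ?_
    · change (F _).val ≤ _
      exact (hF _).trans (by nlinarith)
    · have hd := hρ 0 Nat.one_pos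
      refine ⟨.seq (.copy (ρ 0) d (d + 1)) (.seq (.loop d (.move .right))
        (.seq (out d l) .rewind)), fun w n r hr h0 => ?_⟩
      have hr0 : r (ρ 0) = n := hr 0 Nat.one_pos
      set N := (Nat.card (InputSymbol α) + 1) * (w.length + size n + 1)
      have hN : n ≤ N := by
        have : size n ≤ N := by simp only [N]; nlinarith
        rwa [size_nat] at this
      have hN' : Nat.card (InputSymbol α) ≤ N := by simp only [N]; nlinarith
      have c1 := RegProg.runs_copy (x := w) (N := N) (h := 0)
        (i := ρ 0) (j := d) (t := d + 1) (by omega) (by omega) (by omega) r (h0 _ (by omega))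
        (by rw [hr0, h0 d le_rfl, zero_add]; exact hN)
      rw [hr0, h0 d le_rfl, zero_add] at c1
      have c2 : ∀ m h, RegProg.Runs w N (.loop d (.move .right)) (min h (w.length + 1))
          (Function.update r d m) (min (h + m) (w.length + 1)) (Function.update r d 0) := by
        intro m
        induction m with
        | zero => exact fun h => .loop_zero (by simp)
        | succ m ih =>
          intro h
          refine .loop_pos (n := m) (by simp) .move ?_
          rw [Function.update_idem]
          have := ih (h + 1)
          convert this using 1
          · simp only [HeadMove.apply]; omega
          · congr 1; omega
      have c2 := c2 n 0
      rw [Nat.zero_min, zero_add] at c2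
      -- The head stops at the right end-marker, which is also the symbol that `inputAt` gives for
      -- all later cells.
      have hmin : OfflineTM.inputAt w (min n (w.length + 1)) = OfflineTM.inputAt w n := by
        rcases le_total n (w.length + 1) with h | h
        · rw [min_eq_left h]
        · rw [min_eq_right h]
          obtain ⟨m, rfl⟩ := Nat.exists_eq_add_of_le h
          rw [show w.length + 1 + m = w.length + m + 1 by ring]
          simp only [OfflineTM.inputAt]
          rw [List.getElem?_eq_none le_rfl, List.getElem?_eq_none (by omega)]
      have c3 := hout d l w N (min n (w.length + 1)) (Function.update r d 0) (by omega) (by simp)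
        hN' (hl _)
      rw [hmin, Function.update_idem] at c3
      exact .seq c1 (.seq c2 (.seq c3 (RegProg.runs_rewind (by omega))))
  exact comp this hf

theorem length : LogFn fun (w : List α) (_ : X) => w.length := by
  classical
  refine of_prog rfl 1 (fun w x => by change w.length ≤ _; omega) fun ρ d hρ => ?_
  refine ⟨.seq (.move .right) (.seq (.loopSym (fun a => decide (a ≠ .rightEnd))
    (.seq (.inc d) (.move .right))) .rewind), fun w x r _ h0 => ?_⟩
  change RegProg.Runs _ _ _ _ _ _ (Function.update r d w.length)
  have key : ∀ m n, n + m = w.length → RegProg.Runs w (1 * (w.length + size x + 1))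
      (.loopSym (fun a => decide (a ≠ .rightEnd)) (.seq (.inc d) (.move .right))) (n + 1)
      (Function.update r d n) (w.length + 1) (Function.update r d w.length) := by
    intro m
    induction m with
    | zero =>
      rintro n rfl
      refine .loopSym_false ?_
      simp [OfflineTM.inputAt]
    | succ m ih =>
      intro n hn
      refine .loopSym_true ?_ (.seq (.inc ?_) .move) ?_
      · have : w[n]? = some (w[n]) := List.getElem?_eq_getElem (by omega)
        simp [OfflineTM.inputAt, this]
      · rw [Function.update_self]; omega
      · have := ih (n + 1) (by omega)
        rw [Function.update_self, Function.update_idem, HeadMove.apply, min_eq_left (by omega)]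
        exact this
  have h1 := RegProg.Runs.move (x := w) (N := 1 * (w.length + size x + 1)) (m := .right) (h := 0)
    (r := r)
  rw [HeadMove.apply, zero_add, min_eq_left (by omega)] at h1
  have hu : Function.update r d 0 = r := by
    conv_lhs => rw [← h0 d le_rfl]
    exact Function.update_eq_self _ _
  have h2 := key w.length 0 (by omega)
  rw [hu] at h2
  exact .seq h1 (.seq h2 (RegProg.runs_rewind le_rfl))

end LogFn

/-! ### From logarithmic-space predicates to Turing machines. -/

theorem Nat.log_two_mul_add_one_le (c n : ℕ) (hc : 0 < c) :
    Nat.log 2 (c * (n + 1)) ≤ Nat.log 2 n + (Nat.log 2 c + 2) := by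
  have h1 : c < 2 ^ (Nat.log 2 c + 1) := Nat.lt_pow_succ_log_self one_lt_two c
  have h2 : n < 2 ^ (Nat.log 2 n + 1) := Nat.lt_pow_succ_log_self one_lt_two n
  have h3 : c * (n + 1) < 2 ^ (Nat.log 2 n + (Nat.log 2 c + 2) + 1) := by
    calc c * (n + 1) < 2 ^ (Nat.log 2 c + 1) * (n + 1) := by gcongr
      _ ≤ 2 ^ (Nat.log 2 c + 1) * 2 ^ (Nat.log 2 n + 1) := by gcongr; omega
      _ = 2 ^ (Nat.log 2 n + (Nat.log 2 c + 2)) := by rw [← pow_add]; congr 1; ring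
      _ ≤ _ := Nat.pow_le_pow_right two_pos (by omega)
  exact Nat.lt_succ_iff.1 (Nat.log_lt_of_lt_pow (by positivity) h3)

open OfflineTM RegMachine in
/-- Predicates computable in logarithmic space define languages in `InLogspace`. -/
theorem LogFn.inLogspace {α : Type u} [Finite α] {f : List α → Bool}
    (hf : LogFn fun w (_ : Unit) => f w) : InLogspace {w | f w = true} := by
  classical
  have hf' : LogFn fun w (_ : Unit) => (f w).toNat :=
    LogFn.cases (f := fun b _ _ => b.toNat) hf fun b => LogFn.natConst _
  obtain ⟨c, hc, hP⟩ := hf'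
  have hu : ∀ i < dim Unit, (fun i : ℕ => i) i < 1 := fun i hi => hi
  obtain ⟨P, hP⟩ := hP (fun i => i) 1 hu
  -- The added loop turns the answer into a head position: cell `1` for `true` and cell `0` for
  -- `false`.
  have hcode : ∀ w, RegProg.Runs w (c * (w.length + 1)) (.seq P (.loop 1 (.move .right))) 0
      (fun _ => 0) (f w).toNat (fun _ => 0) := by
    intro w
    have hsize : size () = 0 := by
      have := size_finite_lt ()
      simpa using this
    have h := hP w () (fun _ => 0) (fun i hi => by
      have := enc_le_size (x := ()) hi
      omega) (fun _ _ => rfl)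
    rw [hsize, add_zero] at h
    refine .seq h ?_
    change RegProg.Runs _ _ _ _ (putRegs _ 1 1 fun _ => (f w).toNat) _ _
    rw [putRegs_one]
    have h0 : Function.update (fun _ : ℕ => 0) 1 0 = fun _ : ℕ => 0 :=
      Function.update_eq_self 1 (fun _ : ℕ => 0)
    cases f w with
    | false =>
      simp only [Bool.toNat_false, h0]
      exact .loop_zero rfl
    | true =>
      refine .loop_pos (n := 0) (by simp) .move ?_
      rw [Function.update_idem, h0, HeadMove.apply, zero_add, min_eq_left (by omega)]
      exact .loop_zero rfl
  set R : RegProg α := .seq P (.loop 1 (.move .right))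
  have := R.finite_state
  let instr : R.State ⊕ Option Bool → RegInstr α (R.State ⊕ Option Bool) := fun q =>
    match q with
    | .inl q => (R.instr q).map fun o => o.elim (.inr none) .inl
    -- The exit of the program tests whether the head is still on the left end-marker.
    | .inr none => .test (fun a => decide (a = .leftEnd)) (.inr (some false)) (.inr (some true))
    | .inr (some b) => .halt b
  let M : OfflineTM α := toTM (.inl R.entry) instr R.regs
  have hreach : ∀ w, ∃ D, M.Reach w (Nat.log 2 ((c + 1) * (w.length + 1)) + 3) M.initialConfig
      (readyConfig _ instr (.inr (some (f w))) (f w).toNat D) := by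
    intro w
    -- The factor `c + 1` in place of `c` makes the bound `N` positive: even an empty counter
    -- requires `1 ≤ 2 * N`.
    obtain ⟨D, -, hh, hr⟩ := ((hcode w).mono (N' := (c + 1) * (w.length + 1))
      (by gcongr; omega)).reach (start := .inl R.entry) (instr := instr) le_rfl Sum.inl (.inr none)
      (fun _ => rfl) (by omega) (fun _ => [])
      (fun j => ⟨rfl, by simp only [List.length_nil, pow_zero]; nlinarith⟩)
    refine ⟨D, (reach_initial (by omega)).trans (hr.trans ?_)⟩
    have ht := reach_test (start := .inl R.entry) (instr := instr) (x := w)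
      (s := Nat.log 2 ((c + 1) * (w.length + 1)) + 3) (D := D) hh (q := .inr none) rfl (by omega)
    cases hfw : f w with
    | false => rw [hfw] at ht; simpa [OfflineTM.inputAt] using ht
    | true =>
      rw [hfw] at ht
      simpa [OfflineTM.inputAt_succ_ne_leftEnd w 0] using ht
  refine ⟨M, Nat.log 2 (c + 1) + 5, fun w => ?_⟩
  obtain ⟨D, hD⟩ := hreach w
  constructor
  · obtain ⟨t, ht, -⟩ := hD
    refine ⟨t, ?_⟩
    unfold AnswersWithin OfflineTM.run
    rw [ht]
    cases hfw : f w with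
    | false => exact .inr ⟨fun (h : f w = true) => by simp [hfw] at h, rfl⟩
    | true => exact .inl ⟨hfw, rfl⟩
  · have hs := hD.usesSpaceAtMost (b := f w) rfl
    intro t k
    refine (hs t k).trans_le ?_
    have := Nat.log_two_mul_add_one_le (c + 1) w.length (by omega)
    nlinarith [Nat.zero_le (Nat.log 2 (c + 1) * Nat.log 2 w.length)]


/-! ### Logarithmic space is contained in polynomial time -/

namespace OfflineTM

variable {α : Type u} [Finite α] {M : OfflineTM α} {x : List α} {s : ℕ}

theorem run_succ (t : ℕ) : M.run x (t + 1) = M.next x (M.run x t) :=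
  Function.iterate_succ_apply' _ _ _

theorem run_add (t u : ℕ) : M.run x (t + u) = (M.next x)^[t] (M.run x u) :=
  Function.iterate_add_apply _ _ _ _

theorem run_inputHead_lt (t : ℕ) : (M.run x t).inputHead < x.length + 2 := by
  induction t with
  | zero => simp [run, initialConfig]
  | succ t ih =>
    rw [run_succ]
    unfold next
    split
    · exact ih
    · simp only; omega

theorem run_work_of_le (hs : M.UsesSpaceAtMost x s) (t : ℕ) (k : Fin M.tapes) {i : ℕ} (hi : s ≤ i) :
    (M.run x t).work k i = M.blank := by
  induction t with
  | zero => rfl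
  | succ t ih =>
    rw [run_succ]
    unfold next
    split
    · exact ih
    · have := hs t k
      simp only
      rw [Function.update_of_ne (by omega), ih]

/-- The part of a configuration that can vary during a computation in space `s`. -/
def Config.restrict (n s : ℕ) (c : M.Config) (hi : c.inputHead < n) (hw : ∀ k, c.workHead k < s) :
    M.State × Fin n × (Fin M.tapes → Fin s) × (Fin M.tapes → Fin s → M.WorkSymbol) :=
  (c.state, ⟨_, hi⟩, fun k => ⟨_, hw k⟩, fun k i => c.work k i)

theorem run_eq_of_restrict_eq (hs : M.UsesSpaceAtMost x s) {t t' : ℕ}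
    (h : (M.run x t).restrict _ s (run_inputHead_lt t) (hs t) =
      (M.run x t').restrict _ s (run_inputHead_lt t') (hs t')) : M.run x t = M.run x t' := by
  simp only [Config.restrict, Prod.mk.injEq, Fin.mk.injEq, funext_iff] at h
  obtain ⟨h1, h2, h3, h4⟩ := h
  have h5 : (M.run x t).workHead = (M.run x t').workHead := funext h3
  have h6 : (M.run x t).work = (M.run x t').work := by
    funext k i
    by_cases hi : i < s
    · exact h4 k ⟨i, hi⟩
    · rw [run_work_of_le hs t k (by omega), run_work_of_le hs t' k (by omega)]
  cases hc : M.run x t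
  cases hc' : M.run x t'
  simp_all

/-- A computation in bounded space halts, if at all, after at most as many steps as there are
configurations. -/
theorem exists_halt_le (hs : M.UsesSpaceAtMost x s) {T : ℕ}
    (hT : M.verdict (M.run x T).state ≠ none) :
    ∃ t ≤ Nat.card M.State * (x.length + 2) * s ^ M.tapes * (Nat.card M.WorkSymbol ^ s) ^ M.tapes,
      M.verdict (M.run x t).state ≠ none := by
  classical
  have hex : ∃ t, M.verdict (M.run x t).state ≠ none := ⟨T, hT⟩
  refine ⟨Nat.find hex, ?_, Nat.find_spec hex⟩
  have := M.finite_state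
  have := M.finite_workSymbol
  let F : Fin (Nat.find hex) →
      M.State × Fin (x.length + 2) × (Fin M.tapes → Fin s) × (Fin M.tapes → Fin s → M.WorkSymbol) :=
    fun t => (M.run x t).restrict _ s (run_inputHead_lt t) (hs t)
  -- If a configuration recurred before the first halting time, the halting configuration would be
  -- reached earlier by the length of the cycle.
  have hlt : ∀ t t' : ℕ, t < t' → t' < Nat.find hex → M.run x t ≠ M.run x t' := by
    intro t t' htt ht' heq
    obtain ⟨d, hd⟩ := Nat.exists_eq_add_of_lt ht'
    refine Nat.find_min hex (m := d + 1 + t) (by omega) ?_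
    rw [run_add, heq, ← run_add, show d + 1 + t' = Nat.find hex by omega]
    exact Nat.find_spec hex
  have hF : Function.Injective F := by
    intro t t' h
    have h := run_eq_of_restrict_eq hs h
    rcases lt_trichotomy t.val t'.val with hl | hl | hl
    · exact absurd h (hlt _ _ hl t'.isLt)
    · exact Fin.ext hl
    · exact absurd h.symm (hlt _ _ hl t.isLt)
  have := Nat.card_le_card_of_injective F hF
  simp only [Nat.card_prod, Nat.card_fun, Nat.card_eq_fintype_card (α := Fin _),
    Fintype.card_fin] at this
  calc _ ≤ _ := this
    _ = _ := by ring

end OfflineTM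

open OfflineTM in
-- In space `c log n + c` there are only polynomially many configurations. The factor that could be
-- too large is the number of tape contents; it is polynomial because `g ≤ 2 ^ g` and `2 ^ log n ≤ n
-- + 1`.
theorem InLogspace.inPtime {α : Type u} [Finite α] {A : Language α} (h : InLogspace A) :
    InPtime A := by
  obtain ⟨M, c, hM⟩ := h
  let g := Nat.card M.WorkSymbol
  let e := g * M.tapes * c
  refine ⟨M, .C (Nat.card M.State) * (.X + .C 2) * (.C c * .X + .C c) ^ M.tapes *
    (.C (2 ^ e) * (.X + .C 1) ^ e), fun x => ?_⟩
  obtain ⟨⟨T, hT⟩, hs⟩ := hM x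
  have hhalt : M.verdict (M.run x T).state ≠ none := by
    rcases hT with ⟨-, h⟩ | ⟨-, h⟩ <;> simp [h]
  obtain ⟨t, ht, hv⟩ := exists_halt_le hs hhalt
  obtain ⟨b, hb⟩ := Option.ne_none_iff_exists'.1 hv
  have hfix : ∀ u, t ≤ u → M.run x u = M.run x t := by
    intro u hu
    obtain ⟨d, rfl⟩ := Nat.exists_eq_add_of_le' hu
    rw [run_add]
    exact Function.iterate_fixed (next_of_verdict hb) d
  -- `AnswersWithin` looks at the time bound itself, so the answer has to persist after halting.
  have hall : ∀ u, t ≤ u → M.AnswersWithin A x u := by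
    intro u hu
    have h1 := hfix u hu
    have h2 : M.run x T = M.run x t := by
      rcases le_total t T with h | h
      · exact hfix T h
      · obtain ⟨b', hb'⟩ := Option.ne_none_iff_exists'.1 hhalt
        obtain ⟨d, rfl⟩ := Nat.exists_eq_add_of_le' h
        rw [run_add]
        exact (Function.iterate_fixed (next_of_verdict hb') d).symm
    unfold AnswersWithin at hT ⊢
    rwa [h1, ← h2]
  refine hall _ (ht.trans ?_)
  simp only [Polynomial.eval_mul, Polynomial.eval_add, Polynomial.eval_pow, Polynomial.eval_C,
    Polynomial.eval_X]
  have hlog : 2 ^ Nat.log 2 x.length ≤ x.length + 1 := by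
    rcases Nat.eq_zero_or_pos x.length with h | h
    · simp [h]
    · exact (Nat.pow_log_le_self 2 h.ne').trans (by omega)
  gcongr
  · exact Nat.log_le_self _ _
  · calc (g ^ (c * Nat.log 2 x.length + c)) ^ M.tapes
        ≤ ((2 ^ g) ^ (c * Nat.log 2 x.length + c)) ^ M.tapes := by
          gcongr; exact Nat.lt_two_pow_self.le
      _ = 2 ^ e * (2 ^ Nat.log 2 x.length) ^ e := by
          rw [← pow_mul, ← pow_mul, ← pow_mul, ← pow_add]; congr 1; simp only [e]; ring
      _ ≤ _ := by gcongr


open RegCode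

/-! ### Loops over the positions of the input -/

/-- Perform `f 0, f 1, …, f (n - 1)` in this order. -/
def forwardLoop {S : Type u} (f : ℕ → S → S) (s : S) : ℕ → S
  | 0 => s
  | n + 1 => f n (forwardLoop f s n)

/-- Perform `f (n - 1), …, f 1, f 0` in this order. -/
def backwardLoop {S : Type u} (f : ℕ → S → S) : ℕ → S → S
  | 0, s => s
  | n + 1, s => backwardLoop f n (f n s)

theorem forwardLoop_eq_iterate {S : Type u} (f : ℕ → S → S) (s : S) (n : ℕ) :
    (fun p : ℕ × S => (p.1 + 1, f p.1 p.2))^[n] (0, s) = (n, forwardLoop f s n) := by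
  induction n with
  | zero => rfl
  | succ n ih => rw [Function.iterate_succ_apply', ih]; rfl

/-- The `n` rounds that remain after `t` steps are there for the induction; the case of interest is
`n = 0`. -/
theorem backwardLoop_eq_iterate {S : Type u} (f : ℕ → S → S) (s : S) (n t : ℕ) :
    backwardLoop f (n + t) s =
      backwardLoop f n ((fun p : ℕ × S => (p.1 - 1, f (p.1 - 1) p.2))^[t] (n + t, s)).2 := by
  induction t generalizing s with
  | zero => rfl
  | succ t ih =>
    rw [Function.iterate_succ_apply]
    exact ih (f (n + t) s)

namespace LogFn

variable {α : Type u} {X : Type u₁} {S : Type u₂} [RegCode X] [RegCode S]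

/-- By `hK` a round exceeds the larger of state and index by a constant at most, so linearly many
rounds keep the state linear. The index is allowed in the bound so that a round may record its
position. -/
theorem forwardLoop {n : List α → X → ℕ} {s₀ : List α → X → S} {f : List α → X → ℕ → S → S}
    (hn : LogFn n) (hs : LogFn s₀) (hf : LogFn fun w (p : (X × ℕ) × S) => f w p.1.1 p.1.2 p.2)
    (hK : ∃ K, ∀ w x j s, size (f w x j s) ≤ max (size s) j + K) :
    LogFn fun w x => _root_.forwardLoop (f w x) (s₀ w x) (n w x) := by
  obtain ⟨K, hK⟩ := hK
  have key := iterate (s₀ := fun w x => (0, s₀ w x))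
    (f := fun w (p : X × (ℕ × S)) => (p.2.1 + 1, f w p.1 p.2.1 p.2.2)) hn
    (pair (natConst 0) hs)
    (pair (succ (fst (snd id))) (comp hf (pair (pair (fst id) (fst (snd id))) (snd (snd id)))))
    (by
      obtain ⟨a, ha, -⟩ := hn
      obtain ⟨b, hb, -⟩ := hs
      refine ⟨b + a + K * a, fun w x t ht => ?_⟩
      have h1 := ha w x
      rw [size_nat] at h1
      have h2 : size (_root_.forwardLoop (f w x) (s₀ w x) t) ≤ size (s₀ w x) + t + K * t := by
        clear ht
        induction t with
        | zero => exact le_rfl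
        | succ t ih =>
          refine (hK w x t _).trans ?_
          have : max (size (_root_.forwardLoop (f w x) (s₀ w x) t)) t
              ≤ size (s₀ w x) + t + K * t := max_le ih (by omega)
          calc _ ≤ size (s₀ w x) + t + K * t + K := by omega
            _ ≤ _ := by ring_nf; omega
      dsimp only
      rw [forwardLoop_eq_iterate, size_prod, size_nat]
      have h3 : K * t ≤ K * (a * (w.length + size x + 1)) := by gcongr; omega
      have h4 := hb w x
      have h5 : size (s₀ w x) + t + K * t ≤ (b + a + K * a) * (w.length + size x + 1) := by
        calc _ ≤ b * (w.length + size x + 1) + a * (w.length + size x + 1)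
              + K * (a * (w.length + size x + 1)) := by omega
          _ = _ := by ring
      exact max_le (by omega) (h2.trans h5))
  simp only [forwardLoop_eq_iterate] at key
  exact snd key

theorem backwardLoop {n : List α → X → ℕ} {s₀ : List α → X → S} {f : List α → X → ℕ → S → S}
    (hn : LogFn n) (hs : LogFn s₀) (hf : LogFn fun w (p : (X × ℕ) × S) => f w p.1.1 p.1.2 p.2)
    (hK : ∃ K, ∀ w x j s, size (f w x j s) ≤ max (size s) j + K) :
    LogFn fun w x => _root_.backwardLoop (f w x) (n w x) (s₀ w x) := by
  obtain ⟨K, hK⟩ := hK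
  have key := iterate (s₀ := fun w x => (n w x, s₀ w x))
    (f := fun w (p : X × (ℕ × S)) => (p.2.1 - 1, f w p.1 (p.2.1 - 1) p.2.2)) hn
    (pair hn hs)
    (pair (pred (fst (snd id)))
      (comp hf (pair (pair (fst id) (pred (fst (snd id)))) (snd (snd id)))))
    (by
      obtain ⟨a, ha, -⟩ := hn
      obtain ⟨b, hb, -⟩ := hs
      refine ⟨b + a + K * a, fun w x t ht => ?_⟩
      have h1 := ha w x
      rw [size_nat] at h1
      have h2 : ∀ t, ((fun p : ℕ × S => (p.1 - 1, f w x (p.1 - 1) p.2))^[t] (n w x, s₀ w x)).1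
            ≤ n w x ∧
          size ((fun p : ℕ × S => (p.1 - 1, f w x (p.1 - 1) p.2))^[t] (n w x, s₀ w x)).2
            ≤ size (s₀ w x) + n w x + K * t := by
        intro t
        induction t with
        | zero => exact ⟨le_rfl, by simp⟩
        | succ t ih =>
          rw [Function.iterate_succ_apply']
          set p := (fun p : ℕ × S => (p.1 - 1, f w x (p.1 - 1) p.2))^[t] (n w x, s₀ w x)
          refine ⟨(Nat.sub_le _ _).trans ih.1, (hK w x _ _).trans ?_⟩
          have : max (size p.2) (p.1 - 1) ≤ size (s₀ w x) + n w x + K * t :=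
            max_le ih.2 (by omega)
          calc _ ≤ size (s₀ w x) + n w x + K * t + K := by omega
            _ ≤ _ := by ring_nf; omega
      have h2 := h2 t
      dsimp only
      rw [size_prod, size_nat]
      have h3 : K * t ≤ K * (a * (w.length + size x + 1)) := by gcongr; omega
      have h4 := hb w x
      have h5 : size (s₀ w x) + n w x + K * t ≤ (b + a + K * a) * (w.length + size x + 1) := by
        calc _ ≤ b * (w.length + size x + 1) + a * (w.length + size x + 1)
              + K * (a * (w.length + size x + 1)) := by omega
          _ = _ := by ring
      exact max_le (by omega) (h2.2.trans h5))
  have h : ∀ w x, ((fun s : ℕ × S => (s.1 - 1, f w x (s.1 - 1) s.2))^[n w x] (n w x, s₀ w x)).2 =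
      _root_.backwardLoop (f w x) (n w x) (s₀ w x) := fun w x => by
    have := backwardLoop_eq_iterate (f w x) (s₀ w x) 0 (n w x)
    rw [zero_add] at this
    rw [this]; rfl
  simpa only [h] using snd key

/-! ### Finite control with a counter. -/

theorem size_finite_bound {D : Type v} [Finite D] :
    ∃ K, ∀ a b : D, ∀ j : ℕ, size a ≤ max (size b) j + K :=
  ⟨Nat.card D, fun a _ _ => (size_finite_lt a).le.trans (Nat.le_add_left _ _)⟩

theorem size_counter_bound {D : Type v} [Finite D] (K : ℕ) :
    ∃ K', ∀ (a b : D × ℕ) (j : ℕ), a.2 ≤ max b.2 j + K → size a ≤ max (size b) j + K' := by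
  refine ⟨Nat.card D + K, fun a b j h => ?_⟩
  rw [size_prod, size_prod, size_nat, size_nat]
  have := size_finite_lt a.1
  omega

theorem natCases {n : List α → X → ℕ} {f : List α → X → S} {g : List α → X → ℕ → S}
    (hn : LogFn n) (hf : LogFn f) (hg : LogFn fun w (p : X × ℕ) => g w p.1 p.2) :
    LogFn fun w x => Nat.casesOn (motive := fun _ => S) (n w x) (f w x) (g w x) := by
  have := cond (isZero hn) hf (comp hg (pair id (pred hn)))
  convert this using 3 with w x
  cases n w x <;> simp

/-- A function on a finite part and a counter that, on a positive counter, yields a finite part that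
does not depend on the counter, and adds a constant to the predecessor of the counter. -/
def _root_.IsCounterStep {D : Type v} {E : Type w} (h : D → ℕ → E × ℕ) : Prop :=
  ∀ q, ∃ e k, ∀ d, h q (d + 1) = (e, d + k)

theorem _root_.IsCounterStep.bound {D : Type v} [Finite D] {E : Type w} {h : D → ℕ → E × ℕ}
    (hh : IsCounterStep h) : ∃ K, ∀ q d, (h q d).2 ≤ d + K := by
  choose e k hk using hh
  obtain ⟨K, hK⟩ := (Set.finite_range fun q => max (k q) (h q 0).2).bddAbove
  refine ⟨K, fun q d => ?_⟩
  have : max (k q) (h q 0).2 ≤ K := hK ⟨q, rfl⟩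
  cases d with
  | zero => omega
  | succ d => rw [hk]; dsimp only; omega

/-- Once the finite part is fixed, what remains is a test for zero, a predecessor and the addition
of a constant. -/
theorem counterStep {D : Type v} [Finite D] {E : Type w} [Finite E] {h : D → ℕ → E × ℕ}
    (hh : IsCounterStep h) {q : List α → X → D} {d : List α → X → ℕ} (hq : LogFn q) (hd : LogFn d) :
    LogFn fun w x => h (q w x) (d w x) := by
  refine cases (f := fun e w x => h e (d w x)) hq fun a => ?_
  obtain ⟨e, k, hk⟩ := hh a
  have : LogFn fun w x => Nat.casesOn (motive := fun _ => E × ℕ) (d w x) (h a 0)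
      (fun d => (e, d + k)) :=
    natCases hd (pair (finConst (h a 0).1) (natConst (h a 0).2))
      (pair (finConst e) (add (snd id) (natConst k)))
  convert this using 3 with w x
  cases d w x with
  | zero => rfl
  | succ d => exact hk d

end LogFn


open RegCode

/-! ### The evaluation algorithm -/

namespace PosFormula

section Steps

variable {σ : FirstOrder.Language.{u, v}}

/-- Scanning to the left for the innermost open pair of parentheses: `some b` if it has been found,
where `b` tells whether its connective has been found inside. The counter holds the number of
pending closing parentheses. -/
def topStep : Option (Token σ) × Option Bool → ℕ → Option Bool × ℕ
  | (_, some b), d => (some b, d)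
  | (some .rparen, none), d => (none, d + 1)
  | (some .lparen, none), 0 => (some false, 0)
  | (some .lparen, none), d + 1 => (none, d)
  | (some .and, none), 0 => (some true, 0)
  | (some .or, none), 0 => (some true, 0)
  | (_, none), d => (none, d)

/-- The states of the parser. The `Option Bool` is `none` if no digit may follow, and otherwise tells
whether the digits read so far are those of a number. -/
inductive ParseState : Type
  | before (o : Option Bool)
  | quantifier
  | after (o : Option Bool)
  | fail

/-- One step of the parser on the token `a`, where `b` is the information on the innermost open pair
of parentheses. The counter holds the number of arguments that are still expected. -/
def parseStep : Option (Token σ) → Option Bool → ParseState → ℕ → ParseState × ℕ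
  -- Positions behind the formula, such as those of a certificate, change nothing.
  | none, _, q, m => (q, m)
  | some (.digit c), _, .before (some _), m => (.before (some c), m)
  | some (.digit c), _, .after (some _), m => (.after (some c), m)
  | some (.rel R), _, .before o, m => if o = some false then (.fail, m) else (.after none, m + R.1)
  | some .lparen, _, .before o, m => if o = some false then (.fail, m) else (.before none, m)
  | some .all, _, .before o, m => if o = some false then (.fail, m) else (.quantifier, m)
  | some .ex, _, .before o, m => if o = some false then (.fail, m) else (.quantifier, m)
  | some .var, _, .quantifier, m => (.before (some true), m)
  | some .var, _, .after o, m + 1 => if o = some false then (.fail, m) else (.after (some true), m)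
  | some .and, b, .after o, 0 =>
    if o ≠ some false ∧ b = some false then (.before none, 0) else (.fail, 0)
  | some .or, b, .after o, 0 =>
    if o ≠ some false ∧ b = some false then (.before none, 0) else (.fail, 0)
  | some .rparen, b, .after o, 0 =>
    if o ≠ some false ∧ b = some true then (.after none, 0) else (.fail, 0)
  | _, _, _, m => (.fail, m)

def digit? : Option (Token σ) → Option Bool
  | some (.digit b) => some b
  | _ => none

/-- Comparing two words of digits: `some b` if the comparison has been decided. -/
def compareStep (a b : Option Bool) (s : Option Bool) : Option Bool :=
  match s with
  | some r => some r
  | none => if a = b then (if a = none then some true else none) else some false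

/-- Scanning to the left for a quantifier: the counter holds the number of open parentheses to be
skipped. -/
def scopeStep : Option (Token σ) × Bool → ℕ → Bool × ℕ
  | (_, true), d => (true, d)
  | (some .rparen, false), d => (false, d + 1)
  -- At counter `0` this parenthesis encloses the starting position; truncated subtraction keeps the
  -- counter at `0` when it is passed.
  | (some .lparen, false), d => (false, d - 1)
  -- The start lies in the second operand, so quantifiers in the first one do not bind there; it is
  -- skipped up to its opening parenthesis.
  | (some .and, false), 0 => (false, 1)
  | (some .or, false), 0 => (false, 1)
  | (_, false), d => (false, d)

def isQuantifier : Option (Token σ) → Bool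
  | some .all => true
  | some .ex => true
  | _ => false

/-- The states of the evaluation. In `skip v` the remainder of a pair of parentheses is skipped,
whose value is `v`; in `run v c`, the formula read last has the value `v`, and `c` is the atom that
is being read, with the values of its arguments. -/
inductive EvalState (σ : FirstOrder.Language.{u, v}) (B : Type w) (k : ℕ) : Type (max v w)
  | skip (v : Bool)
  | run (v : Bool) (c : Option ((Σ n, σ.Relations n) × {l : List B // l.length ≤ k}))

variable {B : Type w} [σ.Structure B] {k : ℕ}

open scoped Classical in
-- An argument list of the wrong length counts as false, so the function is also defined on atoms
-- that have been read only in part.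
noncomputable def truth (R : Σ n, σ.Relations n) (l : List B) : Bool :=
  decide (∃ x : Fin R.1 → B, List.ofFn x = l ∧ FirstOrder.Language.Structure.RelMap R.2 x)

/-- Append an element, unless the list is too long. -/
def push (l : {l : List B // l.length ≤ k}) (b : B) : {l : List B // l.length ≤ k} :=
  if h : (l.1 ++ [b]).length ≤ k then ⟨l.1 ++ [b], h⟩ else l

/-- One step of the evaluation on the token `a`, where `b` is the value of the variable there. -/
noncomputable def evalStep (a : Option (Token σ)) (b : B) :
    EvalState σ B k → ℕ → EvalState σ B k × ℕ
  | .skip v, d =>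
    match a, d with
    | some .lparen, d => (.skip v, d + 1)
    | some .rparen, 0 => (.run v none, 0)
    | some .rparen, d + 1 => (.skip v, d)
    | _, d => (.skip v, d)
  | .run v c, d =>
    match a, c with
    -- For a nullary symbol this is already the final value; otherwise the value becomes right with
    -- the last argument.
    | some (.rel R), _ => (.run (truth R ([] : List B)) (some (R, ⟨[], Nat.zero_le k⟩)), d)
    | some .var, some (R, l) => (.run (truth R (push l b).1) (some (R, push l b)), d)
    -- The atom is dropped, lest the variable of the quantifier be taken for an argument of it.
    | some .all, _ => (.run v none, d)
    | some .ex, _ => (.run v none, d)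
    -- A false first operand decides the conjunction; a true one leaves its value to the second
    -- operand. Hence no stack of values is needed.
    | some .and, c => (if v then .run v c else .skip v, d)
    | some .or, c => (if v then .skip v else .run v c, d)
    | _, c => (.run v c, d)

instance : Finite ParseState := by
  refine Finite.of_injective (β := Option Bool ⊕ Option Bool ⊕ Bool)
    (fun q => match q with
      | .before o => .inl o
      | .after o => .inr (.inl o)
      | .quantifier => .inr (.inr true)
      | .fail => .inr (.inr false)) ?_
  intro p q h
  cases p <;> cases q <;> simp_all

instance [Finite (Σ n, σ.Relations n)] [Finite B] : Finite (EvalState σ B k) := by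
  have : Finite {l : List B // l.length ≤ k} := (List.finite_length_le B k).to_subtype
  refine Finite.of_injective
    (β := Bool ⊕ (Bool × Option ((Σ n, σ.Relations n) × {l : List B // l.length ≤ k})))
    (fun q => match q with
      | .skip v => .inl v
      | .run v c => .inr (v, c)) ?_
  intro p q h
  cases p <;> cases q <;> simp_all

end Steps

/-! ### Parsing, binding and evaluation as loops over the positions. -/

section Algorithm

variable {σ : FirstOrder.Language.{u, v}} (t : ℕ → Option (Token σ)) (n : ℕ)

/-- The innermost pair of parentheses that is open at position `p`, as for `topStep`. -/
def top (p : ℕ) : Option Bool :=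
  (backwardLoop (fun j (s : Option Bool × ℕ) => topStep (t j, s.1) s.2) p (none, 0)).1

def parse : ParseState × ℕ :=
  forwardLoop (fun p (s : ParseState × ℕ) => parseStep (t p) (top t p) s.1 s.2)
    (.before none, 0) n

def isFinal : ParseState → Bool
  | .after (some false) => false
  | .after _ => true
  | _ => false

/-- Is the word a formula? -/
def wellFormed : Bool :=
  isFinal (parse t n).1 && decide ((parse t n).2 = 0) && decide (top t n = none)

/-- Do the same digits follow the positions `p` and `q`? -/
def sameVar (p q : ℕ) : Bool :=
  decide (forwardLoop (fun i => compareStep (digit? (t (p + 1 + i))) (digit? (t (q + 1 + i))))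
    none n = some true)

/-- Counter `0` means that position `p` is not separated from `j` by a skipped operand; only then
may a quantifier at `j`, whose variable is written at `j + 1`, bind the variable at `p`. -/
def binderStep (p j : ℕ) (s : Bool × ℕ) : Bool × ℕ :=
  bif !s.1 && isQuantifier (t j) && decide (s.2 = 0) && sameVar t n p (j + 1) then (true, j)
  else scopeStep (t j, s.1) s.2

/-- Whether the variable at position `p` is bound, and the position of its quantifier. -/
def binder (p : ℕ) : Bool × ℕ := backwardLoop (binderStep t n p) p (false, 0)

def isVar : Option (Token σ) → Bool
  | some .var => true
  | _ => false

/-- Are all variables bound? -/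
def closed : Bool :=
  forwardLoop (fun p s => s && !(isVar (t p) && !(binder t n p).1)) true n

variable {B : Type w} [σ.Structure B] (k : ℕ) (val : ℕ → B)

/-- The state of the evaluation, where the quantifier at position `p` is given the value `val p`. -/
noncomputable def evaluate : EvalState σ B k × ℕ :=
  forwardLoop (fun p (s : EvalState σ B k × ℕ) => evalStep (t p) (val (binder t n p).2) s.1 s.2)
    (.run false none, 0) n

def result : EvalState σ B k → Bool
  | .skip v => v
  | .run v _ => v

/-- Is the word a sentence that is true if the quantifiers are given the values `val`? -/
noncomputable def check : Bool :=
  wellFormed t n && closed t n && result k (evaluate t n k val).1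

end Algorithm

/-! ### The algorithm works in logarithmic space. -/

section LogFn

variable {σ : FirstOrder.Language.{u, v}}

theorem isCounterStep_topStep : IsCounterStep (topStep (σ := σ)) := by
  rintro ⟨_ | a, _ | q⟩
  · exact ⟨none, 1, fun d => rfl⟩
  · exact ⟨some q, 1, fun d => rfl⟩
  · cases a <;> first
      | exact ⟨none, 0, fun d => rfl⟩ | exact ⟨none, 1, fun d => rfl⟩ | exact ⟨none, 2, fun d => rfl⟩
  · exact ⟨some q, 1, fun d => by cases a <;> rfl⟩

theorem isCounterStep_scopeStep : IsCounterStep (scopeStep (σ := σ)) := by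
  rintro ⟨_ | a, _ | q⟩
  · exact ⟨false, 1, fun d => rfl⟩
  · exact ⟨true, 1, fun d => rfl⟩
  · cases a <;> first
      | exact ⟨false, 0, fun d => rfl⟩ | exact ⟨false, 1, fun d => rfl⟩
      | exact ⟨false, 2, fun d => rfl⟩
  · exact ⟨true, 1, fun d => by cases a <;> rfl⟩

theorem isCounterStep_parseStep : IsCounterStep
    fun q : Option (Token σ) × Option Bool × ParseState => parseStep q.1 q.2.1 q.2.2 := by
  rintro ⟨_ | a, b, q⟩
  · exact ⟨q, 1, fun d => rfl⟩
  · rcases a with R | _ | _ | _ | _ | _ | _ | _ | c <;> rcases q with o | _ | o | _ <;>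
      first
      | exact ⟨_, _, fun d => rfl⟩
      | exact ⟨.fail, 1, fun d => rfl⟩
      | exact ⟨.before (some true), 1, fun d => rfl⟩
      | skip
    all_goals
      rcases o with _ | o
      all_goals first
        | exact ⟨.fail, 1, fun d => rfl⟩
        | exact ⟨.after (some true), 0, fun d => rfl⟩
        | exact ⟨.after none, 1 + R.1, fun d => Prod.ext rfl (by simp [parseStep, add_assoc])⟩
        | exact ⟨.before none, 1, fun d => rfl⟩
        | exact ⟨.quantifier, 1, fun d => rfl⟩
        | exact ⟨.before (some c), 1, fun d => rfl⟩
        | exact ⟨.after (some c), 1, fun d => rfl⟩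
        | cases o
      all_goals first
        | exact ⟨.fail, 1, fun d => rfl⟩
        | exact ⟨.fail, 0, fun d => rfl⟩
        | exact ⟨.after (some true), 0, fun d => rfl⟩
        | exact ⟨.after none, 1 + R.1, fun d => Prod.ext rfl (by simp [parseStep, add_assoc])⟩
        | exact ⟨.before none, 1, fun d => rfl⟩
        | exact ⟨.quantifier, 1, fun d => rfl⟩

theorem isCounterStep_evalStep {B : Type w} [σ.Structure B] {k : ℕ} : IsCounterStep
    fun q : Option (Token σ) × B × EvalState σ B k => evalStep q.1 q.2.1 q.2.2 := by
  rintro ⟨a, b, v | ⟨v, c⟩⟩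
  · rcases a with _ | a
    · exact ⟨.skip v, 1, fun d => rfl⟩
    · cases a <;> first
        | exact ⟨.skip v, 0, fun d => rfl⟩ | exact ⟨.skip v, 1, fun d => rfl⟩
        | exact ⟨.skip v, 2, fun d => rfl⟩
  · refine ⟨(evalStep a b (.run v c) 0).1, 1, fun d => ?_⟩
    rcases a with _ | a
    · rfl
    · cases a <;> first | rfl | (cases c <;> rfl)

variable [Finite (Σ n, σ.Relations n)] {α : Type u₁} {t : List α → ℕ → Option (Token σ)}

/-- A pattern that recurs for the other automata: `LogFn.cases` fixes the arguments from finite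
types one after the other, until a function of state and counter is left, to which
`LogFn.counterStep` applies. -/
theorem logFn_top (ht : LogFn t) : LogFn fun w p => top (t w) p := by
  obtain ⟨K, hK⟩ := (isCounterStep_topStep (σ := σ)).bound
  obtain ⟨K', hK'⟩ := LogFn.size_counter_bound (D := Option Bool) K
  refine .fst (.backwardLoop (f := fun w _ j s => topStep (t w j, s.1) s.2) .id
    (.pair (.finConst none) (.natConst 0)) ?_
    ⟨K', fun w _ j s => hK' _ _ _ ((hK _ _).trans (by gcongr; exact le_max_left _ _))⟩)
  exact .cases (f := fun a _ (p : (ℕ × ℕ) × (Option Bool × ℕ)) => topStep (a, p.2.1) p.2.2)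
    (.comp ht (.snd (.fst .id))) fun a =>
    .counterStep (h := fun q => topStep (a, q)) (fun q => isCounterStep_topStep (a, q))
      (.fst (.snd .id)) (.snd (.snd .id))

theorem logFn_parse (ht : LogFn t) : LogFn fun w (_ : Unit) => parse (t w) w.length := by
  obtain ⟨K, hK⟩ := (isCounterStep_parseStep (σ := σ)).bound
  obtain ⟨K', hK'⟩ := LogFn.size_counter_bound (D := ParseState) K
  refine .forwardLoop (f := fun w _ p s => parseStep (t w p) (top (t w) p) s.1 s.2) .length
    (.pair (.finConst _) (.natConst 0)) ?_
    ⟨K', fun w _ j s => hK' _ _ _ ((hK (_, _, _) _).trans (by gcongr; exact le_max_left _ _))⟩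
  refine .cases (f := fun a w (p : (Unit × ℕ) × (ParseState × ℕ)) =>
    parseStep a (top (t w) p.1.2) p.2.1 p.2.2)
    (.comp ht (.snd (.fst .id))) fun a => ?_
  exact .cases (f := fun b _ (p : (Unit × ℕ) × (ParseState × ℕ)) => parseStep a b p.2.1 p.2.2)
    (.comp (logFn_top ht) (.snd (.fst .id))) fun b =>
    .counterStep (h := fun q => parseStep a b q) (fun q => isCounterStep_parseStep (a, b, q))
      (.fst (.snd .id)) (.snd (.snd .id))

theorem logFn_wellFormed (ht : LogFn t) :
    LogFn fun w (_ : Unit) => wellFormed (t w) w.length :=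
  .and (.and (.finMap (.fst (logFn_parse ht)) _) (.isZero (.snd (logFn_parse ht))))
    (.finMap (.comp (logFn_top ht) .length) fun a => decide (a = none))

theorem logFn_sameVar (ht : LogFn t) :
    LogFn fun w (x : ℕ × ℕ) => sameVar (t w) w.length x.1 x.2 := by
  refine .finMap (.forwardLoop (f := fun w (x : ℕ × ℕ) i => compareStep (digit? (t w (x.1 + 1 + i)))
    (digit? (t w (x.2 + 1 + i)))) .length (.finConst none) ?_ ?_) fun a => decide (a = some true)
  · refine .cases (f := fun a w (p : ((ℕ × ℕ) × ℕ) × Option Bool) => compareStep a (digit? (t w (p.1.1.2 + 1 + p.1.2))) p.2)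
      (.finMap (.comp ht (.add (.succ (.fst (.fst (.fst .id)))) (.snd (.fst .id)))) _) fun a => ?_
    exact .cases (f := fun b _ (p : ((ℕ × ℕ) × ℕ) × Option Bool) => compareStep a b p.2)
      (.finMap (.comp ht (.add (.succ (.snd (.fst (.fst .id)))) (.snd (.fst .id)))) _) fun b =>
        .finMap (.snd .id) _
  · obtain ⟨K, hK⟩ := LogFn.size_finite_bound (D := Option Bool)
    exact ⟨K, fun _ _ _ _ => hK _ _ _⟩

theorem logFn_binder (ht : LogFn t) : LogFn fun w (p : ℕ) => binder (t w) w.length p := by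
  obtain ⟨K, hK⟩ := (isCounterStep_scopeStep (σ := σ)).bound
  obtain ⟨K', hK'⟩ := LogFn.size_counter_bound (D := Bool) K
  refine .backwardLoop (f := fun w p j s => binderStep (t w) w.length p j s) .id
    (.pair (.finConst false) (.natConst 0)) ?_ ⟨K', fun w p j s => hK' _ _ _ ?_⟩
  · refine .cond (.and (.and (.and (.not (.fst (.snd .id)))
      (.finMap (.comp ht (.snd (.fst .id))) isQuantifier)) (.isZero (.snd (.snd .id))))
      (.comp (logFn_sameVar ht) (.pair (.fst (.fst .id)) (.succ (.snd (.fst .id))))))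
      (.pair (.finConst true) (.snd (.fst .id))) ?_
    exact .cases (f := fun a _ (p : (ℕ × ℕ) × (Bool × ℕ)) => scopeStep (a, p.2.1) p.2.2)
      (.comp ht (.snd (.fst .id)))
      fun a => .counterStep (h := fun q => scopeStep (a, q))
        (fun q => isCounterStep_scopeStep (a, q)) (.fst (.snd .id)) (.snd (.snd .id))
  · unfold binderStep
    cases (!s.1 && isQuantifier (t w j) && decide (s.2 = 0) && sameVar (t w) w.length p (j + 1))
    · exact (hK _ _).trans (by gcongr; exact le_max_left _ _)
    -- A successful search stores the loop index itself.
    · exact (le_max_right _ _).trans (Nat.le_add_right _ _)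

theorem logFn_closed (ht : LogFn t) : LogFn fun w (_ : Unit) => closed (t w) w.length := by
  refine .forwardLoop (f := fun w _ p s => s && !(isVar (t w p) && !(binder (t w) w.length p).1))
    .length (.finConst true) ?_ ?_
  · exact .and (.snd .id) (.not (.and (.finMap (.comp ht (.snd (.fst .id))) _)
      (.not (.fst (.comp (logFn_binder ht) (.snd (.fst .id)))))))
  · obtain ⟨K, hK⟩ := LogFn.size_finite_bound (D := Bool)
    exact ⟨K, fun _ _ _ _ => hK _ _ _⟩

variable {B : Type w} [σ.Structure B] [Finite B] {k : ℕ} {val : List α → ℕ → B}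

theorem logFn_evaluate (ht : LogFn t) (hval : LogFn val) :
    LogFn fun w (_ : Unit) => evaluate (t w) w.length k (val w) := by
  obtain ⟨K, hK⟩ := (isCounterStep_evalStep (σ := σ) (B := B) (k := k)).bound
  obtain ⟨K', hK'⟩ := LogFn.size_counter_bound (D := EvalState σ B k) K
  refine .forwardLoop (f := fun w _ p s => evalStep (t w p)
    (val w (binder (t w) w.length p).2) s.1 s.2) .length
    (.pair (.finConst (EvalState.run (σ := σ) (B := B) (k := k) false none)) (.natConst 0)) ?_ ⟨K', fun w _ j s => hK' _ _ _ ?_⟩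
  · refine .cases (f := fun a w (p : (Unit × ℕ) × (EvalState σ B k × ℕ)) =>
      evalStep a (val w (binder (t w) w.length p.1.2).2) p.2.1 p.2.2)
      (.comp ht (.snd (.fst .id))) fun a => ?_
    exact .cases (f := fun b _ (p : (Unit × ℕ) × (EvalState σ B k × ℕ)) =>
        evalStep a b p.2.1 p.2.2)
      (.comp hval (.snd (.comp (logFn_binder ht) (.snd (.fst .id))))) fun b =>
      .counterStep (h := fun q => evalStep a b q) (fun q => isCounterStep_evalStep (a, b, q))
        (.fst (.snd .id)) (.snd (.snd .id))
  · exact (hK (_, _, _) _).trans (by gcongr; exact le_max_left _ _)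

theorem logFn_check (ht : LogFn t) (hval : LogFn val) :
    LogFn fun w (_ : Unit) => check (t w) w.length k (val w) :=
  .and (.and (logFn_wellFormed ht) (logFn_closed ht)) (.finMap (.fst (logFn_evaluate ht hval)) _)

end LogFn

end PosFormula


/-! ### Correctness of the parser -/

namespace PosFormula

variable {σ : FirstOrder.Language.{u, v}}

/-- Words in which parentheses are matched as in formulas. -/
inductive Balanced : List (Token σ) → Prop
  | nil : Balanced []
  | single (a : Token σ) (h₁ : a ≠ .lparen) (h₂ : a ≠ .rparen) (h₃ : a ≠ .and) (h₄ : a ≠ .or) :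
      Balanced [a]
  | append {l m : List (Token σ)} (hl : Balanced l) (hm : Balanced m) : Balanced (l ++ m)
  | paren {l m : List (Token σ)} (a : Token σ) (ha : a = .and ∨ a = .or) (hl : Balanced l)
      (hm : Balanced m) : Balanced (.lparen :: (l ++ a :: (m ++ [.rparen])))

theorem Balanced.of_forall {l : List (Token σ)}
    (h : ∀ a ∈ l, a ≠ .lparen ∧ a ≠ .rparen ∧ a ≠ .and ∧ a ≠ .or) : Balanced l := by
  induction l with
  | nil => exact .nil
  | cons a l ih =>
    obtain ⟨h₁, h₂, h₃, h₄⟩ := h a (by simp)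
    exact .append (.single a h₁ h₂ h₃ h₄) (ih fun b hb => h b (by simp [hb]))

/-- The tokens of which lists of variables consist. -/
def IsVarToken (a : Token σ) : Prop := a = .var ∨ ∃ b, a = .digit b

theorem isVarToken_of_mem_encodeVar {i : ℕ} {a : Token σ} (h : a ∈ encodeVar i) : IsVarToken a := by
  simp only [encodeVar, List.mem_cons, List.mem_map] at h
  rcases h with rfl | ⟨b, -, rfl⟩
  · exact .inl rfl
  · exact .inr ⟨b, rfl⟩

theorem IsVarToken.ne {a : Token σ} (h : IsVarToken a) :
    a ≠ .lparen ∧ a ≠ .rparen ∧ a ≠ .and ∧ a ≠ .or := by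
  rcases h with rfl | ⟨b, rfl⟩ <;> simp

theorem balanced_encodeVar (i : ℕ) : Balanced (encodeVar (σ := σ) i) :=
  .of_forall fun _ h => (isVarToken_of_mem_encodeVar h).ne

theorem balanced_flatMap (l : List ℕ) : Balanced (l.flatMap (encodeVar (σ := σ))) :=
  .of_forall fun _ h => by
    obtain ⟨i, -, hi⟩ := List.mem_flatMap.1 h
    exact (isVarToken_of_mem_encodeVar hi).ne

theorem balanced_encode (φ : PosFormula σ) : Balanced φ.encode := by
  induction φ with
  | rel R x => exact .append (.single _ (by simp) (by simp) (by simp) (by simp)) (balanced_flatMap _)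
  | and φ ψ hφ hψ => exact .paren _ (.inl rfl) hφ hψ
  | or φ ψ hφ hψ => exact .paren _ (.inr rfl) hφ hψ
  | all i φ h =>
    exact .append (.single _ (by simp) (by simp) (by simp) (by simp))
      (.append (balanced_encodeVar i) h)
  | ex i φ h =>
    exact .append (.single _ (by simp) (by simp) (by simp) (by simp))
      (.append (balanced_encodeVar i) h)

/-- For every open pair of parentheses, innermost first, whether its connective has been read. -/
def stackStep (s : List Bool) : Token σ → List Bool
  | .lparen => false :: s
  | .rparen => s.tail
  | .and => true :: s.tail
  | .or => true :: s.tail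
  | _ => s

def stack (l : List (Token σ)) : List Bool := l.foldl stackStep []

theorem stack_snoc (l : List (Token σ)) (a : Token σ) : stack (l ++ [a]) = stackStep (stack l) a := by
  simp [stack]

/-- Each pair inside a balanced word is pushed, marked at its connective and popped again. -/
theorem stack_append_balanced {l : List (Token σ)} (hl : Balanced l) (m : List (Token σ)) :
    stack (m ++ l) = stack m := by
  have : ∀ s, l.foldl stackStep s = s := by
    induction hl with
    | nil => exact fun _ => rfl
    | single a h₁ h₂ h₃ h₄ => intro s; cases a <;> simp_all [stackStep]
    | append _ _ h₁ h₂ => intro s; rw [List.foldl_append, h₁, h₂]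
    | paren a ha _ _ h₁ h₂ =>
      intro s
      rcases ha with rfl | rfl <;> simp [stackStep, h₁, h₂]
  rw [stack, List.foldl_append, this, stack]

theorem backwardLoop_topStep_some (t : ℕ → Option (Token σ)) (p d : ℕ) (b : Bool) :
    backwardLoop (fun j (s : Option Bool × ℕ) => topStep (t j, s.1) s.2) p (some b, d) =
      (some b, d) := by
  induction p with
  | zero => rfl
  | succ p ih =>
    have : topStep (t p, some b) d = (some b, d) := by cases t p <;> rfl
    rw [backwardLoop]
    exact (congrArg _ this).trans ih

/-- A scan to the left with `d` pending closing parentheses finds entry `d` of the stack: the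
counter follows the pushes and pops backwards, letter by letter. -/
theorem top_append (u v : List (Token σ)) : top (fun j => (u ++ v)[j]?) u.length = (stack u)[0]? := by
  have : ∀ d, (backwardLoop (fun j (s : Option Bool × ℕ) => topStep ((u ++ v)[j]?, s.1) s.2)
      u.length (none, d)).1 = (stack u)[d]? := by
    induction u using List.reverseRecOn generalizing v with
    | nil => intro d; simp [backwardLoop, stack]
    | append_singleton u a ih =>
      intro d
      have ha : (u ++ [a] ++ v)[u.length]? = some a := by simp
      rw [List.length_append, List.length_singleton, backwardLoop, stack_snoc]
      simp only [ha]
      have ih := ih (a :: v)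
      rw [List.append_cons] at ih
      cases a <;> first
        | exact ih d
        | skip
      · cases d with
        | zero => exact congrArg Prod.fst (backwardLoop_topStep_some _ _ _ _)
        | succ d => exact (ih (d + 1)).trans (by simp [stackStep])
      · cases d with
        | zero => exact congrArg Prod.fst (backwardLoop_topStep_some _ _ _ _)
        | succ d => exact (ih (d + 1)).trans (by simp [stackStep])
      · cases d with
        | zero => exact congrArg Prod.fst (backwardLoop_topStep_some _ _ _ _)
        | succ d => exact (ih d).trans (by simp [stackStep])
      · exact (ih (d + 1)).trans (by simp [stackStep])
  exact this 0

theorem parse_snoc (u v : List (Token σ)) (a : Token σ) :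
    parse (fun j => (u ++ a :: v)[j]?) (u.length + 1) =
      parseStep (some a) (stack u)[0]? (parse (fun j => (u ++ a :: v)[j]?) u.length).1
        (parse (fun j => (u ++ a :: v)[j]?) u.length).2 := by
  have ha : (u ++ a :: v)[u.length]? = some a := by simp
  have := top_append u (a :: v)
  simp only [parse, forwardLoop] at this ⊢
  rw [this, ha]

/-- The value of the digits of a word, read from its last digit. -/
def lastDigit (b : Bool) (l : List Bool) : Bool := l.getLast?.getD b

/-- The digits of a number are the empty word, for `0`, or end in a one. So the last digit, with
default `true`, tells whether a word of digits names a number; this is all that the parser has to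
remember. -/
theorem lastDigit_bits (i : ℕ) : lastDigit true (Nat.bits i) = true := by
  induction i using Nat.binaryRec' with
  | zero => rfl
  | bit b n h ih =>
    rw [Nat.bits_append_bit n b h, lastDigit, List.getLast?_cons]
    cases hn : (Nat.bits n).getLast? with
    | none =>
      have h0 : Nat.bits n = [] := List.getLast?_eq_none_iff.1 hn
      have : n = 0 := by
        by_contra hne
        have := Nat.size_pos.2 (Nat.pos_of_ne_zero hne)
        rw [← Nat.size_eq_bits_len, h0] at this
        simp at this
      simpa using h this
    | some c => simpa [lastDigit, hn] using ih

theorem exists_bits_eq {l : List Bool} (h : lastDigit true l = true) : ∃ i, Nat.bits i = l := by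
  induction l with
  | nil => exact ⟨0, rfl⟩
  | cons b l ih =>
    have hl : lastDigit true l = true := by
      cases hl : l.getLast? with
      | none => simp [lastDigit, hl]
      | some c => simpa [lastDigit, List.getLast?_cons, hl] using h
    obtain ⟨i, rfl⟩ := ih hl
    refine ⟨Nat.bit b i, Nat.bits_append_bit i b fun hi => ?_⟩
    subst hi
    simpa [lastDigit] using h

/-! #### Formulas are accepted -/

theorem parse_digits_before (u v : List (Token σ)) (l : List Bool) (b : Bool) (m : ℕ)
    (h : parse (fun j => (u ++ (l.map Token.digit ++ v))[j]?) u.length = (.before (some b), m)) :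
    parse (fun j => (u ++ (l.map Token.digit ++ v))[j]?) (u.length + l.length) =
      (.before (some (lastDigit b l)), m) := by
  induction l generalizing u b with
  | nil => exact h
  | cons c l ih =>
    have h1 := parse_snoc u (l.map Token.digit ++ v) (.digit c)
    simp only [List.map_cons, List.cons_append] at h ⊢
    rw [h] at h1
    have := ih (u ++ [.digit c]) c (by simpa [parseStep] using h1)
    have hl : lastDigit b (c :: l) = lastDigit c l := by simp [lastDigit, List.getLast?_cons]
    rw [hl]
    simpa [add_assoc, add_comm 1] using this

theorem parse_digits_after (u v : List (Token σ)) (l : List Bool) (b : Bool) (m : ℕ)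
    (h : parse (fun j => (u ++ (l.map Token.digit ++ v))[j]?) u.length = (.after (some b), m)) :
    parse (fun j => (u ++ (l.map Token.digit ++ v))[j]?) (u.length + l.length) =
      (.after (some (lastDigit b l)), m) := by
  induction l generalizing u b with
  | nil => exact h
  | cons c l ih =>
    have h1 := parse_snoc u (l.map Token.digit ++ v) (.digit c)
    simp only [List.map_cons, List.cons_append] at h ⊢
    rw [h] at h1
    have := ih (u ++ [.digit c]) c (by simpa [parseStep] using h1)
    have hl : lastDigit b (c :: l) = lastDigit c l := by simp [lastDigit, List.getLast?_cons]
    rw [hl]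
    simpa [add_assoc, add_comm 1] using this

theorem parse_encodeVar_before (u v : List (Token σ)) (i m : ℕ)
    (h : parse (fun j => (u ++ (encodeVar i ++ v))[j]?) u.length = (.quantifier, m)) :
    parse (fun j => (u ++ (encodeVar i ++ v))[j]?) (u.length + (encodeVar (σ := σ) i).length) =
      (.before (some true), m) := by
  have h1 := parse_snoc u ((Nat.bits i).map Token.digit ++ v) .var
  simp only [encodeVar, List.cons_append] at h ⊢
  rw [h] at h1
  have := parse_digits_before (u ++ [.var]) v (Nat.bits i) true m (by simpa [parseStep] using h1)
  rw [lastDigit_bits] at this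
  simpa [add_assoc, add_comm 1] using this

theorem parse_flatMap (u v : List (Token σ)) (l : List ℕ) (o : Option Bool) (ho : o ≠ some false)
    (h : parse (fun j => (u ++ (l.flatMap encodeVar ++ v))[j]?) u.length = (.after o, l.length)) :
    ∃ o', o' ≠ some false ∧
      parse (fun j => (u ++ (l.flatMap encodeVar ++ v))[j]?)
        (u.length + (l.flatMap (encodeVar (σ := σ))).length) = (.after o', 0) := by
  induction l generalizing u o with
  | nil => exact ⟨o, ho, h⟩
  | cons i l ih =>
    have h1 := parse_snoc u ((Nat.bits i).map Token.digit ++ (l.flatMap encodeVar ++ v)) .var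
    simp only [List.flatMap_cons, encodeVar, List.cons_append, List.append_assoc,
      List.length_cons] at h ⊢
    have h0 := h
    rw [h0] at h1
    have h2 := parse_digits_after (u ++ [.var]) (l.flatMap encodeVar ++ v) (Nat.bits i) true l.length
      (by simpa [parseStep, ho, encodeVar] using h1)
    rw [lastDigit_bits] at h2
    obtain ⟨o', ho', h3⟩ := ih (u ++ .var :: (Nat.bits i).map Token.digit) (some true) (by simp)
      (by simpa [add_assoc, add_comm 1, encodeVar] using h2)
    refine ⟨o', ho', ?_⟩
    simpa [add_assoc, add_comm 1, add_left_comm 1, encodeVar] using h3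

theorem parse_encode (φ : PosFormula σ) (u v : List (Token σ)) (o : Option Bool)
    (ho : o ≠ some false)
    (h : parse (fun j => (u ++ (φ.encode ++ v))[j]?) u.length = (.before o, 0)) :
    ∃ o', o' ≠ some false ∧
      parse (fun j => (u ++ (φ.encode ++ v))[j]?) (u.length + φ.encode.length) =
        (.after o', 0) := by
  -- Conjunction and disjunction are treated alike. The equations `e1` to `e5` cut the same word at
  -- the places where the parser is inspected; balancedness of the operands determines the stack
  -- there.
  have binary : ∀ (φ ψ : PosFormula σ) (a : Token σ) (ha : a = .and ∨ a = .or)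
      (hφ : ∀ (u v : List (Token σ)) (o : Option Bool), o ≠ some false →
        parse (fun j => (u ++ (φ.encode ++ v))[j]?) u.length = (.before o, 0) →
        ∃ o', o' ≠ some false ∧ parse (fun j => (u ++ (φ.encode ++ v))[j]?)
          (u.length + φ.encode.length) = (.after o', 0))
      (hψ : ∀ (u v : List (Token σ)) (o : Option Bool), o ≠ some false →
        parse (fun j => (u ++ (ψ.encode ++ v))[j]?) u.length = (.before o, 0) →
        ∃ o', o' ≠ some false ∧ parse (fun j => (u ++ (ψ.encode ++ v))[j]?)
          (u.length + ψ.encode.length) = (.after o', 0))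
      (u v : List (Token σ)) (o : Option Bool) (ho : o ≠ some false)
      (l : List (Token σ)) (hl : l = .lparen :: (φ.encode ++ a :: (ψ.encode ++ [.rparen]))),
      parse (fun j => (u ++ (l ++ v))[j]?) u.length = (.before o, 0) →
        ∃ o', o' ≠ some false ∧ parse (fun j => (u ++ (l ++ v))[j]?)
          (u.length + l.length) = (.after o', 0) := by
    intro φ ψ a ha hφ hψ u v o ho l hl h
    set x := u ++ (l ++ v) with hx
    have e1 : x = u ++ .lparen :: (φ.encode ++ a :: (ψ.encode ++ .rparen :: v)) := by
      rw [hx, hl]; simp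
    have e2 : x = (u ++ [.lparen]) ++ (φ.encode ++ a :: (ψ.encode ++ .rparen :: v)) := by
      rw [e1]; simp
    have e3 : x = (u ++ .lparen :: φ.encode) ++ a :: (ψ.encode ++ .rparen :: v) := by
      rw [e1]; simp
    have e4 : x = (u ++ .lparen :: (φ.encode ++ [a])) ++ (ψ.encode ++ .rparen :: v) := by
      rw [e1]; simp
    have e5 : x = (u ++ .lparen :: (φ.encode ++ a :: ψ.encode)) ++ .rparen :: v := by
      rw [e1]; simp
    have h1 := parse_snoc u (φ.encode ++ a :: (ψ.encode ++ .rparen :: v)) .lparen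
    rw [← e1, h] at h1
    have h2 := hφ (u ++ [.lparen]) (a :: (ψ.encode ++ .rparen :: v)) none (by simp)
      (by rw [← e2]; simpa [parseStep, ho] using h1)
    rw [← e2] at h2
    obtain ⟨o₂, ho₂, h2⟩ := h2
    have h3 := parse_snoc (u ++ .lparen :: φ.encode) (ψ.encode ++ .rparen :: v) a
    have s3 : stack (u ++ .lparen :: φ.encode) = false :: stack u := by
      rw [List.append_cons, stack_append_balanced (balanced_encode φ), stack_snoc]; rfl
    rw [← e3, s3] at h3
    have h3 : parse (fun j => x[j]?) ((u ++ .lparen :: φ.encode).length + 1) = (.before none, 0) := by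
      rw [h3]
      rw [show (u ++ .lparen :: φ.encode).length = (u ++ [Token.lparen]).length + φ.encode.length by
        simp; ring, h2]
      rcases ha with rfl | rfl <;> simp [parseStep, ho₂]
    have h4 := hψ (u ++ .lparen :: (φ.encode ++ [a])) (.rparen :: v) none (by simp)
      (by rw [← e4, ← h3]; congr 1; simp; omega)
    rw [← e4] at h4
    obtain ⟨o₄, ho₄, h4⟩ := h4
    have h5 := parse_snoc (u ++ .lparen :: (φ.encode ++ a :: ψ.encode)) v .rparen
    have s5 : stack (u ++ .lparen :: (φ.encode ++ a :: ψ.encode)) = true :: stack u := by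
      rw [show u ++ Token.lparen :: (φ.encode ++ a :: ψ.encode) =
        ((u ++ .lparen :: φ.encode) ++ [a]) ++ ψ.encode by simp,
        stack_append_balanced (balanced_encode ψ), stack_snoc, s3]
      rcases ha with rfl | rfl <;> rfl
    rw [← e5, s5] at h5
    refine ⟨none, by simp, ?_⟩
    rw [show u.length + l.length =
      (u ++ .lparen :: (φ.encode ++ a :: ψ.encode)).length + 1 by rw [hl]; simp; ring, h5,
      show (u ++ .lparen :: (φ.encode ++ a :: ψ.encode)).length =
        (u ++ .lparen :: (φ.encode ++ [a])).length + ψ.encode.length by simp; ring, h4]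
    simp [parseStep, ho₄]
  have quantified : ∀ (φ : PosFormula σ) (i : ℕ) (a : Token σ) (ha : a = .all ∨ a = .ex)
      (hφ : ∀ (u v : List (Token σ)) (o : Option Bool), o ≠ some false →
        parse (fun j => (u ++ (φ.encode ++ v))[j]?) u.length = (.before o, 0) →
        ∃ o', o' ≠ some false ∧ parse (fun j => (u ++ (φ.encode ++ v))[j]?)
          (u.length + φ.encode.length) = (.after o', 0))
      (u v : List (Token σ)) (o : Option Bool) (ho : o ≠ some false)
      (l : List (Token σ)) (hl : l = a :: (encodeVar i ++ φ.encode)),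
      parse (fun j => (u ++ (l ++ v))[j]?) u.length = (.before o, 0) →
        ∃ o', o' ≠ some false ∧ parse (fun j => (u ++ (l ++ v))[j]?)
          (u.length + l.length) = (.after o', 0) := by
    intro φ i a ha hφ u v o ho l hl h
    set x := u ++ (l ++ v) with hx
    have e1 : x = u ++ a :: (encodeVar i ++ (φ.encode ++ v)) := by rw [hx, hl]; simp
    have e2 : x = (u ++ [a]) ++ (encodeVar i ++ (φ.encode ++ v)) := by rw [e1]; simp
    have e3 : x = (u ++ a :: encodeVar i) ++ (φ.encode ++ v) := by rw [e1]; simp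
    have h1 := parse_snoc u (encodeVar i ++ (φ.encode ++ v)) a
    rw [← e1, h] at h1
    have h2 := parse_encodeVar_before (u ++ [a]) (φ.encode ++ v) i 0 (by
      rw [← e2]
      rcases ha with rfl | rfl <;> simpa [parseStep, ho] using h1)
    rw [← e2] at h2
    have h3 := hφ (u ++ a :: encodeVar i) v (some true) (by simp)
      (by rw [← e3, ← h2]; congr 1; simp; ring)
    rw [← e3] at h3
    obtain ⟨o₃, ho₃, h3⟩ := h3
    refine ⟨o₃, ho₃, ?_⟩
    rw [← h3]; congr 1; rw [hl]; simp; ring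
  induction φ generalizing u v o with
  | @rel n R f =>
    set x := u ++ ((rel R f).encode ++ v) with hx
    have e1 : x = u ++ .rel ⟨n, R⟩ :: ((List.ofFn f).flatMap encodeVar ++ v) := by
      rw [hx]; simp [encode]
    have e2 : x = (u ++ [.rel ⟨n, R⟩]) ++ ((List.ofFn f).flatMap encodeVar ++ v) := by
      rw [e1]; simp
    have h1 := parse_snoc u ((List.ofFn f).flatMap encodeVar ++ v) (.rel ⟨n, R⟩)
    rw [← e1, h] at h1
    have h2 := parse_flatMap (u ++ [.rel ⟨n, R⟩]) v (List.ofFn f) none (by simp)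
      (by rw [← e2]; simpa [parseStep, ho] using h1)
    rw [← e2] at h2
    obtain ⟨o₂, ho₂, h2⟩ := h2
    refine ⟨o₂, ho₂, ?_⟩
    rw [← h2]; congr 1; simp [encode]; ring
  | and φ ψ hφ hψ => exact binary φ ψ .and (.inl rfl) hφ hψ u v o ho _ rfl h
  | or φ ψ hφ hψ => exact binary φ ψ .or (.inr rfl) hφ hψ u v o ho _ rfl h
  | all i φ hφ => exact quantified φ i .all (.inl rfl) hφ u v o ho _ rfl h
  | ex i φ hφ => exact quantified φ i .ex (.inr rfl) hφ u v o ho _ rfl h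

end PosFormula


namespace PosFormula

variable {σ : FirstOrder.Language.{u, v}}

/-! #### Accepted words are formulas -/

/-- The words after which a formula may begin, with the stack of open parentheses. -/
inductive IsContext : List (Token σ) → List Bool → Prop
  | nil : IsContext [] []
  | quantifier {u s} (a : Token σ) (i : ℕ) (ha : a = .all ∨ a = .ex) (h : IsContext u s) :
      IsContext (u ++ a :: encodeVar i) s
  | left {u s} (h : IsContext u s) : IsContext (u ++ [.lparen]) (false :: s)
  | right {u s} (φ : PosFormula σ) (a : Token σ) (ha : a = .and ∨ a = .or) (h : IsContext u s) :
      IsContext (u ++ .lparen :: (φ.encode ++ [a])) (true :: s)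

/-- After the context `u₀` of the whole pair come its opening parenthesis and possibly quantifiers,
which are absorbed into the formula that follows. -/
theorem IsContext.exists_left {u : List (Token σ)} {s : List Bool} (h : IsContext u (false :: s)) :
    ∃ u₀, IsContext u₀ s ∧ ∀ φ : PosFormula σ, ∃ ψ : PosFormula σ,
      u ++ φ.encode = u₀ ++ .lparen :: ψ.encode := by
  generalize hs : false :: s = s' at h
  induction h with
  | nil => simp at hs
  | quantifier a i ha h ih =>
    obtain ⟨u₀, hu₀, H⟩ := ih hs
    refine ⟨u₀, hu₀, fun φ => ?_⟩
    rcases ha with rfl | rfl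
    · obtain ⟨ψ, hψ⟩ := H (.all i φ)
      exact ⟨ψ, by rw [← hψ]; simp [encode]⟩
    · obtain ⟨ψ, hψ⟩ := H (.ex i φ)
      exact ⟨ψ, by rw [← hψ]; simp [encode]⟩
  | @left u₀ s h _ =>
    obtain rfl : _ = s := by simpa using hs
    exact ⟨u₀, h, fun φ => ⟨φ, by simp⟩⟩
  | right φ a ha h _ => simp at hs

/-- The context contains the first operand and the connective of the pair, perhaps followed by
quantifiers. After these are absorbed, the closing parenthesis completes a conjunction or
disjunction. -/
theorem IsContext.exists_right {u : List (Token σ)} {s : List Bool} (h : IsContext u (true :: s)) :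
    ∃ u₀, IsContext u₀ s ∧ ∀ φ : PosFormula σ, ∃ ψ : PosFormula σ,
      u ++ φ.encode ++ [.rparen] = u₀ ++ ψ.encode := by
  generalize hs : true :: s = s' at h
  induction h with
  | nil => simp at hs
  | quantifier a i ha h ih =>
    obtain ⟨u₀, hu₀, H⟩ := ih hs
    refine ⟨u₀, hu₀, fun φ => ?_⟩
    rcases ha with rfl | rfl
    · obtain ⟨ψ, hψ⟩ := H (.all i φ)
      exact ⟨ψ, by rw [← hψ]; simp [encode]⟩
    · obtain ⟨ψ, hψ⟩ := H (.ex i φ)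
      exact ⟨ψ, by rw [← hψ]; simp [encode]⟩
  | left h _ => simp at hs
  | @right u₀ s φ a ha h _ =>
    obtain rfl : _ = s := by simpa using hs
    refine ⟨u₀, h, fun ψ => ?_⟩
    rcases ha with rfl | rfl
    · exact ⟨.and φ ψ, by simp [encode]⟩
    · exact ⟨.or φ ψ, by simp [encode]⟩

theorem IsContext.exists_nil {u : List (Token σ)} (h : IsContext u []) (φ : PosFormula σ) :
    ∃ ψ : PosFormula σ, u ++ φ.encode = ψ.encode := by
  generalize hs : [] = s' at h
  induction h generalizing φ with
  | nil => exact ⟨φ, rfl⟩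
  | quantifier a i ha h ih =>
    rcases ha with rfl | rfl
    · obtain ⟨ψ, hψ⟩ := ih (.all i φ) hs
      exact ⟨ψ, by rw [← hψ]; simp [encode]⟩
    · obtain ⟨ψ, hψ⟩ := ih (.ex i φ) hs
      exact ⟨ψ, by rw [← hψ]; simp [encode]⟩
  | left h _ => simp at hs
  | right φ a ha h _ => simp at hs

/-- What has been read when the parser is in a given state. -/
def ParseInv : ParseState → ℕ → List (Token σ) → Prop
  | .before none, m, u => m = 0 ∧ IsContext u (stack u)
  | .before (some b), m, u => m = 0 ∧ ∃ u₀ a l, IsContext u₀ (stack u₀) ∧ (a = .all ∨ a = .ex) ∧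
      u = u₀ ++ a :: .var :: l.map .digit ∧ b = lastDigit true l
  | .quantifier, m, u => m = 0 ∧ ∃ u₀ a, IsContext u₀ (stack u₀) ∧ (a = .all ∨ a = .ex) ∧
      u = u₀ ++ [a]
  | .after none, m, u => ∃ u₀, IsContext u₀ (stack u₀) ∧
      ((∃ R, u = u₀ ++ [.rel R] ∧ m = R.1) ∨ ∃ φ : PosFormula σ, u = u₀ ++ φ.encode ∧ m = 0)
  | .after (some b), m, u => ∃ (u₀ : List (Token σ)) (R : Σ n, σ.Relations n) (xs : List ℕ) (l : List Bool),
      IsContext u₀ (stack u₀) ∧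
      u = u₀ ++ .rel R :: (xs.flatMap encodeVar ++ .var :: l.map .digit) ∧
      xs.length + 1 + m = R.1 ∧ b = lastDigit true l
  | .fail, _, _ => True

/-- The digits read so far end properly, so they name a variable and the pending quantifier is
complete. -/
theorem ParseInv.isContext {o : Option Bool} {m : ℕ} {u : List (Token σ)}
    (h : ParseInv (.before o) m u) (ho : o ≠ some false) : m = 0 ∧ IsContext u (stack u) := by
  rcases o with _ | b
  · exact h
  · obtain ⟨hm, u₀, a, l, hu₀, ha, rfl, rfl⟩ := h
    obtain ⟨i, hi⟩ := exists_bits_eq (l := l) (by simpa using ho)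
    have e : (.var :: l.map .digit : List (Token σ)) = encodeVar i := by rw [encodeVar, hi]
    have hb : Balanced (a :: .var :: l.map .digit) := by
      refine .append (l := [a]) (.single a ?_ ?_ ?_ ?_) (e ▸ balanced_encodeVar i) <;>
        rcases ha with rfl | rfl <;> simp
    refine ⟨hm, ?_⟩
    rw [stack_append_balanced hb, e]
    exact .quantifier a i ha hu₀

theorem exists_rel_encode {R : Σ n, σ.Relations n} {l : List ℕ} (h : l.length = R.1) :
    ∃ φ : PosFormula σ, φ.encode = .rel R :: l.flatMap encodeVar := by
  obtain ⟨n, R⟩ := R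
  dsimp only at h
  subst h
  exact ⟨.rel R l.get, by simp [encode]⟩

/-- No argument is missing and the last name ends properly, so the text behind the context is an
atom or a formula completed before. -/
theorem ParseInv.exists_formula {o : Option Bool} {u : List (Token σ)}
    (h : ParseInv (.after o) 0 u) (ho : o ≠ some false) :
    ∃ u₀ φ, IsContext u₀ (stack u₀) ∧ u = u₀ ++ encode φ := by
  rcases o with _ | b
  · obtain ⟨u₀, hu₀, ⟨R, rfl, hm⟩ | ⟨φ, rfl, -⟩⟩ := h
    · obtain ⟨φ, hφ⟩ := exists_rel_encode (R := R) (l := []) hm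
      exact ⟨u₀, φ, hu₀, by rw [hφ]; rfl⟩
    · exact ⟨u₀, φ, hu₀, rfl⟩
  · obtain ⟨u₀, R, xs, l, hu₀, rfl, hR, rfl⟩ := h
    obtain ⟨i, hi⟩ := exists_bits_eq (l := l) (by simpa using ho)
    obtain ⟨φ, hφ⟩ := exists_rel_encode (R := R) (l := xs ++ [i]) (by simpa using hR)
    refine ⟨u₀, φ, hu₀, ?_⟩
    rw [hφ]
    simp [encodeVar, hi]

theorem lastDigit_snoc (b c : Bool) (l : List Bool) : lastDigit b (l ++ [c]) = c := by
  simp [lastDigit]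

/-- At a connective or a closing parenthesis the formula just read is merged with its context, by
`exists_left` or `exists_right`; the information on the innermost open pair says which of them
applies. -/
theorem ParseInv.step {q : ParseState} {m : ℕ} {u : List (Token σ)} (h : ParseInv q m u)
    (a : Token σ) :
    ParseInv (parseStep (some a) (stack u)[0]? q m).1 (parseStep (some a) (stack u)[0]? q m).2
      (u ++ [a]) := by
  have hquant : ∀ o, ParseInv (.before o) m u → (a = .all ∨ a = .ex) →
      ParseInv (if o = some false then (ParseState.fail, m) else (.quantifier, m)).1
        (if o = some false then (ParseState.fail, m) else (.quantifier, m)).2 (u ++ [a]) := by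
    intro o h ha
    split
    · trivial
    · obtain ⟨hm, hu⟩ := h.isContext ‹_›
      exact ⟨hm, u, a, hu, ha, rfl⟩
  have hop : ∀ o, ParseInv (.after o) 0 u → (a = .and ∨ a = .or) → ∀ b, b = (stack u)[0]? →
      ParseInv (if o ≠ some false ∧ b = some false then (ParseState.before none, 0)
        else (.fail, 0)).1 (if o ≠ some false ∧ b = some false then (ParseState.before none, 0)
        else (.fail, 0)).2 (u ++ [a]) := by
    intro o h ha b hb
    split
    · rename_i hc
      obtain ⟨u₀, φ, hu₀, rfl⟩ := h.exists_formula hc.1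
      rw [stack_append_balanced (balanced_encode φ)] at hb
      cases hs : stack u₀ with
      | nil => rw [hc.2, hs] at hb; simp at hb
      | cons c s =>
        obtain rfl : c = false := by rw [hc.2, hs] at hb; simpa using hb.symm
        rw [hs] at hu₀
        obtain ⟨u₁, hu₁, H⟩ := hu₀.exists_left
        obtain ⟨ψ, hψ⟩ := H φ
        refine ⟨rfl, ?_⟩
        have e : stack (u₀ ++ φ.encode ++ [a]) = true :: s := by
          rw [stack_snoc, stack_append_balanced (balanced_encode φ), hs]
          rcases ha with rfl | rfl <;> rfl
        rw [e, hψ]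
        simpa using IsContext.right ψ a ha hu₁
    · trivial
  cases q with
  | fail => cases a <;> trivial
  | quantifier =>
    obtain ⟨hm, u₀, c, hu₀, hc, rfl⟩ := h
    cases a <;> first | trivial | skip
    exact ⟨hm, u₀, c, [], hu₀, hc, by simp, rfl⟩
  | before o =>
    cases a with
    | rel R =>
      simp only [parseStep]
      split
      · trivial
      · obtain ⟨hm, hu⟩ := h.isContext ‹_›
        exact ⟨u, hu, .inl ⟨R, rfl, by omega⟩⟩
    | lparen =>
      simp only [parseStep]
      split
      · trivial
      · obtain ⟨hm, hu⟩ := h.isContext ‹_›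
        refine ⟨hm, ?_⟩
        rw [stack_snoc]
        exact .left hu
    | all => exact hquant o h (.inl rfl)
    | ex => exact hquant o h (.inr rfl)
    | digit c =>
      rcases o with _ | b
      · trivial
      · obtain ⟨hm, u₀, a, l, hu₀, ha, rfl, rfl⟩ := h
        exact ⟨hm, u₀, a, l ++ [c], hu₀, ha, by simp, (lastDigit_snoc _ _ _).symm⟩
    | _ => trivial
  | after o =>
    cases a with
    | digit c =>
      rcases o with _ | b
      · trivial
      · obtain ⟨u₀, R, xs, l, hu₀, rfl, hR, rfl⟩ := h
        exact ⟨u₀, R, xs, l ++ [c], hu₀, by simp, hR, (lastDigit_snoc _ _ _).symm⟩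
    | var =>
      rcases m with _ | m
      · trivial
      · simp only [parseStep]
        split
        · trivial
        · rcases o with _ | b
          · obtain ⟨u₀, hu₀, ⟨R, rfl, hm⟩ | ⟨φ, rfl, hm⟩⟩ := h
            · exact ⟨u₀, R, [], [], hu₀, by simp, by simp; omega, rfl⟩
            · omega
          · obtain ⟨u₀, R, xs, l, hu₀, rfl, hR, rfl⟩ := h
            obtain ⟨i, hi⟩ := exists_bits_eq (l := l) (by simp_all)
            exact ⟨u₀, R, xs ++ [i], [], hu₀, by simp [encodeVar, hi], by simp; omega, rfl⟩
    | and =>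
      rcases m with _ | m
      · exact hop o h (.inl rfl) _ rfl
      · trivial
    | or =>
      rcases m with _ | m
      · exact hop o h (.inr rfl) _ rfl
      · trivial
    | rparen =>
      rcases m with _ | m
      · simp only [parseStep]
        split
        · rename_i hc
          obtain ⟨u₀, φ, hu₀, rfl⟩ := h.exists_formula hc.1
          rw [stack_append_balanced (balanced_encode φ)] at hc
          cases hs : stack u₀ with
          | nil => rw [hs] at hc; simp at hc
          | cons c s =>
            obtain rfl : c = true := by rw [hs] at hc; simpa using hc.2
            have hu₀' := hu₀
            rw [hs] at hu₀
            obtain ⟨u₁, hu₁, H⟩ := hu₀.exists_right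
            obtain ⟨ψ, hψ⟩ := H φ
            -- Both sides of `hψ` end in balanced words or a closing parenthesis, so comparing their
            -- stacks determines that of `u₁`.
            have e : stack u₁ = s := by
              have h1 := congrArg stack hψ
              rw [stack_snoc, stack_append_balanced (balanced_encode φ), hs,
                stack_append_balanced (balanced_encode ψ)] at h1
              exact h1.symm
            exact ⟨u₁, e ▸ hu₁, .inr ⟨ψ, hψ, rfl⟩⟩
        · trivial
      · trivial
    | _ => trivial

theorem parse_inv (u v : List (Token σ)) :
    ParseInv (parse (fun j => (u ++ v)[j]?) u.length).1 (parse (fun j => (u ++ v)[j]?) u.length).2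
      u := by
  induction u using List.reverseRecOn generalizing v with
  | nil => exact ⟨rfl, .nil⟩
  | append_singleton u a ih =>
    have h := (ih (a :: v)).step a
    rw [← parse_snoc] at h
    simpa using h

/-- The loops of `check` run over the whole input, which is longer than the formula if a certificate
follows it. -/
theorem parse_add (x : List (Token σ)) (k : ℕ) :
    parse (fun j => x[j]?) (x.length + k) = parse (fun j => x[j]?) x.length := by
  induction k with
  | zero => rfl
  | succ k ih =>
    rw [← ih, ← add_assoc]
    have : x[x.length + k]? = none := List.getElem?_eq_none (by omega)
    conv_lhs => rw [parse, forwardLoop]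
    simp only [this]
    rfl

theorem top_add (x : List (Token σ)) (k : ℕ) :
    top (fun j => x[j]?) (x.length + k) = top (fun j => x[j]?) x.length := by
  induction k with
  | zero => rfl
  | succ k ih =>
    rw [← ih, ← add_assoc]
    have : x[x.length + k]? = none := List.getElem?_eq_none (by omega)
    conv_lhs => rw [top, backwardLoop]
    simp only [this]
    rfl

theorem wellFormed_iff (x : List (Token σ)) {n : ℕ} (hn : x.length ≤ n) :
    wellFormed (fun j => x[j]?) n = true ↔ ∃ φ : PosFormula σ, φ.encode = x := by
  obtain ⟨k, rfl⟩ := Nat.exists_eq_add_of_le hn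
  have htop := top_append x []
  have hinv := parse_inv x []
  simp only [List.append_nil] at htop hinv
  simp only [wellFormed, parse_add, top_add, htop, Bool.and_eq_true, decide_eq_true_eq]
  constructor
  · rintro ⟨⟨hf, hm⟩, hs⟩
    rw [hm] at hinv
    cases hq : (parse (fun j => x[j]?) x.length).1 with
    | after o =>
      rw [hq] at hinv hf
      obtain ⟨u₀, φ, hu₀, rfl⟩ := hinv.exists_formula (by rintro rfl; simp [isFinal] at hf)
      rw [stack_append_balanced (balanced_encode φ)] at hs
      have : stack u₀ = [] := by simpa using hs
      rw [this] at hu₀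
      obtain ⟨ψ, hψ⟩ := hu₀.exists_nil φ
      exact ⟨ψ, hψ.symm⟩
    | _ => rw [hq] at hf; simp [isFinal] at hf
  · rintro ⟨φ, rfl⟩
    obtain ⟨o, ho, h⟩ := parse_encode φ [] [] none (by simp) rfl
    simp only [List.nil_append, List.append_nil, List.length_nil, zero_add] at h
    rw [h]
    have := stack_append_balanced (balanced_encode φ) []
    simp only [List.nil_append] at this
    rw [this]
    refine ⟨⟨?_, rfl⟩, rfl⟩
    rcases o with _ | _ | _ <;> simp_all [isFinal]

end PosFormula


/-! ### Correctness of the evaluation -/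

namespace PosFormula

variable {σ : FirstOrder.Language.{u, v}}

/-- The word `l` is written from position `p` onwards. -/
def Occurs (t : ℕ → Option (Token σ)) : ℕ → List (Token σ) → Prop
  | _, [] => True
  | p, a :: l => t p = some a ∧ Occurs t (p + 1) l

theorem occurs_append {t : ℕ → Option (Token σ)} {p : ℕ} {l m : List (Token σ)} :
    Occurs t p (l ++ m) ↔ Occurs t p l ∧ Occurs t (p + l.length) m := by
  induction l generalizing p with
  | nil => simp [Occurs]
  | cons a l ih => simp [Occurs, ih, and_assoc, add_assoc, add_comm 1]

theorem occurs_getElem? (u v : List (Token σ)) :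
    Occurs (fun j => (u ++ v)[j]?) u.length v := by
  induction v generalizing u with
  | nil => trivial
  | cons a v ih =>
    refine ⟨by simp, ?_⟩
    have := ih (u ++ [a])
    rwa [List.length_append, List.append_assoc] at this

theorem Occurs.getElem? {t : ℕ → Option (Token σ)} {p : ℕ} {l : List (Token σ)} (h : Occurs t p l)
    {k : ℕ} (hk : k < l.length) : t (p + k) = l[k]? := by
  induction l generalizing p k with
  | nil => simp at hk
  | cons a l ih =>
    cases k with
    | zero => exact h.1
    | succ k => simpa [add_assoc, add_comm 1] using ih h.2 (by simpa using hk)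

theorem Occurs.digit?_eq_none {t : ℕ → Option (Token σ)} {p : ℕ} {φ : PosFormula σ}
    (h : Occurs t p φ.encode) : digit? (t p) = none := by
  cases φ <;> rw [h.1] <;> rfl

/-! #### Names of variables -/

/-- The variable with index `i` is written from position `p` onwards. -/
def VarAt (t : ℕ → Option (Token σ)) (p i : ℕ) : Prop :=
  -- The case of equality says that no further digit follows.
  t p = some .var ∧ ∀ k ≤ (Nat.bits i).length, digit? (t (p + 1 + k)) = (Nat.bits i)[k]?

theorem Occurs.varAt {t : ℕ → Option (Token σ)} {p i : ℕ} (h : Occurs t p (encodeVar i))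
    (hend : digit? (t (p + (encodeVar (σ := σ) i).length)) = none) : VarAt t p i := by
  refine ⟨h.1, fun k hk => ?_⟩
  rcases hk.lt_or_eq with hk | rfl
  · rw [h.2.getElem? (by simpa using hk)]
    simp [hk, digit?]
  · simpa [encodeVar, add_assoc, add_comm 1] using hend

/-- It ensures that the `n` rounds of the comparison in `sameVar` reach the end of the name. -/
theorem VarAt.length_lt {t : ℕ → Option (Token σ)} {n p i : ℕ} (ht : ∀ j, n ≤ j → t j = none)
    (h : VarAt t p i) : (Nat.bits i).length < n := by
  by_contra! hn
  rcases Nat.eq_zero_or_pos (Nat.bits i).length with h0 | h0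
  · have := h.1
    rw [ht p (by omega)] at this
    simp at this
  · have := h.2 ((Nat.bits i).length - 1) (by omega)
    rw [ht _ (by omega), List.getElem?_eq_getElem (by omega)] at this
    simp [digit?] at this

/-- While the comparison is undecided, the names agree and neither has ended; it succeeds only where
both end together. -/
theorem forwardLoop_compareStep_eq {a b : ℕ → Option Bool} (m : ℕ) :
    (forwardLoop (fun i => compareStep (a i) (b i)) none m = none →
      ∀ j < m, a j = b j ∧ a j ≠ none) ∧
    (forwardLoop (fun i => compareStep (a i) (b i)) none m = some true →
      ∃ k, a k = none ∧ b k = none ∧ ∀ j < k, a j = b j ∧ a j ≠ none) := by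
  induction m with
  | zero => simp [forwardLoop]
  | succ m ih =>
    simp only [forwardLoop]
    cases hs : forwardLoop (fun i => compareStep (a i) (b i)) none m with
    | some r => exact ⟨by simp [compareStep], fun h => ih.2 (hs.trans h)⟩
    | none =>
      have ih := ih.1 hs
      simp only [compareStep]
      split_ifs with h1 h2
      · exact ⟨by simp, fun _ => ⟨m, h2, h1 ▸ h2, ih⟩⟩
      · refine ⟨fun _ j hj => ?_, by simp⟩
        rcases Nat.lt_succ_iff_lt_or_eq.1 hj with hj | rfl
        · exact ih j hj
        · exact ⟨h1, h2⟩
      · simp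

theorem forwardLoop_compareStep_self {a b : ℕ → Option Bool} {k : ℕ} (ha : a k = none)
    (hb : b k = none) (h : ∀ j < k, a j = b j ∧ a j ≠ none) (m : ℕ) :
    forwardLoop (fun i => compareStep (a i) (b i)) none m = if k < m then some true else none := by
  induction m with
  | zero => simp [forwardLoop]
  | succ m ih =>
    rw [forwardLoop, ih]
    rcases lt_trichotomy k m with hk | rfl | hk
    · simp [hk, hk.trans, compareStep]
    · simp [compareStep, ha, hb]
    · simp [hk.not_gt, Nat.not_lt.2 (Nat.succ_le_of_lt hk), compareStep, (h m hk).1 ▸ (h m hk).2,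
        (h m hk).1]

theorem sameVar_iff {t : ℕ → Option (Token σ)} {n p q i j : ℕ} (ht : ∀ j, n ≤ j → t j = none)
    (hp : VarAt t p i) (hq : VarAt t q j) : sameVar t n p q = true ↔ i = j := by
  rw [sameVar, decide_eq_true_eq]
  constructor
  · intro h
    obtain ⟨k, h1, h2, h3⟩ := (forwardLoop_compareStep_eq n).2 h
    have key : ∀ {p i : ℕ}, VarAt t p i → digit? (t (p + 1 + k)) = none →
        (∀ j < k, digit? (t (p + 1 + j)) ≠ none) → k = (Nat.bits i).length := by
      intro p i hp h1 h3
      rcases lt_trichotomy k (Nat.bits i).length with hk | hk | hk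
      · rw [hp.2 k hk.le, List.getElem?_eq_getElem hk] at h1
        simp at h1
      · exact hk
      · exact absurd ((hp.2 _ le_rfl).trans (by simp)) (h3 _ hk)
    have hi := key hp h1 fun j hj => (h3 j hj).2
    have hj := key hq h2 fun j hj => (h3 j hj).1 ▸ (h3 j hj).2
    have : Nat.bits i = Nat.bits j := by
      refine List.ext_getElem? fun l => ?_
      rcases lt_or_ge l k with hl | hl
      · rw [← hp.2 l (by omega), ← hq.2 l (by omega), (h3 l hl).1]
      · rw [List.getElem?_eq_none (by omega), List.getElem?_eq_none (by omega)]
    exact Nat.eq_of_testBit_eq fun l => by rw [Nat.testBit_eq_inth, Nat.testBit_eq_inth, this]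
  · rintro rfl
    have := forwardLoop_compareStep_self (a := fun k => digit? (t (p + 1 + k)))
      (b := fun k => digit? (t (q + 1 + k))) (k := (Nat.bits i).length)
      ((hp.2 _ le_rfl).trans (by simp)) ((hq.2 _ le_rfl).trans (by simp))
      (fun j hj => ⟨(hp.2 j hj.le).trans (hq.2 j hj.le).symm, by
        rw [hp.2 j hj.le, List.getElem?_eq_getElem hj]; simp⟩) n
    rw [this, if_pos (hp.length_lt ht)]

/-! #### Scopes of quantifiers -/

/-- The result of the search, below position `q`, for the quantifier of the variable at `p`. -/
def scope (t : ℕ → Option (Token σ)) (n p q : ℕ) : Bool × ℕ :=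
  backwardLoop (binderStep t n p) q (false, 0)

theorem scope_zero (t : ℕ → Option (Token σ)) (n p : ℕ) : scope t n p 0 = (false, 0) := rfl

theorem backwardLoop_binderStep_true (t : ℕ → Option (Token σ)) (n p q j : ℕ) :
    backwardLoop (binderStep t n p) q (true, j) = (true, j) := by
  induction q with
  | zero => rfl
  | succ q ih =>
    have : binderStep t n p q (true, j) = (true, j) := by
      cases h : t q with
      | none => simp [binderStep, h, scopeStep]
      | some a => cases a <;> simp [binderStep, h, scopeStep]
    rw [backwardLoop, this, ih]

/-- With a positive counter no quantifier is accepted, and the parentheses of a balanced word leave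
the counter as it was. -/
theorem backwardLoop_binderStep_balanced {t : ℕ → Option (Token σ)} {l : List (Token σ)}
    (hl : Balanced l) (n p : ℕ) {q : ℕ} (h : Occurs t q l) (d : ℕ) :
    backwardLoop (binderStep t n p) (q + l.length) (false, d + 1) =
      backwardLoop (binderStep t n p) q (false, d + 1) := by
  induction hl generalizing q d with
  | nil => rfl
  | single a h₁ h₂ h₃ h₄ =>
    have : binderStep t n p q (false, d + 1) = (false, d + 1) := by
      cases a <;> simp_all [binderStep, scopeStep, h.1]
    simp [backwardLoop, this]
  | append _ _ ih₁ ih₂ =>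
    rw [occurs_append] at h
    rw [List.length_append, ← add_assoc, ih₂ h.2, ih₁ h.1]
  | @paren l m a ha _ _ ih₁ ih₂ =>
    obtain ⟨h0, h⟩ := h
    rw [occurs_append] at h
    obtain ⟨h1, h2, h⟩ := h
    rw [occurs_append] at h
    obtain ⟨h3, h4, -⟩ := h
    have e : q + (Token.lparen :: (l ++ a :: (m ++ [.rparen]))).length =
        q + 1 + l.length + 1 + m.length + 1 := by simp; ring
    have s1 : binderStep t n p (q + 1 + l.length + 1 + m.length) (false, d + 1) =
        (false, d + 1 + 1) := by
      simp [binderStep, scopeStep, h4]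
    have s2 : binderStep t n p (q + 1 + l.length) (false, d + 1 + 1) = (false, d + 1 + 1) := by
      rcases ha with rfl | rfl <;> simp [binderStep, scopeStep, h2]
    have s3 : binderStep t n p q (false, d + 1 + 1) = (false, d + 1) := by
      simp [binderStep, scopeStep, h0]
    rw [e, backwardLoop, s1, ih₂ h3, backwardLoop, s2, ih₁ h1, backwardLoop, s3]

theorem scope_lparen {t : ℕ → Option (Token σ)} {q : ℕ} (h : t q = some .lparen) (n p : ℕ) :
    scope t n p (q + 1) = scope t n p q := by
  have : binderStep t n p q (false, 0) = (false, 0) := by simp [binderStep, scopeStep, h, isQuantifier]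
  rw [scope, backwardLoop, this, scope]

theorem scope_rel {t : ℕ → Option (Token σ)} {q : ℕ} {R} (h : t q = some (.rel R)) (n p : ℕ) :
    scope t n p (q + 1) = scope t n p q := by
  have : binderStep t n p q (false, 0) = (false, 0) := by simp [binderStep, scopeStep, h, isQuantifier]
  rw [scope, backwardLoop, this, scope]

theorem scope_varTokens {t : ℕ → Option (Token σ)} {q : ℕ} {l : List (Token σ)} (h : Occurs t q l)
    (hl : ∀ a ∈ l, IsVarToken a) (n p : ℕ) : scope t n p (q + l.length) = scope t n p q := by
  induction l generalizing q with
  | nil => rfl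
  | cons a l ih =>
    have hs : binderStep t n p q (false, 0) = (false, 0) := by
      rcases hl a (by simp) with rfl | ⟨b, rfl⟩ <;>
        simp [binderStep, scopeStep, h.1, isQuantifier]
    have := ih h.2 fun b hb => hl b (by simp [hb])
    rw [List.length_cons, add_comm l.length, ← add_assoc, this, scope, backwardLoop, hs, scope]

/-- The connective raises the counter to `1`, the first operand is passed without a match, and the
opening parenthesis brings the counter back to `0`. -/
theorem scope_connective {t : ℕ → Option (Token σ)} {q : ℕ} {l : List (Token σ)} {a : Token σ}
    (h : t q = some .lparen) (hl : Balanced l) (h' : Occurs t (q + 1) l)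
    (ha : t (q + 1 + l.length) = some a) (hop : a = .and ∨ a = .or) (n p : ℕ) :
    scope t n p (q + 1 + l.length + 1) = scope t n p q := by
  have s1 : binderStep t n p (q + 1 + l.length) (false, 0) = (false, 1) := by
    rcases hop with rfl | rfl <;> simp [binderStep, scopeStep, ha, isQuantifier]
  have s2 : binderStep t n p q (false, 1) = (false, 0) := by simp [binderStep, scopeStep, h]
  rw [scope, backwardLoop, s1, backwardLoop_binderStep_balanced hl n p h' 0, backwardLoop, s2, scope]

theorem scope_quantifier {t : ℕ → Option (Token σ)} {n : ℕ} (ht : ∀ j, n ≤ j → t j = none)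
    {q i p i' : ℕ} {a : Token σ} (ha : a = .all ∨ a = .ex) (h : t q = some a)
    (ho : Occurs t (q + 1) (encodeVar i)) (hq : VarAt t (q + 1) i) (hp : VarAt t p i') :
    scope t n p (q + 1 + (encodeVar (σ := σ) i).length) =
      if i' = i then (true, q) else scope t n p q := by
  rw [scope_varTokens ho fun _ => isVarToken_of_mem_encodeVar, scope, backwardLoop]
  have hs := sameVar_iff ht hp hq
  have hquant : isQuantifier (t q) = true := by rw [h]; rcases ha with rfl | rfl <;> rfl
  split_ifs with hi
  · have : binderStep t n p q (false, 0) = (true, q) := by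
      simp [binderStep, hquant, hs.2 hi]
    rw [this, backwardLoop_binderStep_true]
  · have hs : sameVar t n p (q + 1) = false := by simpa using mt hs.1 hi
    have : binderStep t n p q (false, 0) = (false, 0) := by
      rcases ha with rfl | rfl <;> simp [binderStep, scopeStep, hs, h]
    rw [this, scope]

/-! #### Sentences -/

/-- Are the variables below position `m` bound? -/
def closedBelow (t : ℕ → Option (Token σ)) (n m : ℕ) : Bool :=
  forwardLoop (fun p s => s && !(isVar (t p) && !(binder t n p).1)) true m

theorem closedBelow_succ {t : ℕ → Option (Token σ)} {m : ℕ} {a : Option (Token σ)} (ha : t m = a)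
    (h : isVar a = false) (n : ℕ) :
    closedBelow t n (m + 1) = closedBelow t n m := by
  simp [closedBelow, forwardLoop, ha, h]

theorem closedBelow_digits {t : ℕ → Option (Token σ)} {m : ℕ} {l : List Bool}
    (h : Occurs t m (l.map .digit)) (n : ℕ) :
    closedBelow t n (m + l.length) = closedBelow t n m := by
  induction l generalizing m with
  | nil => rfl
  | cons b l ih =>
    have := ih h.2
    rw [List.length_cons, add_comm l.length, ← add_assoc, this, closedBelow_succ h.1 rfl]

theorem closedBelow_encodeVar {t : ℕ → Option (Token σ)} {m i : ℕ} (h : Occurs t m (encodeVar i))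
    (n : ℕ) : closedBelow t n (m + (encodeVar (σ := σ) i).length) =
      (closedBelow t n m && (scope t n m m).1) := by
  have := closedBelow_digits h.2 n
  rw [show m + (encodeVar (σ := σ) i).length = m + 1 + (Nat.bits i).length by
    simp [encodeVar]; ring, this]
  simp [closedBelow, forwardLoop, h.1, isVar, scope, binder]

/-- All variables between `q` and `q'` are bound if and only if those with index in `F` are bound
from position `q`. -/
def BoundBetween (t : ℕ → Option (Token σ)) (n q q' : ℕ) (F : Set ℕ) : Prop :=
  (closedBelow t n q' = true →
    closedBelow t n q = true ∧ ∀ i ∈ F, ∃ p, VarAt t p i ∧ (scope t n p q).1 = true) ∧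
  (closedBelow t n q = true → (∀ i ∈ F, ∀ p, VarAt t p i → (scope t n p q).1 = true) →
    closedBelow t n q' = true)

theorem closedBelow_varTokens {t : ℕ → Option (Token σ)} {m : ℕ} {xs : List ℕ}
    (h : Occurs t m (xs.flatMap encodeVar)) (n : ℕ)
    (hend : digit? (t (m + (xs.flatMap (encodeVar (σ := σ))).length)) = none) :
    BoundBetween t n m (m + (xs.flatMap (encodeVar (σ := σ))).length) {i | i ∈ xs} := by
  unfold BoundBetween
  simp only [Set.mem_ofPred_eq]
  induction xs generalizing m with
  | nil => simp
  | cons i xs ih =>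
    rw [List.flatMap_cons, occurs_append] at h
    rw [List.flatMap_cons, List.length_append, ← add_assoc] at hend ⊢
    have hi : digit? (t (m + (encodeVar (σ := σ) i).length)) = none := by
      cases xs with
      | nil => exact hend
      | cons j xs => rw [h.2.1]; rfl
    obtain ⟨ih₁, ih₂⟩ := ih h.2 hend
    have hv := h.1.varAt hi
    have hs := scope_varTokens h.1 (fun _ => isVarToken_of_mem_encodeVar) n
    simp only [hs, closedBelow_encodeVar h.1, Bool.and_eq_true] at ih₁ ih₂
    constructor
    · intro hc
      obtain ⟨⟨h1, h2⟩, h3⟩ := ih₁ hc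
      refine ⟨h1, fun j hj => ?_⟩
      rcases List.mem_cons.1 hj with rfl | hj
      · exact ⟨m, hv, h2⟩
      · exact h3 j hj
    · exact fun h1 h2 => ih₂ ⟨h1, h2 i (by simp) m hv⟩ fun j hj => h2 j (by simp [hj])

/-- Induction on the formula. The lemmas on `scope` reduce a search that begins at a subformula to
one that begins at the whole formula, except that a quantifier catches its own index. -/
theorem closedBelow_encode {t : ℕ → Option (Token σ)} {n : ℕ} (ht : ∀ j, n ≤ j → t j = none)
    (φ : PosFormula σ) {q : ℕ} (h : Occurs t q φ.encode)
    (hend : digit? (t (q + φ.encode.length)) = none) :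
    BoundBetween t n q (q + φ.encode.length) φ.free := by
  have binary : ∀ (φ ψ : PosFormula σ) (a : Token σ) (ha : a = .and ∨ a = .or) (q : ℕ)
      (hφ : ∀ {q : ℕ}, Occurs t q φ.encode → digit? (t (q + φ.encode.length)) = none →
        BoundBetween t n q (q + φ.encode.length) φ.free)
      (hψ : ∀ {q : ℕ}, Occurs t q ψ.encode → digit? (t (q + ψ.encode.length)) = none →
        BoundBetween t n q (q + ψ.encode.length) ψ.free)
      (l : List (Token σ)) (hl : l = .lparen :: (φ.encode ++ a :: (ψ.encode ++ [.rparen])))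
      (h : Occurs t q l),
      BoundBetween t n q (q + l.length) (φ.free ∪ ψ.free) := by
    intro φ ψ a ha q hφ hψ l hl h
    subst hl
    obtain ⟨h0, h⟩ := h
    rw [occurs_append] at h
    obtain ⟨h1, h2, h⟩ := h
    rw [occurs_append] at h
    obtain ⟨h3, h4, -⟩ := h
    rw [show q + (Token.lparen :: (φ.encode ++ a :: (ψ.encode ++ [.rparen]))).length =
        q + 1 + φ.encode.length + 1 + ψ.encode.length + 1 by simp; ring]
    have c1 := closedBelow_succ h0 rfl n
    have c2 := closedBelow_succ h2 (by rcases ha with rfl | rfl <;> rfl) n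
    have c3 := closedBelow_succ h4 rfl n
    obtain ⟨a1, a2⟩ := hφ h1 (by rw [h2]; rcases ha with rfl | rfl <;> rfl)
    obtain ⟨b1, b2⟩ := hψ h3 (by rw [h4]; rfl)
    simp only [scope_lparen h0, scope_connective h0 (balanced_encode φ) h1 h2 ha, c1, c2]
      at a1 a2 b1 b2
    rw [BoundBetween, c3]
    constructor
    · intro hc
      obtain ⟨k1, k2⟩ := b1 hc
      obtain ⟨k3, k4⟩ := a1 k1
      exact ⟨k3, fun i hi => hi.elim (k4 i) (k2 i)⟩
    · intro k1 k2
      exact b2 (a2 k1 fun i hi => k2 i (.inl hi)) fun i hi => k2 i (.inr hi)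
  have quantified : ∀ (φ : PosFormula σ) (j : ℕ) (a : Token σ) (ha : a = .all ∨ a = .ex) (q : ℕ)
      (hφ : ∀ {q : ℕ}, Occurs t q φ.encode → digit? (t (q + φ.encode.length)) = none →
        BoundBetween t n q (q + φ.encode.length) φ.free)
      (l : List (Token σ)) (hl : l = a :: (encodeVar j ++ φ.encode))
      (h : Occurs t q l) (hend : digit? (t (q + l.length)) = none),
      BoundBetween t n q (q + l.length) (φ.free \ {j}) := by
    intro φ j a ha q hφ l hl h hend
    subst hl
    obtain ⟨h0, h⟩ := h
    rw [occurs_append] at h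
    obtain ⟨h1, h2⟩ := h
    rw [show q + (a :: (encodeVar j ++ φ.encode)).length =
        q + 1 + (encodeVar (σ := σ) j).length + φ.encode.length by simp; ring] at hend ⊢
    have c1 := closedBelow_succ h0 (by rcases ha with rfl | rfl <;> rfl) n
    have hv := h1.varAt h2.digit?_eq_none
    obtain ⟨a1, a2⟩ := hφ h2 hend
    -- The variable written behind a quantifier is bound by that quantifier, so it imposes no
    -- condition.
    have c2 : (scope t n (q + 1) (q + 1)).1 = true := by
      have := scope_quantifier ht ha h0 h1 hv hv
      rw [scope_varTokens h1 fun _ => isVarToken_of_mem_encodeVar, if_pos rfl] at this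
      rw [this]
    rw [closedBelow_encodeVar h1, c1, c2, Bool.and_true] at a1 a2
    constructor
    · intro hc
      obtain ⟨k1, k2⟩ := a1 hc
      refine ⟨k1, fun i hi => ?_⟩
      obtain ⟨p, hp, k3⟩ := k2 i hi.1
      rw [scope_quantifier ht ha h0 h1 hv hp, if_neg (show i ≠ j from hi.2)] at k3
      exact ⟨p, hp, k3⟩
    · intro k1 k2
      refine a2 k1 fun i hi p hp => ?_
      rw [scope_quantifier ht ha h0 h1 hv hp]
      split_ifs with hij
      · rfl
      · exact k2 i ⟨hi, hij⟩ p hp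
  induction φ generalizing q with
  | @rel k R x =>
    have c1 := closedBelow_succ h.1 rfl n
    have e : q + (rel R x).encode.length =
        q + 1 + ((List.ofFn x).flatMap (encodeVar (σ := σ))).length := by
      simp [encode]; ring
    rw [e] at hend ⊢
    have := closedBelow_varTokens h.2 n hend
    simpa only [BoundBetween, c1, scope_rel h.1, List.mem_ofFn, free, Set.mem_range, Set.mem_ofPred_eq] using this
  | and φ ψ hφ hψ => exact binary φ ψ .and (.inl rfl) q hφ hψ _ rfl h
  | or φ ψ hφ hψ => exact binary φ ψ .or (.inr rfl) q hφ hψ _ rfl h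
  | all i φ hφ => exact quantified φ i .all (.inl rfl) q hφ _ rfl h hend
  | ex i φ hφ => exact quantified φ i .ex (.inr rfl) q hφ _ rfl h hend

/-- A search from position `0` finds nothing, so all variables are bound exactly if no index is
free. -/
theorem closed_iff {t : ℕ → Option (Token σ)} {n : ℕ} {φ : PosFormula σ}
    (h : Occurs t 0 φ.encode) (ht : ∀ j, φ.encode.length ≤ j → t j = none)
    (hn : φ.encode.length ≤ n) : closed t n = true ↔ φ.IsSentence := by
  have key := closedBelow_encode (fun j hj => ht j (hn.trans hj)) φ h (by
    rw [zero_add, ht _ le_rfl]; rfl)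
  have hc : closed t n = closedBelow t n (0 + φ.encode.length) := by
    obtain ⟨k, rfl⟩ := Nat.exists_eq_add_of_le hn
    clear key hn
    suffices ∀ n, closedBelow t n (φ.encode.length + k) = closedBelow t n (0 + φ.encode.length) from
      this _
    intro n
    induction k with
    | zero => rw [add_zero, zero_add]
    | succ k ih => rw [← ih, ← add_assoc, closedBelow_succ (ht _ (by omega)) rfl]
  simp only [BoundBetween, scope_zero] at key
  rw [hc, IsSentence, Set.eq_empty_iff_forall_notMem]
  constructor
  · intro hc i hi
    obtain ⟨p, -, hp⟩ := (key.1 hc).2 i hi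
    simp at hp
  · exact fun hφ => key.2 rfl fun i hi => (hφ i hi).elim

end PosFormula


namespace PosFormula

variable {σ : FirstOrder.Language.{u, v}} {B : Type w}

/-! #### Truth values -/

/-- For the variables with index in `F`, the search from position `q` yields the values in `s`. -/
def Agrees (t : ℕ → Option (Token σ)) (n : ℕ) (val : ℕ → B) (q : ℕ) (F : Set ℕ) (s : ℕ → B) :
    Prop :=
  ∀ p i, VarAt t p i → i ∈ F → val (scope t n p q).2 = s i

theorem Agrees.of_scope {t : ℕ → Option (Token σ)} {n : ℕ} {val : ℕ → B} {q q' : ℕ} {F F' : Set ℕ}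
    {s : ℕ → B} (h : Agrees t n val q F s) (hF : F' ⊆ F)
    (hq : ∀ p, scope t n p q' = scope t n p q) : Agrees t n val q' F' s :=
  fun p i hp hi => by rw [hq, h p i hp (hF hi)]

variable [σ.Structure B]

/-- The truth of the formula written at position `o` under the assignment `s`, if the quantifier at
position `p` is given the value `val p`. -/
def Holds (val : ℕ → B) : PosFormula σ → ℕ → (ℕ → B) → Prop
  | rel R x, _, s => FirstOrder.Language.Structure.RelMap R (fun j => s (x j))
  | and φ ψ, o, s => φ.Holds val (o + 1) s ∧ ψ.Holds val (o + 1 + φ.encode.length + 1) s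
  | or φ ψ, o, s => φ.Holds val (o + 1) s ∨ ψ.Holds val (o + 1 + φ.encode.length + 1) s
  | all i φ, o, s =>
    φ.Holds val (o + 1 + (encodeVar (σ := σ) i).length) (Function.update s i (val o))
  | ex i φ, o, s =>
    φ.Holds val (o + 1 + (encodeVar (σ := σ) i).length) (Function.update s i (val o))

variable {k : ℕ}

/-- The state of the evaluation at position `p`. -/
noncomputable def evalAt (t : ℕ → Option (Token σ)) (n k : ℕ) (val : ℕ → B) (p : ℕ) :
    EvalState σ B k × ℕ :=
  forwardLoop (fun p (s : EvalState σ B k × ℕ) => evalStep (t p) (val (binder t n p).2) s.1 s.2)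
    (.run false none, 0) p

theorem evalAt_succ {t : ℕ → Option (Token σ)} {n : ℕ} {val : ℕ → B} {p : ℕ}
    {r : EvalState σ B k × ℕ} (h : evalAt t n k val p = r) :
    evalAt t n k val (p + 1) = evalStep (t p) (val (scope t n p p).2) r.1 r.2 := by
  subst h; rfl

/-- Pairs inside the skipped text raise and lower the counter, so none of their closing parentheses
ends the skipping. -/
theorem evalAt_skip {t : ℕ → Option (Token σ)} {l : List (Token σ)} (hl : Balanced l) {n : ℕ}
    {val : ℕ → B} {q : ℕ} (h : Occurs t q l) {b : Bool} {d : ℕ}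
    (hq : evalAt t n k val q = (.skip b, d)) : evalAt t n k val (q + l.length) = (.skip b, d) := by
  induction hl generalizing q d with
  | nil => exact hq
  | single a h₁ h₂ h₃ h₄ =>
    rw [List.length_singleton, evalAt_succ hq, h.1]
    cases a <;> simp_all [evalStep]
  | append _ _ ih₁ ih₂ =>
    rw [occurs_append] at h
    rw [List.length_append, ← add_assoc]
    exact ih₂ h.2 (ih₁ h.1 hq)
  | @paren l m a ha _ _ ih₁ ih₂ =>
    obtain ⟨h0, h⟩ := h
    rw [occurs_append] at h
    obtain ⟨h1, h2, h⟩ := h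
    rw [occurs_append] at h
    obtain ⟨h3, h4, -⟩ := h
    have e : q + (Token.lparen :: (l ++ a :: (m ++ [.rparen]))).length =
        q + 1 + l.length + 1 + m.length + 1 := by simp; ring
    have s1 : evalAt t n k val (q + 1) = (.skip b, d + 1) := by rw [evalAt_succ hq, h0]; rfl
    have s2 := ih₁ h1 s1
    have s3 : evalAt t n k val (q + 1 + l.length + 1) = (.skip b, d + 1) := by
      rw [evalAt_succ s2, h2]
      rcases ha with rfl | rfl <;> rfl
    rw [e, evalAt_succ (ih₂ h3 s3), h4]
    rfl

theorem evalAt_digits {t : ℕ → Option (Token σ)} {l : List Bool} {n : ℕ} {val : ℕ → B} {q : ℕ}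
    (h : Occurs t q (l.map .digit)) {b : Bool} {c} {d : ℕ}
    (hq : evalAt t n k val q = (.run b c, d)) :
    evalAt t n k val (q + l.length) = (.run b c, d) := by
  induction l generalizing q with
  | nil => exact hq
  | cons a l ih =>
    rw [List.length_cons, add_comm l.length, ← add_assoc]
    refine ih h.2 ?_
    rw [evalAt_succ hq, h.1]
    cases c <;> rfl

theorem evalAt_varTokens {t : ℕ → Option (Token σ)} {n : ℕ} {val : ℕ → B} {q : ℕ} {xs : List ℕ}
    (h : Occurs t q (xs.flatMap encodeVar))
    (hend : digit? (t (q + (xs.flatMap (encodeVar (σ := σ))).length)) = none) {s : ℕ → B}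
    (hs : Agrees t n val q {i | i ∈ xs} s) {R : Σ n, σ.Relations n}
    {l : {l : List B // l.length ≤ k}} (hl : l.1.length + xs.length ≤ k)
    (hq : evalAt t n k val q = (.run (truth R l.1) (some (R, l)), 0)) :
    ∃ c, evalAt t n k val (q + (xs.flatMap (encodeVar (σ := σ))).length) =
      (.run (truth R (l.1 ++ xs.map s)) c, 0) := by
  induction xs generalizing q l with
  | nil => exact ⟨some (R, l), by simpa using hq⟩
  | cons i xs ih =>
    rw [List.flatMap_cons, occurs_append] at h
    rw [List.flatMap_cons, List.length_append, ← add_assoc] at hend ⊢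
    have hi : digit? (t (q + (encodeVar (σ := σ) i).length)) = none := by
      cases xs with
      | nil => exact hend
      | cons j xs => rw [h.2.1]; rfl
    have hpush : (push l (s i)).1 = l.1 ++ [s i] := by
      -- By `hl` the list is not yet full, so nothing is discarded.
      rw [push, dif_pos]
      simp only [List.length_cons] at hl
      simp
      omega
    have h1 : evalAt t n k val (q + 1) = (.run (truth R (push l (s i)).1) (some (R, push l (s i))), 0) := by
      rw [evalAt_succ hq, h.1.1, hs q i (h.1.varAt hi) (by simp)]
      rfl
    have h2 := evalAt_digits h.1.2 h1
    obtain ⟨c, hc⟩ := ih (l := push l (s i)) h.2 hend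
      (hs.of_scope (by intro j hj; simp [show j ∈ xs from hj])
        fun p => scope_varTokens h.1 (fun _ => isVarToken_of_mem_encodeVar) n p)
      (by rw [hpush]; simp only [List.length_cons] at hl; simp; omega)
      (by rw [← h2]; congr 1; simp [encodeVar]; ring)
    refine ⟨c, ?_⟩
    rw [hc, hpush]
    simp

open scoped Classical in
-- The incoming value `b` and atom `c` are arbitrary, because the first atom of the formula
-- overwrites them; this is what lets the second operand start from the state that the first one
-- leaves.
theorem evalAt_encode {t : ℕ → Option (Token σ)} {n : ℕ} (ht : ∀ j, n ≤ j → t j = none)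
    (hk : ∀ R : Σ n, σ.Relations n, R.1 ≤ k) (val : ℕ → B)
    (φ : PosFormula σ) {q : ℕ} (h : Occurs t q φ.encode)
    (hend : digit? (t (q + φ.encode.length)) = none) {s : ℕ → B}
    (hs : Agrees t n val q φ.free s) {b : Bool} {c} (hq : evalAt t n k val q = (.run b c, 0)) :
    ∃ c, evalAt t n k val (q + φ.encode.length) = (.run (decide (φ.Holds val q s)) c, 0) := by
  have quantified : ∀ (φ : PosFormula σ) (j : ℕ) (a : Token σ) (ha : a = .all ∨ a = .ex) (q : ℕ)
      (hφ : ∀ {q : ℕ}, Occurs t q φ.encode → digit? (t (q + φ.encode.length)) = none →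
        ∀ {s : ℕ → B}, Agrees t n val q φ.free s → ∀ {b c}, evalAt t n k val q = (.run b c, 0) →
        ∃ c, evalAt t n k val (q + φ.encode.length) = (.run (decide (φ.Holds val q s)) c, 0))
      (l : List (Token σ)) (hl : l = a :: (encodeVar j ++ φ.encode))
      (h : Occurs t q l) (hend : digit? (t (q + l.length)) = none) (s : ℕ → B)
      (hs : Agrees t n val q (φ.free \ {j}) s) (b : Bool) (c)
      (hq : evalAt t n k val q = (.run b c, 0)),
      ∃ c, evalAt t n k val (q + l.length) = (.run (decide (φ.Holds val
        (q + 1 + (encodeVar (σ := σ) j).length) (Function.update s j (val q)))) c, 0) := by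
    intro φ j a ha q hφ l hl h hend s hs b c hq
    subst hl
    obtain ⟨h0, h⟩ := h
    rw [occurs_append] at h
    obtain ⟨h1, h2⟩ := h
    rw [show q + (a :: (encodeVar j ++ φ.encode)).length =
        q + 1 + (encodeVar (σ := σ) j).length + φ.encode.length by simp; ring] at hend ⊢
    have hv := h1.varAt h2.digit?_eq_none
    have s1 : evalAt t n k val (q + 1) = (.run b none, 0) := by
      rw [evalAt_succ hq, h0]
      rcases ha with rfl | rfl <;> rfl
    have s2 : evalAt t n k val (q + 1 + 1) = (.run b none, 0) := by
      rw [evalAt_succ s1, h1.1]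
      rfl
    have s3 := evalAt_digits h1.2 s2
    refine hφ h2 hend (fun p i hp hi => ?_) (b := b) (c := none) ?_
    · rw [scope_quantifier ht ha h0 h1 hv hp]
      split_ifs with hij
      · simp [hij]
      · rw [hs p i hp ⟨hi, hij⟩, Function.update_of_ne hij]
    · rw [← s3]; congr 1; simp [encodeVar]; ring
  induction φ generalizing q s b c with
  | @rel m R x =>
    have e : q + (rel R x).encode.length =
        q + 1 + ((List.ofFn x).flatMap (encodeVar (σ := σ))).length := by
      simp [encode]; ring
    rw [e] at hend ⊢
    obtain ⟨c, hc⟩ := evalAt_varTokens (k := k) h.2 hend (s := s) (R := ⟨m, R⟩)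
      (l := ⟨[], Nat.zero_le k⟩)
      (hs.of_scope (by simp [free, Set.subset_def, List.mem_ofFn]) (scope_rel h.1 n)) (by simpa using hk ⟨m, R⟩)
      (by rw [evalAt_succ hq, h.1]; cases c <;> rfl)
    refine ⟨c, ?_⟩
    rw [hc]
    congr 2
    simp only [truth, Holds, List.nil_append, List.map_ofFn]
    refine decide_eq_decide.2 ⟨?_, fun hR => ⟨_, rfl, hR⟩⟩
    rintro ⟨y, hy, hR⟩
    rwa [List.ofFn_injective hy] at hR
  | and φ ψ hφ hψ =>
    obtain ⟨h0, h⟩ := h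
    rw [occurs_append] at h
    obtain ⟨h1, h2, h⟩ := h
    rw [occurs_append] at h
    obtain ⟨h3, h4, -⟩ := h
    rw [show q + (φ.and ψ).encode.length =
        q + 1 + φ.encode.length + 1 + ψ.encode.length + 1 by simp [encode]; ring]
    have s1 : evalAt t n k val (q + 1) = (.run b c, 0) := by
      rw [evalAt_succ hq, h0]; cases c <;> rfl
    obtain ⟨c', s2⟩ := hφ h1 (by rw [h2]; rfl)
      (hs.of_scope Set.subset_union_left (scope_lparen h0 n)) s1
    have s3 := evalAt_succ s2
    rw [h2] at s3
    -- If the first operand is true, the value of the second is that of the pair; if it is false,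
    -- this value is carried through the second operand to the closing parenthesis.
    by_cases hT : φ.Holds val (q + 1) s
    · have s3 : evalAt t n k val (q + 1 + φ.encode.length + 1) = (.run true c', 0) := by
        rw [s3]; cases c' <;> simp [evalStep, hT]
      obtain ⟨c'', s4⟩ := hψ h3 (by rw [h4]; rfl) (hs.of_scope Set.subset_union_right
        (scope_connective h0 (balanced_encode φ) h1 h2 (.inl rfl) n)) s3
      refine ⟨c'', ?_⟩
      rw [evalAt_succ s4, h4]
      cases c'' <;> simp [evalStep, Holds, hT]
    · have s3 : evalAt t n k val (q + 1 + φ.encode.length + 1) = (.skip false, 0) := by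
        rw [s3]; cases c' <;> simp [evalStep, hT]
      refine ⟨none, ?_⟩
      rw [evalAt_succ (evalAt_skip (balanced_encode ψ) h3 s3), h4]
      simp [evalStep, Holds, hT]
  | or φ ψ hφ hψ =>
    obtain ⟨h0, h⟩ := h
    rw [occurs_append] at h
    obtain ⟨h1, h2, h⟩ := h
    rw [occurs_append] at h
    obtain ⟨h3, h4, -⟩ := h
    rw [show q + (φ.or ψ).encode.length =
        q + 1 + φ.encode.length + 1 + ψ.encode.length + 1 by simp [encode]; ring]
    have s1 : evalAt t n k val (q + 1) = (.run b c, 0) := by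
      rw [evalAt_succ hq, h0]; cases c <;> rfl
    obtain ⟨c', s2⟩ := hφ h1 (by rw [h2]; rfl)
      (hs.of_scope Set.subset_union_left (scope_lparen h0 n)) s1
    have s3 := evalAt_succ s2
    rw [h2] at s3
    by_cases hT : φ.Holds val (q + 1) s
    · have s3 : evalAt t n k val (q + 1 + φ.encode.length + 1) = (.skip true, 0) := by
        rw [s3]; cases c' <;> simp [evalStep, hT]
      refine ⟨none, ?_⟩
      rw [evalAt_succ (evalAt_skip (balanced_encode ψ) h3 s3), h4]
      simp [evalStep, Holds, hT]
    · have s3 : evalAt t n k val (q + 1 + φ.encode.length + 1) = (.run false c', 0) := by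
        rw [s3]; cases c' <;> simp [evalStep, hT]
      obtain ⟨c'', s4⟩ := hψ h3 (by rw [h4]; rfl) (hs.of_scope Set.subset_union_right
        (scope_connective h0 (balanced_encode φ) h1 h2 (.inr rfl) n)) s3
      refine ⟨c'', ?_⟩
      rw [evalAt_succ s4, h4]
      cases c'' <;> simp [evalStep, Holds, hT]
  | all i φ hφ => exact quantified φ i .all (.inl rfl) q hφ _ rfl h hend s hs b c hq
  | ex i φ hφ => exact quantified φ i .ex (.inr rfl) q hφ _ rfl h hend s hs b c hq

theorem evalAt_add {t : ℕ → Option (Token σ)} {n m : ℕ} (ht : ∀ j, m ≤ j → t j = none)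
    {val : ℕ → B} {b : Bool} {c} (h : evalAt t n k val m = (.run b c, 0)) (j : ℕ) :
    evalAt t n k val (m + j) = (.run b c, 0) := by
  induction j with
  | zero => exact h
  | succ j ih =>
    rw [← add_assoc, evalAt_succ ih, ht _ (by omega)]
    cases c <;> rfl

/-- The assignment `s` is arbitrary, since a sentence has no free variable on which it would have to
agree with `val`. -/
theorem check_encode (hk : ∀ R : Σ n, σ.Relations n, R.1 ≤ k) {φ : PosFormula σ}
    (hφ : φ.IsSentence) {n : ℕ} (hn : φ.encode.length ≤ n) (val : ℕ → B) (s : ℕ → B) :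
    check (fun j => φ.encode[j]?) n k val = true ↔ φ.Holds val 0 s := by
  classical
  have hocc : Occurs (fun j => φ.encode[j]?) 0 φ.encode := occurs_getElem? [] φ.encode
  have ht : ∀ j, φ.encode.length ≤ j → φ.encode[j]? = none := fun j hj =>
    List.getElem?_eq_none hj
  obtain ⟨c, hc⟩ := evalAt_encode (k := k) (n := n) (s := s) (fun j hj => ht j (hn.trans hj)) hk
    val φ hocc (by rw [zero_add, ht _ le_rfl]; rfl)
    (fun p i _ hi => by rw [hφ] at hi; exact hi.elim) rfl
  simp only [check, Bool.and_eq_true, wellFormed_iff φ.encode hn, closed_iff hocc ht hn]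
  obtain ⟨j, rfl⟩ := Nat.exists_eq_add_of_le hn
  rw [zero_add] at hc
  have := evalAt_add ht hc j
  rw [show evaluate (fun j => φ.encode[j]?) (φ.encode.length + j) k val = _ from this]
  simp [result, hφ]

theorem exists_of_check {x : List (Token σ)} {n : ℕ} (hn : x.length ≤ n) {val : ℕ → B}
    (h : check (fun j => x[j]?) n k val = true) :
    ∃ φ : PosFormula σ, φ.IsSentence ∧ φ.encode = x := by
  simp only [check, Bool.and_eq_true, wellFormed_iff x hn] at h
  obtain ⟨⟨⟨φ, rfl⟩, h1⟩, -⟩ := h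
  exact ⟨φ, (closed_iff (occurs_getElem? [] φ.encode) (fun j hj => List.getElem?_eq_none hj) hn).1 h1,
    rfl⟩

end PosFormula


/-! ### Quantifiers with a fixed value -/

namespace PosFormula

variable {σ : FirstOrder.Language.{u, v}} {B : Type w}

open scoped Classical in
/-- The quantifiers `a` get the value `b`, the others are given by `c`. -/
noncomputable def strategy (t : ℕ → Option (Token σ)) (a : Token σ) (b : B) (c : ℕ → B) (j : ℕ) :
    B :=
  if t j = some a then b else c j

theorem strategy_of_eq {t : ℕ → Option (Token σ)} {a : Token σ} {j : ℕ} (h : t j = some a) (b : B)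
    (c : ℕ → B) : strategy t a b c j = b :=
  if_pos h

variable [σ.Structure B]

/-- Only values at positions inside the word of the formula matter, which allows independent choices
for different subformulas. -/
theorem holds_congr (φ : PosFormula σ) {val val' : ℕ → B} {o : ℕ} {s : ℕ → B}
    (h : ∀ j, o ≤ j → j < o + φ.encode.length → val j = val' j) :
    φ.Holds val o s ↔ φ.Holds val' o s := by
  induction φ generalizing o s with
  | rel R x => rfl
  | and φ ψ hφ hψ =>
    simp only [encode, List.length_cons, List.length_append] at h
    exact and_congr (hφ fun j h1 h2 => h j (by omega) (by omega))
      (hψ fun j h1 h2 => h j (by omega) (by omega))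
  | or φ ψ hφ hψ =>
    simp only [encode, List.length_cons, List.length_append] at h
    exact or_congr (hφ fun j h1 h2 => h j (by omega) (by omega))
      (hψ fun j h1 h2 => h j (by omega) (by omega))
  | all i φ hφ =>
    simp only [encode, List.length_cons, List.length_append] at h
    simp only [Holds, h o le_rfl (by omega)]
    exact hφ fun j h1 h2 => h j (by omega) (by omega)
  | ex i φ hφ =>
    simp only [encode, List.length_cons, List.length_append] at h
    simp only [Holds, h o le_rfl (by omega)]
    exact hφ fun j h1 h2 => h j (by omega) (by omega)

theorem update_mem {h : B → Set B} {s s' : ℕ → B} (hs : ∀ i, s' i ∈ h (s i)) {b b' : B}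
    (hb : b' ∈ h b) (i j : ℕ) : Function.update s' i b' j ∈ h (Function.update s i b j) := by
  rcases eq_or_ne j i with rfl | hij
  · simpa using hb
  · simpa [hij] using hs j

/-- Every `b` lies in `h a`, so the single instance `a` of a universal quantifier yields all
instances under `s'`. For an existential quantifier any element of the non-empty set `h (val o)` is
a witness. -/
theorem realize_of_holds {h : B → Set B} (hh : IsShe σ h) {a : B} (ha : h a = Set.univ)
    {t : ℕ → Option (Token σ)} {val : ℕ → B} (hval : ∀ j, t j = some .all → val j = a)
    (φ : PosFormula σ) {o : ℕ} (ho : Occurs t o φ.encode) {s s' : ℕ → B}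
    (hs : ∀ i, s' i ∈ h (s i)) (H : φ.Holds val o s) : φ.Realize s' := by
  induction φ generalizing o s s' with
  | rel R x => exact hh.preserves _ R _ _ H fun j => hs _
  | and φ ψ hφ hψ =>
    obtain ⟨-, ho⟩ := ho
    rw [occurs_append] at ho
    exact ⟨hφ ho.1 hs H.1, hψ (occurs_append.1 ho.2.2).1 hs H.2⟩
  | or φ ψ hφ hψ =>
    obtain ⟨-, ho⟩ := ho
    rw [occurs_append] at ho
    exact H.imp (hφ ho.1 hs) (hψ (occurs_append.1 ho.2.2).1 hs)
  | all i φ hφ =>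
    intro b
    exact hφ (occurs_append.1 ho.2).2 (update_mem hs (by rw [hval o ho.1, ha]; trivial) i) H
  | ex i φ hφ =>
    obtain ⟨b, hb⟩ := hh.isShop.total (val o)
    exact ⟨b, hφ (occurs_append.1 ho.2).2 (update_mem hs hb i) H⟩

/-- For a universal quantifier, surjectivity provides an instance `b` with `val o ∈ h b`; for an
existential one, `e` lies in the image of every witness. The other values of `val` do not matter. -/
theorem holds_of_realize {h : B → Set B} (hh : IsShe σ h) {e : B} (he : ∀ b, e ∈ h b)
    {t : ℕ → Option (Token σ)} {val : ℕ → B} (hval : ∀ j, t j = some .ex → val j = e)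
    (φ : PosFormula σ) {o : ℕ} (ho : Occurs t o φ.encode) {s s' : ℕ → B}
    (hs : ∀ i, s' i ∈ h (s i)) (H : φ.Realize s) : φ.Holds val o s' := by
  induction φ generalizing o s s' with
  | rel R x => exact hh.preserves _ R _ _ H fun j => hs _
  | and φ ψ hφ hψ =>
    obtain ⟨-, ho⟩ := ho
    rw [occurs_append] at ho
    exact ⟨hφ ho.1 hs H.1, hψ (occurs_append.1 ho.2.2).1 hs H.2⟩
  | or φ ψ hφ hψ =>
    obtain ⟨-, ho⟩ := ho
    rw [occurs_append] at ho
    exact H.imp (hφ ho.1 hs) (hψ (occurs_append.1 ho.2.2).1 hs)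
  | all i φ hφ =>
    obtain ⟨b, hb⟩ := hh.isShop.surjective (val o)
    exact hφ (occurs_append.1 ho.2).2 (update_mem hs hb i) (H b)
  | ex i φ hφ =>
    obtain ⟨b, hb⟩ := H
    exact hφ (occurs_append.1 ho.2).2 (update_mem hs (by rw [hval o ho.1]; exact he b) i) hb

theorem holds_strategy_congr {t : ℕ → Option (Token σ)} {a : Token σ} {b : B} {c c' : ℕ → B}
    (φ : PosFormula σ) {o : ℕ} {s : ℕ → B}
    (h : ∀ j, o ≤ j → j < o + φ.encode.length → c j = c' j) :
    φ.Holds (strategy t a b c) o s ↔ φ.Holds (strategy t a b c') o s :=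
  φ.holds_congr fun j h1 h2 => by rw [strategy, strategy, h j h1 h2]

/-- Strategies for two subformulas at different positions can be combined. -/
theorem exists_strategy (t : ℕ → Option (Token σ)) (a : Token σ) (b : B) (φ ψ : PosFormula σ)
    (o : ℕ) (s : ℕ → B) (c c' : ℕ → B) : ∃ d : ℕ → B,
    (φ.Holds (strategy t a b d) (o + 1) s ↔ φ.Holds (strategy t a b c) (o + 1) s) ∧
    (ψ.Holds (strategy t a b d) (o + 1 + φ.encode.length + 1) s ↔
      ψ.Holds (strategy t a b c') (o + 1 + φ.encode.length + 1) s) :=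
  ⟨fun j => if j < o + 1 + φ.encode.length then c j else c' j,
    holds_strategy_congr φ fun j _ h => if_pos h,
    holds_strategy_congr ψ fun j h _ => if_neg (by omega)⟩

/-- The value of the first quantifier can be chosen. -/
theorem exists_strategy_update {t : ℕ → Option (Token σ)} {a : Token σ} (b : B) (φ : PosFormula σ)
    {o : ℕ} {a' : Token σ} (ho : t o = some a') (ha : a' ≠ a) (i : ℕ) (s : ℕ → B) (c : ℕ → B) (b' : B) : ∃ d : ℕ → B,
    strategy t a b d o = b' ∧
    (φ.Holds (strategy t a b d) (o + 1 + (encodeVar (σ := σ) i).length) s ↔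
      φ.Holds (strategy t a b c) (o + 1 + (encodeVar (σ := σ) i).length) s) :=
  ⟨Function.update c o b', (if_neg (by simpa [ho] using ha)).trans (by simp), holds_strategy_congr φ fun j h _ =>
    Function.update_of_ne (by omega) _ _⟩

/-- Since a universal variable is only instantiated at `a`, the witness of an existential quantifier
needs to depend on its position alone. -/
theorem exists_holds {t : ℕ → Option (Token σ)} (a : B) (φ : PosFormula σ) {o : ℕ}
    (ho : Occurs t o φ.encode) {s : ℕ → B} (H : φ.Realize s) :
    ∃ c, φ.Holds (strategy t .all a c) o s := by
  induction φ generalizing o s with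
  | rel R x => exact ⟨fun _ => a, H⟩
  | and φ ψ hφ hψ =>
    obtain ⟨-, ho⟩ := ho
    rw [occurs_append] at ho
    obtain ⟨c, hc⟩ := hφ ho.1 H.1
    obtain ⟨c', hc'⟩ := hψ (occurs_append.1 ho.2.2).1 H.2
    obtain ⟨d, h1, h2⟩ := exists_strategy t .all a φ ψ o s c c'
    exact ⟨d, h1.2 hc, h2.2 hc'⟩
  | or φ ψ hφ hψ =>
    obtain ⟨-, ho⟩ := ho
    rw [occurs_append] at ho
    rcases H with H | H
    · obtain ⟨c, hc⟩ := hφ ho.1 H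
      exact ⟨c, .inl hc⟩
    · obtain ⟨c, hc⟩ := hψ (occurs_append.1 ho.2.2).1 H
      exact ⟨c, .inr hc⟩
  | all i φ hφ =>
    obtain ⟨c, hc⟩ := hφ (occurs_append.1 ho.2).2 (H a)
    exact ⟨c, by rwa [Holds, strategy_of_eq ho.1]⟩
  | ex i φ hφ =>
    obtain ⟨b, H⟩ := H
    obtain ⟨c, hc⟩ := hφ (occurs_append.1 ho.2).2 H
    obtain ⟨d, h1, h2⟩ := exists_strategy_update a φ ho.1 (show _ ≠ .all by simp) i
      (Function.update s i b) c b
    exact ⟨d, by rw [Holds, h1]; exact h2.2 hc⟩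

/-- Dual to `exists_holds`: with existential variables fixed at `e`, a counterexample for a
universal quantifier depends on its position alone. -/
theorem exists_not_holds {t : ℕ → Option (Token σ)} (e : B) (φ : PosFormula σ) {o : ℕ}
    (ho : Occurs t o φ.encode) {s : ℕ → B} (H : ¬ φ.Realize s) :
    ∃ c, ¬ φ.Holds (strategy t .ex e c) o s := by
  induction φ generalizing o s with
  | rel R x => exact ⟨fun _ => e, H⟩
  | and φ ψ hφ hψ =>
    obtain ⟨-, ho⟩ := ho
    rw [occurs_append] at ho
    rcases not_and_or.1 H with H | H
    · obtain ⟨c, hc⟩ := hφ ho.1 H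
      exact ⟨c, fun h => hc h.1⟩
    · obtain ⟨c, hc⟩ := hψ (occurs_append.1 ho.2.2).1 H
      exact ⟨c, fun h => hc h.2⟩
  | or φ ψ hφ hψ =>
    obtain ⟨-, ho⟩ := ho
    rw [occurs_append] at ho
    obtain ⟨H, H'⟩ := not_or.1 H
    obtain ⟨c, hc⟩ := hφ ho.1 H
    obtain ⟨c', hc'⟩ := hψ (occurs_append.1 ho.2.2).1 H'
    obtain ⟨d, h1, h2⟩ := exists_strategy t .ex e φ ψ o s c c'
    exact ⟨d, not_or.2 ⟨fun h => hc (h1.1 h), fun h => hc' (h2.1 h)⟩⟩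
  | all i φ hφ =>
    obtain ⟨b, H⟩ := not_forall.1 H
    obtain ⟨c, hc⟩ := hφ (occurs_append.1 ho.2).2 H
    obtain ⟨d, h1, h2⟩ := exists_strategy_update e φ ho.1 (show _ ≠ .ex by simp) i
      (Function.update s i b) c b
    exact ⟨d, by rw [Holds, h1]; exact fun h => hc (h2.1 h)⟩
  | ex i φ hφ =>
    obtain ⟨c, hc⟩ := hφ (occurs_append.1 ho.2).2 (not_exists.1 H e)
    exact ⟨c, by rwa [Holds, strategy_of_eq ho.1]⟩

end PosFormula


/-! ### Words with certificates -/

section Certificate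

variable {α : Type u} {Γ : Type v}

/-- The letter at position `j` of the first part of a word over `α ⊕ Γ`. -/
def leftLetter (w : List (α ⊕ Γ)) (j : ℕ) : Option α :=
  match OfflineTM.inputAt w (j + 1) with
  | .letter (.inl a) => some a
  | _ => none

/-- The length of the first part of a word over `α ⊕ Γ`. -/
def leftLength (w : List (α ⊕ Γ)) : ℕ :=
  forwardLoop (fun j n => bif (leftLetter w j).isSome then n + 1 else n) 0 w.length

/-- The letter at position `j` of the second part of a word over `α ⊕ Γ`. -/
def rightLetter (w : List (α ⊕ Γ)) (j : ℕ) : Option Γ :=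
  match OfflineTM.inputAt w (leftLength w + j + 1) with
  | .letter (.inr a) => some a
  | _ => none

theorem leftLetter_append (x : List α) (y : List Γ) :
    leftLetter (x.map Sum.inl ++ y.map Sum.inr) = fun j => x[j]? := by
  funext j
  rcases lt_or_ge j x.length with hj | hj
  · rw [leftLetter, OfflineTM.inputAt, List.getElem?_append_left (by simpa using hj),
      List.getElem?_map]
    simp [hj]
  · rw [leftLetter, OfflineTM.inputAt, List.getElem?_append_right (by simpa using hj),
      List.getElem?_map, List.getElem?_eq_none hj]
    cases y[j - (x.map Sum.inl).length]? <;> rfl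

theorem leftLength_append (x : List α) (y : List Γ) :
    leftLength (x.map Sum.inl ++ y.map Sum.inr) = x.length := by
  have : ∀ m, forwardLoop (fun j n => bif (x[j]?).isSome then n + 1 else n) 0 m =
      min m x.length := by
    intro m
    induction m with
    | zero => simp [forwardLoop]
    | succ m ih =>
      rw [forwardLoop, ih]
      rcases lt_or_ge m x.length with hm | hm
      · simp [hm]; omega
      · simp [List.getElem?_eq_none hm]; omega
  rw [leftLength, leftLetter_append, this]
  simp

theorem rightLetter_append (x : List α) (y : List Γ) (j : ℕ) :
    rightLetter (x.map Sum.inl ++ y.map Sum.inr) j = y[j]? := by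
  rw [rightLetter, leftLength_append, OfflineTM.inputAt, List.getElem?_append_right (by simp)]
  simp only [List.length_map, add_tsub_cancel_left, List.getElem?_map]
  cases y[j]? <;> rfl

variable [Finite α] [Finite Γ]

theorem logFn_leftLetter : LogFn (leftLetter (α := α) (Γ := Γ)) :=
  .finMap (.symbol (.succ .id)) fun a : InputSymbol (α ⊕ Γ) =>
    match a with
    | .letter (.inl a) => some a
    | _ => none

theorem logFn_leftLength : LogFn fun (w : List (α ⊕ Γ)) (_ : Unit) => leftLength w := by
  refine .forwardLoop (f := fun w _ j n => bif (leftLetter w j).isSome then n + 1 else n) .length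
    (.natConst 0) (.cond (.finMap (.comp logFn_leftLetter (.snd (.fst .id))) _) (.succ (.snd .id))
    (.snd .id)) ⟨1, fun w _ j n => ?_⟩
  rw [RegCode.size_nat, RegCode.size_nat]
  cases (leftLetter w j).isSome <;> simp only [cond_true, cond_false] <;> omega

theorem logFn_rightLetter : LogFn (rightLetter (α := α) (Γ := Γ)) :=
  .finMap (.symbol (.succ (.add (.comp logFn_leftLength (.finConst ())) .id)))
    fun a : InputSymbol (α ⊕ Γ) =>
    match a with
    | .letter (.inr a) => some a
    | _ => none

end Certificate

/-! ### The complexity of positive evaluation -/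

namespace PosFormula

variable {σ : FirstOrder.Language.{u, v}} {B : Type w} [Finite B]

theorem exists_arity_le (σ : FirstOrder.Language.{u, v}) [Finite (Σ n, σ.Relations n)] :
    ∃ k, ∀ R : Σ n, σ.Relations n, R.1 ≤ k := by
  obtain ⟨k, hk⟩ := (Set.finite_range fun R : Σ n, σ.Relations n => R.1).bddAbove
  exact ⟨k, fun R => hk ⟨R, rfl⟩⟩

theorem logFn_strategy [Finite (Σ n, σ.Relations n)] {α : Type u₁} {t : List α → ℕ → Option (Token σ)} {c : List α → ℕ → B}
    (ht : LogFn t) (hc : LogFn c) (a : Token σ) (b : B) :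
    LogFn fun w j => strategy (t w) a b (c w) j := by
  classical
  have := LogFn.cond (.finMap ht fun o => decide (o = some a)) (.finConst b) hc
  convert this using 3 with w j
  by_cases h : t w j = some a <;> simp [strategy, h]

variable [σ.Structure B]

/-- The values of the quantifiers that the certificate in a word prescribes. -/
noncomputable def certStrategy (a : Token σ) (b : B) (w : List (Token σ ⊕ Fin (Nat.card B))) :
    ℕ → B :=
  strategy (leftLetter w) a b fun j => ((rightLetter w j).map (Finite.equivFin B).symm).getD b

/-- The length of the whole word serves as the loop bound, as it is at least that of the formula. -/
noncomputable def certCheck (k : ℕ) (a : Token σ) (b : B)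
    (w : List (Token σ ⊕ Fin (Nat.card B))) : Bool :=
  check (leftLetter w) w.length k (certStrategy a b w)

theorem logFn_certCheck [Finite (Σ n, σ.Relations n)] (k : ℕ) (a : Token σ) (b : B) :
    LogFn fun w (_ : Unit) => certCheck k a b w :=
  logFn_check logFn_leftLetter (logFn_strategy logFn_leftLetter (.finMap logFn_rightLetter
    fun o => (o.map (Finite.equivFin B).symm).getD b) a b)

theorem certCheck_append {k : ℕ} (hk : ∀ R : Σ n, σ.Relations n, R.1 ≤ k) (a : Token σ) (b : B)
    {φ : PosFormula σ} (hφ : φ.IsSentence) (y : List (Fin (Nat.card B))) (s : ℕ → B) :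
    certCheck k a b (φ.encode.map Sum.inl ++ y.map Sum.inr) = true ↔
      φ.Holds (strategy (fun j => φ.encode[j]?) a b
        fun j => (y[j]?.map (Finite.equivFin B).symm).getD b) 0 s := by
  rw [certCheck, certStrategy, leftLetter_append]
  simp only [rightLetter_append]
  exact check_encode hk hφ (by simp) _ s

theorem exists_of_certCheck {k : ℕ} {a : Token σ} {b : B} {x : List (Token σ)}
    {y : List (Fin (Nat.card B))} (h : certCheck k a b (x.map Sum.inl ++ y.map Sum.inr) = true) :
    ∃ φ : PosFormula σ, φ.IsSentence ∧ φ.encode = x := by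
  rw [certCheck, leftLetter_append] at h
  exact exists_of_check (by simp) h

/-- The certificate lists the values of `c` at all positions of the formula, so that it is exactly
as long as the formula. -/
theorem exists_certificate {k : ℕ} (hk : ∀ R : Σ n, σ.Relations n, R.1 ≤ k) (a : Token σ) (b : B)
    {φ : PosFormula σ} (hφ : φ.IsSentence) (c : ℕ → B) (s : ℕ → B) :
    ∃ y : List (Fin (Nat.card B)), y.length ≤ φ.encode.length ∧
      (certCheck k a b (φ.encode.map Sum.inl ++ y.map Sum.inr) = true ↔
        φ.Holds (strategy (fun j => φ.encode[j]?) a b c) 0 s) := by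
  refine ⟨List.ofFn fun j : Fin φ.encode.length => Finite.equivFin B (c j), by simp, ?_⟩
  rw [certCheck_append hk a b hφ _ s]
  refine holds_strategy_congr φ fun j _ hj => ?_
  rw [zero_add] at hj
  simp [hj]

end PosFormula

/-! ### The three upper bounds. -/

section Main

open PosFormula

variable {σ : FirstOrder.Language.{u, v}} [Finite (Σ n, σ.Relations n)] {B : Type w} [Finite B]
  [σ.Structure B]

theorem inNP_of_isAShop {h : B → Set B} (hh : IsShe σ h) {a : B} (ha : h a = Set.univ) :
    InNP (positiveEvaluation σ B) := by
  obtain ⟨k, hk⟩ := exists_arity_le σ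
  -- The alphabet of certificates has to lie in `Type`, while `B` may lie in a higher universe.
  refine ⟨Fin (Nat.card B), inferInstance, {w | certCheck (σ := σ) k .all a w = true}, .X,
    (logFn_certCheck k .all a).inLogspace.inPtime, fun x => ?_⟩
  simp only [Polynomial.eval_X]
  constructor
  · rintro ⟨φ, hφ, hT, rfl⟩
    obtain ⟨c, hc⟩ := exists_holds a φ (occurs_getElem? [] φ.encode) (hT fun _ => a)
    obtain ⟨y, hy, hiff⟩ := exists_certificate hk .all a hφ c fun _ => a
    exact ⟨y, hy, hiff.2 hc⟩
  · rintro ⟨y, -, hy⟩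
    obtain ⟨φ, hφ, rfl⟩ := exists_of_certCheck hy
    refine ⟨φ, hφ, fun s => ?_, rfl⟩
    exact realize_of_holds hh ha (fun j hj => strategy_of_eq hj _ _) φ
      (occurs_getElem? [] φ.encode) (s := fun _ => a) (fun i => by rw [ha]; trivial)
      ((certCheck_append hk .all a hφ y _).1 hy)

theorem inCoNP_of_isEShop {h : B → Set B} (hh : IsShe σ h) {e : B} (he : ∀ b, e ∈ h b) :
    InCoNP (positiveEvaluation σ B) := by
  obtain ⟨k, hk⟩ := exists_arity_le σ
  refine ⟨Fin (Nat.card B), inferInstance, {w | (!certCheck (σ := σ) k .ex e w) = true}, .X,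
    (logFn_certCheck k .ex e).not.inLogspace.inPtime, fun x => ?_⟩
  simp only [Polynomial.eval_X]
  constructor
  · intro hx
    by_cases h' : ∃ φ : PosFormula σ, φ.IsSentence ∧ φ.encode = x
    · obtain ⟨φ, hφ, rfl⟩ := h'
      obtain ⟨s, hs⟩ : ∃ s : ℕ → B, ¬ φ.Realize s := by
        by_contra! hT
        exact hx ⟨φ, hφ, hT, rfl⟩
      obtain ⟨c, hc⟩ := exists_not_holds e φ (occurs_getElem? [] φ.encode) hs
      obtain ⟨y, hy, hiff⟩ := exists_certificate hk .ex e hφ c s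
      exact ⟨y, hy, (Bool.not_eq_true' _).mpr (Bool.eq_false_iff.2 (mt hiff.1 hc))⟩
    -- A word that is not a sentence is rejected with every certificate, so the empty one serves.
    · refine ⟨[], by simp, ?_⟩
      exact (Bool.not_eq_true' _).mpr (Bool.eq_false_iff.2 (mt exists_of_certCheck h'))
  · rintro ⟨y, -, hy⟩ ⟨φ, hφ, hT, rfl⟩
    have H : φ.Holds (strategy (fun j => φ.encode[j]?) .ex e
        fun j => (y[j]?.map (Finite.equivFin B).symm).getD e) 0 fun _ => e :=
      holds_of_realize hh he (fun j hj => strategy_of_eq hj _ _) φ (occurs_getElem? [] φ.encode)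
        (s := fun _ => e) (fun i => he e) (hT _)
    rw [← certCheck_append hk .ex e hφ y] at H
    have hy : (!certCheck (σ := σ) k .ex e (φ.encode.map Sum.inl ++ y.map Sum.inr)) = true := hy
    rw [H] at hy
    simp at hy

theorem inLogspace_of_isAShop_of_isEShop {h g : B → Set B} (hh : IsShe σ h) {a : B}
    (ha : h a = Set.univ) (hg : IsShe σ g) {e : B} (he : ∀ b, e ∈ g b) :
    InLogspace (positiveEvaluation σ B) := by
  obtain ⟨k, hk⟩ := exists_arity_le σ
  let t : List (Token σ) → ℕ → Option (Token σ) := fun w j => w[j]?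
  have ht : LogFn t := by
    have : LogFn fun (w : List (Token σ)) j => (match OfflineTM.inputAt w (j + 1) with
        | .letter a => some a
        | _ => none : Option (Token σ)) :=
      .finMap (.symbol (.succ .id)) fun a : InputSymbol (Token σ) =>
        match a with
        | .letter a => some a
        | _ => none
    convert this using 3 with w j
    simp only [t, OfflineTM.inputAt]
    cases w[j]? <;> rfl
  -- Universal quantifiers get `a` and all others `e`; no certificate is left.
  have hval := logFn_strategy ht (.finConst e) .all a
  have key := (logFn_check (k := k) ht hval).inLogspace
  refine (congrArg InLogspace (Set.ext fun x => ?_)).mpr key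
  constructor
  · rintro ⟨φ, hφ, hT, rfl⟩
    refine (check_encode hk hφ le_rfl _ fun _ => e).2 ?_
    refine holds_of_realize hg he (fun j hj => ?_) φ (occurs_getElem? [] φ.encode)
      (s := fun _ => e) (fun i => he e) (hT _)
    simp only [List.nil_append] at hj
    simp [strategy, t, hj]
  · intro hx
    obtain ⟨φ, hφ, rfl⟩ := exists_of_check le_rfl hx
    refine ⟨φ, hφ, fun s => ?_, rfl⟩
    exact realize_of_holds hh ha (fun j hj => strategy_of_eq hj _ _) φ
      (occurs_getElem? [] φ.encode) (s := fun _ => a) (fun i => by rw [ha]; trivial)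
      ((check_encode hk hφ le_rfl _ _).1 hx)

end Main

theorem mainTheorem6 (σ : FirstOrder.Language.{u, v}) [σ.IsRelational]
    [Finite (Σ n, σ.Relations n)] (B : Type w) [Finite B] [σ.Structure B] :
    ((∃ f : B → Set B, IsShe σ f ∧ IsAShop f) → InNP (positiveEvaluation σ B)) ∧
    ((∃ f : B → Set B, IsShe σ f ∧ IsEShop f) → InCoNP (positiveEvaluation σ B)) ∧
    ((∃ f : B → Set B, IsShe σ f ∧ IsAShop f) → (∃ f : B → Set B, IsShe σ f ∧ IsEShop f) →
      InLogspace (positiveEvaluation σ B)) := by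
  refine ⟨?_, ?_, ?_⟩
  · rintro ⟨h, hh, -, a, ha⟩
    exact inNP_of_isAShop hh ha
  · rintro ⟨h, hh, -, e, he⟩
    exact inCoNP_of_isEShop hh he
  · rintro ⟨h, hh, -, a, ha⟩ ⟨g, hg, -, e, he⟩
    exact inLogspace_of_isAShop_of_isEShop hh ha hg he
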